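/- Let $\Delta(d)=\{p\in\mathbb{R}^d: p_i\ge 0,\ \sum_i p_i=1\}$ and $\mathrm{KL}(p\|q)=\sum_i p_i\ln(p_i/q_i)\in[0,\infty]$. For $m\ge 0$ write $x\sim\mathrm{Poi}(mp)$ for a histogram $x\in\mathbb{N}^d$ with independent counts $x_i\sim\mathrm{Poi}(mp_i)$. A randomized algorithm $\mathcal{A}$ is $(\varepsilon,\delta)$-DP if $\Pr[\mathcal{A}(x)\in T]\le e^{\varepsilon}\Pr[\mathcal{A}(y)\in T]+\delta$ for every measurable $T$ and all datasets $x,y$ that differ in at most one record (histograms at $\ell_1$ distance at most $1$); $\varepsilon$-DP means $(\varepsilon,0)$-DP. For a map $N$ assigning to each $p\in\Delta(d)$ a set $N(p)\subseteq\Delta(d)$, let $$\mathrm{lower}(p,n,N)=\inf_{\mathcal{A}}\ \sup_{q\in N(p)}\ \mathbb{E}_{x\sim\mathrm{Poi}(nq)}\big[\mathrm{KL}(q\|\mathcal{A}(x))\big],$$ the infimum being over all randomized estimators $\mathcal{A}:\mathbb{N}^d\to\Delta(d)$, and let $\mathrm{lower}_{\varepsilon,\delta}(p,n,N)$ be the same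 quantity with the infimum restricted to $(\varepsilon,\delta)$-DP estimators. For $r>0$ define $$N_{\le r}(p)=\Big\{q\in\Delta(d): |q_i-p_i|\le r\ \forall i,\ \sum_{i:p_i\le r}q_i\le\max\Big\{r,\sum_{i:p_i\le r}p_i\Big\}\Big\},$$ $$N_{stat}(p)=\Big\{q\in\Delta(d): |q_i-p_i|\le\min\big\{p_i,\sqrt{p_i/n}\big\}\ \forall i\Big\}\cup\Big\{q\in\Delta(d): \sum_i|q_i-p_i|\le\tfrac1n\Big\}.$$ Private "sampling twice" algorithm: let $\alpha=\tfrac12$, $\tau=4\ln d$, $\varepsilon>0$ and $\underline{\varepsilon}=\min\{\varepsilon,1\}$. The input is a pair of histograms $(x,x')$. Draw independent $\mathrm{Lap}(0,1/\varepsilon)$ variables $z_1,\dots,z_d$, $\zeta$, $z_1',\dots,z_d'$; put $\tilde x_i=x_i+z_i$, $\tilde x_i'=x_i'+z_i'$ and $L=\{i:\tilde x_i\le\tau/\underline{\varepsilon}\}$. Let $\tilde c=\max\{\sum_{i\in L}x_i'+\zeta,\ 1/\underline{\varepsilon}\}$ if $L\ne\emptyset$, and $\tilde c=0$ if $L=\emptyset$.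 Let $\bar x_i=\max\{\tilde x_i,1/\underline{\varepsilon}\}$ for $i\in L$, $\bar x_i=(1-\alpha)\big(\max\{\tilde x_i,1/\underline{\varepsilon}\}+\max\{\tilde x_i',1/\underline{\varepsilon}\}\big)$ for $i\notin L$, and $N=\tilde c+\sum_{i\notin L}\bar x_i$. The output is $\mathcal{A}(x,x')\in\Delta(d)$ with $\mathcal{A}(x,x')_i=\frac1N\,\tilde c\,\frac{\bar x_i}{\sum_{j\in L}\bar x_j}$ for $i\in L$ and $\mathcal{A}(x,x')_i=\frac1N\,\bar x_i$ for $i\notin L$. Corollary. There is an absolute constant $C$ such that for all integers $d\ge2$, $n\ge1$, all $\varepsilon>0$, $0\le\delta\le\varepsilon$ and all $p\in\Delta(d)$, with $t=6\tau=24\ln d$: the algorithm $\mathcal{A}$ is $\varepsilon$-DP (as a function of the pair $(x,x')$), and, for independent $x\sim\mathrm{Poi}(\alpha np)$ and $x'\sim\mathrm{Poi}((1-\alpha)np)$, $$\mathbb{E}\big[\mathrm{KL}(p\|\mathcal{A}(x,x'))\big]\le C\Big(\mathrm{lower}(p,n,N_{stat})+\mathrm{lower}(p,n,N_{\le t/n})+\mathrm{lower}_{\varepsilon,\delta}(p,n,N_{\le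 1/(n\varepsilon)})+\mathrm{lower}_{\varepsilon,\delta}(p,n,N_{\le t/(n\varepsilon)})\Big).$$ -/

import Mathlib

open MeasureTheory ProbabilityTheory
open scoped ENNReal NNReal

namespace PrivateKL

noncomputable section

/-- The Laplace distribution `Lap(0, b)` with mean zero and scale `b > 0`. -/
def laplaceMeasure (b : ℝ) : Measure ℝ :=
  volume.withDensity fun z => ENNReal.ofReal (Real.exp (-|z| / b) / (2 * b))

/-- The law of a histogram of `d` independent counts `x i ∼ Poi(m * p i)`. -/
def poissonHistogram {d : ℕ} (m : ℝ) (p : stdSimplex ℝ (Fin d)) : Measure (Fin d → ℕ) :=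
  Measure.pi fun i => poissonMeasure (m * p i).toNNReal

/-- `KL(p ‖ q) = ∑ i, p i * ln (p i / q i)` for probability vectors, with the usual value `∞` when
`q` vanishes somewhere where `p` does not. -/
def kl {d : ℕ} (p q : Fin d → ℝ) : ℝ≥0∞ :=
  open Classical in
  if ∃ i, p i ≠ 0 ∧ q i = 0 then ⊤ else ENNReal.ofReal (∑ i, p i * Real.log (p i / q i))

/-- The `ℓ¹` distance of two histograms. -/
def histDist {d : ℕ} (x y : Fin d → ℕ) : ℕ :=
  ∑ i, Nat.dist (x i) (y i)

/-- A randomized algorithm, given by the law `M x` of its output on each dataset `x`, is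
`(ε, δ)`-differentially private for the neighbouring relation `adj` on datasets. -/
def IsDP {X Y : Type*} [MeasurableSpace Y] (adj : X → X → Prop) (ε δ : ℝ)
    (M : X → Measure Y) : Prop :=
  ∀ x y, adj x y → ∀ T, MeasurableSet T →
    M x T ≤ ENNReal.ofReal (Real.exp ε) * M y T + ENNReal.ofReal δ

/-- The expected KL error at `q` of a (randomized) estimator `A` on a sample `x ∼ Poi(n q)`. -/
def expectedKL {d : ℕ} (n : ℕ) (q : stdSimplex ℝ (Fin d))
    (A : Kernel (Fin d → ℕ) (stdSimplex ℝ (Fin d))) : ℝ≥0∞ :=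
  ∫⁻ x, ∫⁻ a, kl q a ∂(A x) ∂(poissonHistogram n q)

/-- The per-instance lower bound `lower(p, n, N)` for a neighbourhood map `N`: the infimum over all
randomized estimators of the worst expected KL error over `N p`. -/
def lower {d : ℕ} (p : stdSimplex ℝ (Fin d)) (n : ℕ)
    (N : stdSimplex ℝ (Fin d) → Set (stdSimplex ℝ (Fin d))) : ℝ≥0∞ :=
  ⨅ (A : Kernel (Fin d → ℕ) (stdSimplex ℝ (Fin d))) (_ : IsMarkovKernel A),
    ⨆ q ∈ N p, expectedKL n q A

/-- The per-instance lower bound `lower_{ε,δ}(p, n, N)`: the infimum is over the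
`(ε, δ)`-differentially private estimators, where neighbouring histograms differ by one record. -/
def lowerDP {d : ℕ} (ε δ : ℝ) (p : stdSimplex ℝ (Fin d)) (n : ℕ)
    (N : stdSimplex ℝ (Fin d) → Set (stdSimplex ℝ (Fin d))) : ℝ≥0∞ :=
  ⨅ (A : Kernel (Fin d → ℕ) (stdSimplex ℝ (Fin d))) (_ : IsMarkovKernel A)
    (_ : IsDP (fun x y => histDist x y ≤ 1) ε δ A),
    ⨆ q ∈ N p, expectedKL n q A

/-- The neighbourhood `N_{≤ r}(p)` with perturbation scale `r` of every coordinate, under which the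
combined mass of the symbols with `p i ≤ r` stays at most `max {r, its mass under p}`. -/
def nbhdAdd {d : ℕ} (r : ℝ) (p : stdSimplex ℝ (Fin d)) : Set (stdSimplex ℝ (Fin d)) :=
  {q | (∀ i, |q i - p i| ≤ r) ∧
    ∑ i with p i ≤ r, q i ≤ max r (∑ i with p i ≤ r, p i)}

/-- The neighbourhood `N_stat(p)`. -/
def nbhdStat {d : ℕ} (n : ℕ) (p : stdSimplex ℝ (Fin d)) : Set (stdSimplex ℝ (Fin d)) :=
  {q | ∀ i, |q i - p i| ≤ min (p i) (√(p i / n))} ∪ {q | ∑ i, |q i - p i| ≤ 1 / n}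

/-- The noise used by the private "sampling twice" algorithm: `z` for the first histogram, `ζ` for
the combined mass, and `z'` for the second histogram. -/
structure Noise (d : ℕ) where
  z : Fin d → ℝ
  ζ : ℝ
  z' : Fin d → ℝ

namespace SamplingTwice

variable {d : ℕ} (α τ ε : ℝ) (x x' : Fin d → ℕ) (w : Noise d)

/-- The first noisy counts. -/
def noisy₁ (i : Fin d) : ℝ := x i + w.z i

/-- The second noisy counts. -/
def noisy₂ (i : Fin d) : ℝ := x' i + w.z' i

/-- The set `L` of symbols whose first noisy count is at most `τ / min {ε, 1}`. -/
def small : Finset (Fin d) := Finset.univ.filter fun i => noisy₁ x w i ≤ τ / min ε 1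

/-- The estimate of the combined mass of the symbols in `L`; it is zero if there is no such
symbol. -/
def mass : ℝ :=
  if small τ ε x w = ∅ then 0
  else max ((∑ i ∈ small τ ε x w, (x' i : ℝ)) + w.ζ) (1 / min ε 1)

/-- The truncated individual estimates. -/
def trunc (i : Fin d) : ℝ :=
  if i ∈ small τ ε x w then max (noisy₁ x w i) (1 / min ε 1)
  else (1 - α) * (max (noisy₁ x w i) (1 / min ε 1) + max (noisy₂ x' w i) (1 / min ε 1))

/-- The normalization constant. -/
def total : ℝ :=
  mass τ ε x x' w + ∑ i ∈ (small τ ε x w)ᶜ, trunc α τ ε x x' w i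

/-- The output of the algorithm. -/
def output (i : Fin d) : ℝ :=
  if i ∈ small τ ε x w then
    1 / total α τ ε x x' w * mass τ ε x x' w *
      (trunc α τ ε x x' w i / ∑ j ∈ small τ ε x w, trunc α τ ε x x' w j)
  else 1 / total α τ ε x x' w * trunc α τ ε x x' w i

/-- The output is a measurable function of the noise. -/
theorem measurable_output {d : ℕ} (α τ ε : ℝ) (x x' : Fin d → ℕ) :
    Measurable fun w : (Fin d → ℝ) × ℝ × (Fin d → ℝ) =>
      output α τ ε x x' ⟨w.1, w.2.1, w.2.2⟩ := by
  have hS : ∀ i, MeasurableSet {w : (Fin d → ℝ) × ℝ × (Fin d → ℝ) |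
      i ∈ small τ ε x ⟨w.1, w.2.1, w.2.2⟩} := fun i => by
    have : {w : (Fin d → ℝ) × ℝ × (Fin d → ℝ) | i ∈ small τ ε x ⟨w.1, w.2.1, w.2.2⟩} =
        {w | (x i : ℝ) + w.1 i ≤ τ / min ε 1} := by
      ext w
      exact Finset.mem_filter.trans (and_iff_right (Finset.mem_univ i))
    rw [this]
    exact measurableSet_le (by fun_prop) (by fun_prop)
  have ht : ∀ i, Measurable fun w : (Fin d → ℝ) × ℝ × (Fin d → ℝ) =>
      trunc α τ ε x x' ⟨w.1, w.2.1, w.2.2⟩ i := fun i => by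
    unfold trunc noisy₁ noisy₂
    exact Measurable.ite (hS i) (by fun_prop) (by fun_prop)
  have hsum : ∀ f : Fin d → ((Fin d → ℝ) × ℝ × (Fin d → ℝ)) → ℝ, (∀ i, Measurable (f i)) →
      Measurable fun w : (Fin d → ℝ) × ℝ × (Fin d → ℝ) =>
        ∑ i ∈ small τ ε x ⟨w.1, w.2.1, w.2.2⟩, f i w := fun f hf => by
    have : (fun w : (Fin d → ℝ) × ℝ × (Fin d → ℝ) =>
        ∑ i ∈ small τ ε x ⟨w.1, w.2.1, w.2.2⟩, f i w) = fun w =>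
        ∑ i, if i ∈ small τ ε x ⟨w.1, w.2.1, w.2.2⟩ then f i w else 0 := by
      funext w; rw [Finset.sum_ite_mem, Finset.univ_inter]
    rw [this]
    exact Finset.measurable_sum _ fun i _ => Measurable.ite (hS i) (hf i) measurable_const
  have hm : Measurable fun w : (Fin d → ℝ) × ℝ × (Fin d → ℝ) =>
      mass τ ε x x' ⟨w.1, w.2.1, w.2.2⟩ := by
    unfold mass
    refine Measurable.ite ?_ measurable_const
      (((hsum (fun i _ => (x' i : ℝ)) fun i => measurable_const).add (by fun_prop)).max
        measurable_const)
    have : {w : (Fin d → ℝ) × ℝ × (Fin d → ℝ) | small τ ε x ⟨w.1, w.2.1, w.2.2⟩ = ∅} =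
        ⋂ i, {w | i ∈ small τ ε x ⟨w.1, w.2.1, w.2.2⟩}ᶜ := by
      ext w; simp [Finset.eq_empty_iff_forall_notMem]
    rw [this]
    exact MeasurableSet.iInter fun i => (hS i).compl
  have hN : Measurable fun w : (Fin d → ℝ) × ℝ × (Fin d → ℝ) =>
      total α τ ε x x' ⟨w.1, w.2.1, w.2.2⟩ := by
    unfold total
    refine hm.add ?_
    have : (fun w : (Fin d → ℝ) × ℝ × (Fin d → ℝ) =>
        ∑ i ∈ (small τ ε x ⟨w.1, w.2.1, w.2.2⟩)ᶜ, trunc α τ ε x x' ⟨w.1, w.2.1, w.2.2⟩ i) =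
        fun w => ∑ i, trunc α τ ε x x' ⟨w.1, w.2.1, w.2.2⟩ i -
          ∑ i ∈ small τ ε x ⟨w.1, w.2.1, w.2.2⟩, trunc α τ ε x x' ⟨w.1, w.2.1, w.2.2⟩ i := by
      funext w; rw [eq_sub_iff_add_eq, add_comm]; exact Finset.sum_add_sum_compl _ _
    rw [this]
    exact (Finset.measurable_sum _ fun i _ => ht i).sub (hsum _ ht)
  refine measurable_pi_lambda _ fun i => ?_
  unfold output
  exact Measurable.ite (hS i)
    (((measurable_const.div hN).mul hm).mul ((ht i).div (hsum _ ht)))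
    ((measurable_const.div hN).mul (ht i))

/-- The output is a probability vector. -/
theorem output_mem_stdSimplex {d : ℕ} (hd : 0 < d) {α τ ε : ℝ} (hα : α < 1) (hε : 0 < ε)
    (x x' : Fin d → ℕ) (w : Noise d) : output α τ ε x x' w ∈ stdSimplex ℝ (Fin d) := by
  have hm : 0 < 1 / min ε 1 := by positivity
  have ht : ∀ i, 0 < trunc α τ ε x x' w i := fun i => by
    unfold trunc
    have h1 : 0 < max (noisy₁ x w i) (1 / min ε 1) := lt_max_of_lt_right hm
    have h2 : 0 < max (noisy₂ x' w i) (1 / min ε 1) := lt_max_of_lt_right hm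
    have h3 : 0 < 1 - α := by linarith
    split_ifs <;> positivity
  have hc : 0 ≤ mass τ ε x x' w := by
    unfold mass; split_ifs
    · exact le_rfl
    · exact (lt_max_of_lt_right hm).le
  have hs : 0 ≤ ∑ i ∈ (small τ ε x w)ᶜ, trunc α τ ε x x' w i :=
    Finset.sum_nonneg fun i _ => (ht i).le
  have hN : 0 < total α τ ε x x' w := by
    unfold total
    by_cases h : small τ ε x w = ∅
    · have : 0 < ∑ i ∈ (small τ ε x w)ᶜ, trunc α τ ε x x' w i := by
        rw [h, Finset.compl_empty]
        exact Finset.sum_pos (fun i _ => ht i) ⟨⟨0, hd⟩, Finset.mem_univ _⟩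
      linarith
    · have : 0 < mass τ ε x x' w := by
        unfold mass; rw [if_neg h]; exact lt_max_of_lt_right hm
      linarith
  constructor
  · intro i
    unfold output
    have := ht i
    have : 0 ≤ ∑ j ∈ small τ ε x w, trunc α τ ε x x' w j :=
      Finset.sum_nonneg fun i _ => (ht i).le
    split_ifs <;> positivity
  · rw [← Finset.sum_add_sum_compl (small τ ε x w)]
    have h1 : ∑ i ∈ small τ ε x w, output α τ ε x x' w i =
        1 / total α τ ε x x' w * mass τ ε x x' w := by
      rw [Finset.sum_congr rfl fun i hi => by unfold output; rw [if_pos hi], ← Finset.mul_sum,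
        ← Finset.sum_div]
      by_cases h : small τ ε x w = ∅
      · have : mass τ ε x x' w = 0 := by unfold mass; rw [if_pos h]
        simp [this]
      · rw [div_self, mul_one]
        exact (Finset.sum_pos (fun i _ => ht i) (Finset.nonempty_iff_ne_empty.2 h)).ne'
    have h2 : ∑ i ∈ (small τ ε x w)ᶜ, output α τ ε x x' w i =
        1 / total α τ ε x x' w * ∑ i ∈ (small τ ε x w)ᶜ, trunc α τ ε x x' w i := by
      rw [Finset.mul_sum]
      exact Finset.sum_congr rfl fun i hi => by
        unfold output; rw [if_neg (Finset.mem_compl.1 hi)]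
    rw [h1, h2, ← mul_add, ← total, one_div, inv_mul_cancel₀ hN.ne']

end SamplingTwice

/-- The law of the output of the private "sampling twice" algorithm with partition ratio `α`,
threshold `τ` and privacy parameter `ε` on the partitioned dataset `s = (x, x')`: the `2 d + 1`
noise variables are independent `Lap(0, 1 / ε)`. -/
def samplingTwice {d : ℕ} (α τ ε : ℝ) (s : (Fin d → ℕ) × (Fin d → ℕ)) : Measure (Fin d → ℝ) :=
  ((Measure.pi fun _ : Fin d => laplaceMeasure (1 / ε)).prod
    ((laplaceMeasure (1 / ε)).prod (Measure.pi fun _ : Fin d => laplaceMeasure (1 / ε)))).map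
    fun w => SamplingTwice.output α τ ε s.1 s.2 ⟨w.1, w.2.1, w.2.2⟩

/-- The expected KL error at `p` of the private "sampling twice" algorithm, run on independent
`x ∼ Poi(α n p)` and `x' ∼ Poi((1 - α) n p)`. -/
def samplingTwiceKL {d : ℕ} (α τ ε : ℝ) (n : ℕ) (p : stdSimplex ℝ (Fin d)) : ℝ≥0∞ :=
  ∫⁻ s, ∫⁻ a, kl p a ∂(samplingTwice α τ ε s)
    ∂((poissonHistogram (α * n) p).prod (poissonHistogram ((1 - α) * n) p))

end

end PrivateKL

open PrivateKL

/-! For probability vectors the relative entropy is the sum over symbols of `klTerm a b = a ln (a /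
b) - a + b`, and each term is nonnegative. The upper and lower bounds can therefore be compared
symbol by symbol. Put e = min {ε, 1}, E = n e and r = t / E. A symbol is light if p_i ≤ r and heavy
otherwise. Let P and k be the combined mass and the number of the light symbols.

Privacy: the set L depends on x and z only. Once L is fixed, a record of x' enters the output either
through the combined mass of L or through one second count outside L. Changing one record is thus
absorbed by shifting a single Laplace variable (`isDP_samplingTwice`).

Upper bound: since ln u ≤ u - 1, normalizing the output costs nothing. The same inequality shows
that, for every constant M > 0, the error is at most a sum of terms klTerm(a_i, b_i) over i ∉ L,
klTerm(a_i, b_i / M) over i ∈ L, and one term for the combined mass of L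
(`sum_mul_log_le_of_two_stage`). Poisson counts with Laplace noise have good exponential moments
(`HasMGFBound`). These give, up to constants, a cost 1/n + 1/(E² p_i) for each heavy symbol, at most
P ln M + P + k/(E M) for the light symbols together, and 1/E for the combined mass
(`samplingTwiceKL_le_sum`). The threshold τ = 4 ln d makes misclassification harmless as long as ln
M ≤ 1 + ln d.

Lower bound: Assouad's method is applied to a product family (`BlockDesign`) in which each block
moves a mass s from a reservoir to one of g places, or leaves it. The move is undetectable if n s²
is small compared with the masses involved (χ² bound), or if s is at most of order 1/E (privacy). A
block whose places are otherwise empty costs s (1 + ln g); a block with a single place of mass y ≥ s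
costs s² / y. Pairing up the heavy symbols in sorted order recovers 1/n each in N_stat and 1/(E²
p_i) each in N_{≤1/E}. For the light symbols, the design depends on how P compares with 1/E and with
k/E, and in each regime a choice of M makes the upper bound match (`exists_sum_small_le`).

Boundary cases: if E ≤ 2, the error is O(ln d), while N_{≤r} is the whole simplex and one block with
d - 1 places costs as much. If ε < 1, then δ ≤ ε allows (ε, δ) to be relaxed to (ε, ε). If ε ≥ 1,
then e = 1 and (1, 1)-privacy is vacuous, so the bounds for N_{≤t/n} hold for all estimators; the
extra privacy cost 1/(n² p_i) of a heavy symbol is then below 1/n. -/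

namespace PrivateKL

/-! ### Integration over finite products of probability measures. -/

section PiMeasure

variable {ι : Type*} [Fintype ι] {X : ι → Type*} [∀ i, MeasurableSpace (X i)]

/-- Fubini for one coordinate of a product of probability measures; the other coordinates may be
integrated against any family that agrees off that coordinate. -/
theorem lintegral_pi_update [DecidableEq ι] [∀ i, Nonempty (X i)] (μ ν : ∀ i, Measure (X i)) [∀ i, IsProbabilityMeasure (μ i)]
    [∀ i, IsProbabilityMeasure (ν i)] (i : ι) (h : ∀ j, j ≠ i → μ j = ν j)
    {f : (∀ i, X i) → ℝ≥0∞} (hf : Measurable f) :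
    ∫⁻ x, f x ∂Measure.pi ν =
      ∫⁻ x, ∫⁻ y, f (Function.update x i y) ∂(ν i) ∂Measure.pi μ := by
  have x₀ : ∀ i, X i := fun i => Classical.arbitrary _
  have hg : Measurable fun x => ∫⁻ y, f (Function.update x i y) ∂(ν i) :=
    Measurable.lintegral_prod_right'
      (f := fun q : (∀ i, X i) × X i => f (Function.update q.1 i q.2))
      (hf.comp measurable_update')
  rw [lintegral_eq_lmarginal_univ x₀, lintegral_eq_lmarginal_univ x₀,
    lmarginal_erase' f hf (Finset.mem_univ i), lmarginal_erase' _ hg (Finset.mem_univ i)]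
  -- The inner integral no longer depends on coordinate `i`, so integrating that coordinate against
  -- the probability measure `μ i` changes nothing.
  have h1 : (fun x => ∫⁻ z, ∫⁻ y, f (Function.update (Function.update x i z) i y) ∂(ν i) ∂(μ i))
      = fun x => ∫⁻ y, f (Function.update x i y) ∂(ν i) := by
    funext x; simp
  rw [h1]
  have h2 : (Measure.pi fun j : (Finset.univ.erase i : Finset ι) => μ j) =
      Measure.pi fun j : (Finset.univ.erase i : Finset ι) => ν j := by
    congr 1; funext j; exact h j (Finset.ne_of_mem_erase j.2)
  unfold lmarginal
  rw [h2]

theorem lintegral_pi_eval (μ : ∀ i, Measure (X i)) [∀ i, IsProbabilityMeasure (μ i)] (i : ι)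
    {f : X i → ℝ≥0∞} (hf : Measurable f) :
    ∫⁻ x, f (x i) ∂Measure.pi μ = ∫⁻ y, f y ∂(μ i) :=
  (measurePreserving_eval μ i).lintegral_comp hf

theorem lintegral_pi_prod (μ : ∀ i, Measure (X i)) [∀ i, IsProbabilityMeasure (μ i)]
    (s : Finset ι) (f : ∀ i, X i → ℝ≥0∞) (hf : ∀ i, Measurable (f i)) :
    ∫⁻ x, ∏ i ∈ s, f i (x i) ∂Measure.pi μ = ∏ i ∈ s, ∫⁻ y, f i y ∂(μ i) := by
  have := lintegral_prod_eq_prod_lintegral_of_indepFun (μ := Measure.pi μ) s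
    (fun i x => f i (x i)) (iIndepFun_pi fun i => (hf i).aemeasurable)
    fun i => (hf i).comp (measurable_pi_apply i)
  refine this.trans ?_
  exact Finset.prod_congr rfl fun i _ => lintegral_pi_eval μ i (hf i)

end PiMeasure

/-! ### Convolution and exponential moments of Poisson laws. -/

section Poisson

theorem lintegral_poissonMeasure (r : ℝ≥0) (f : ℕ → ℝ≥0∞) :
    ∫⁻ k, f k ∂(poissonMeasure r) =
      ∑' k : ℕ, ENNReal.ofReal (Real.exp (-r) * r ^ k / k.factorial) * f k := by
  rw [lintegral_countable']
  exact tsum_congr fun k => by rw [poissonMeasure_singleton, mul_comm]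

theorem lintegral_poissonMeasure_add (r a : ℝ≥0) (f : ℕ → ℝ≥0∞) :
    ∫⁻ k, f k ∂(poissonMeasure (r + a)) =
      ∫⁻ k, ∫⁻ w, f (k + w) ∂(poissonMeasure a) ∂(poissonMeasure r) := by
  rw [← poissonMeasure_conv_poissonMeasure, Measure.lintegral_conv .of_discrete]

theorem hasSum_poisson_pow (r c : ℝ) :
    HasSum (fun k : ℕ => Real.exp (-r) * r ^ k / k.factorial * c ^ k)
      (Real.exp (r * (c - 1))) := by
  have := (NormedSpace.expSeries_div_hasSum_exp (r * c)).mul_left (Real.exp (-r))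
  rw [← Real.exp_eq_exp_ℝ, ← Real.exp_add] at this
  convert! this using 1
  · funext k; rw [mul_pow]; ring
  · congr 1; ring

theorem lintegral_poisson_pow (r : ℝ≥0) {c : ℝ} (hc : 0 ≤ c) :
    ∫⁻ k, ENNReal.ofReal (c ^ k) ∂(poissonMeasure r) =
      ENNReal.ofReal (Real.exp (r * (c - 1))) := by
  rw [lintegral_poissonMeasure, ← (hasSum_poisson_pow r c).tsum_eq,
    ENNReal.ofReal_tsum_of_nonneg (fun k => by positivity) (hasSum_poisson_pow r c).summable]
  exact tsum_congr fun k => by rw [← ENNReal.ofReal_mul (by positivity)]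

theorem lintegral_poisson_exp (r : ℝ≥0) (s : ℝ) :
    ∫⁻ k : ℕ, ENNReal.ofReal (Real.exp (s * k)) ∂(poissonMeasure r) =
      ENNReal.ofReal (Real.exp (r * (Real.exp s - 1))) := by
  rw [← lintegral_poisson_pow r (Real.exp_pos s).le]
  congr 1; funext k
  rw [← Real.exp_nat_mul, mul_comm]

theorem lintegral_poisson_cast_mul_pow (r : ℝ≥0) {c : ℝ} (hc : 0 ≤ c) :
    ∫⁻ k : ℕ, ENNReal.ofReal (k * c ^ k) ∂(poissonMeasure r) =
      ENNReal.ofReal (r * c * Real.exp (r * (c - 1))) := by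
  have h0 : HasSum (fun k : ℕ => Real.exp (-r) * (r:ℝ) ^ k / k.factorial * (k * c ^ k))
      (r * c * Real.exp (r * (c - 1))) := by
    -- The term at `k = 0` vanishes; after the index shift the factor `k + 1` cancels against the
    -- factorial and leaves the generating function.
    rw [← hasSum_nat_add_iff' 1]
    simp only [Finset.range_one, Finset.sum_singleton, Nat.cast_zero, zero_mul, mul_zero, sub_zero]
    convert! (hasSum_poisson_pow r c).mul_left (r * c : ℝ) using 1
    funext k
    rw [Nat.factorial_succ]
    push_cast
    field_simp
    ring
  rw [lintegral_poissonMeasure, ← h0.tsum_eq,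
    ENNReal.ofReal_tsum_of_nonneg (fun k => by positivity) h0.summable]
  exact tsum_congr fun k => by rw [← ENNReal.ofReal_mul (by positivity)]

end Poisson

/-! ### Exponential moments and shifts of Laplace noise. -/

section Laplace

theorem lintegral_laplaceMeasure (b : ℝ) {f : ℝ → ℝ≥0∞} (hf : Measurable f) :
    ∫⁻ z, f z ∂(laplaceMeasure b) =
      ∫⁻ z, ENNReal.ofReal (Real.exp (-|z| / b) / (2 * b)) * f z := by
  rw [laplaceMeasure, lintegral_withDensity_eq_lintegral_mul _ (by fun_prop) hf]
  rfl

theorem lintegral_laplace_exp {b s : ℝ} (hb : 0 < b) (h1 : s * b < 1) (h2 : -1 < s * b) :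
    ∫⁻ z, ENNReal.ofReal (Real.exp (s * z)) ∂(laplaceMeasure b) =
      ENNReal.ofReal (1 / (1 - (s * b) ^ 2)) := by
  have ha : s - 1 / b < 0 := by
    rw [sub_neg, lt_div_iff₀ hb]; exact h1
  have hc : 0 < s + 1 / b := by
    rw [← neg_lt_iff_pos_add, ← neg_div, div_lt_iff₀ hb]; exact h2
  rw [lintegral_laplaceMeasure b (by fun_prop),
    ← lintegral_add_compl _ (measurableSet_Iic (a := (0 : ℝ))), Set.compl_Iic]
  have e1 : ∫⁻ z in Set.Iic (0 : ℝ), ENNReal.ofReal (Real.exp (-|z| / b) / (2 * b)) *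
      ENNReal.ofReal (Real.exp (s * z)) = ENNReal.ofReal (1 / (2 * b) * (1 / (s + 1 / b))) := by
    have : ∀ z ∈ Set.Iic (0 : ℝ), ENNReal.ofReal (Real.exp (-|z| / b) / (2 * b)) *
        ENNReal.ofReal (Real.exp (s * z)) =
        ENNReal.ofReal (1 / (2 * b)) * ENNReal.ofReal (Real.exp ((s + 1 / b) * z)) := by
      intro z hz
      rw [← ENNReal.ofReal_mul (by positivity), ← ENNReal.ofReal_mul (by positivity),
        abs_of_nonpos hz]
      congr 1
      rw [add_mul, Real.exp_add, neg_neg, one_div_mul_eq_div]; field_simp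
    rw [setLIntegral_congr_fun measurableSet_Iic this, lintegral_const_mul _ (by fun_prop),
      ← ofReal_integral_eq_lintegral_ofReal (integrableOn_exp_mul_Iic hc _)
        (Filter.Eventually.of_forall fun _ => (Real.exp_pos _).le), integral_exp_mul_Iic hc,
      ← ENNReal.ofReal_mul (by positivity)]
    simp
  have e2 : ∫⁻ z in Set.Ioi (0 : ℝ), ENNReal.ofReal (Real.exp (-|z| / b) / (2 * b)) *
      ENNReal.ofReal (Real.exp (s * z)) = ENNReal.ofReal (1 / (2 * b) * (-1 / (s - 1 / b))) := by
    have : ∀ z ∈ Set.Ioi (0 : ℝ), ENNReal.ofReal (Real.exp (-|z| / b) / (2 * b)) *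
        ENNReal.ofReal (Real.exp (s * z)) =
        ENNReal.ofReal (1 / (2 * b)) * ENNReal.ofReal (Real.exp ((s - 1 / b) * z)) := by
      intro z hz
      rw [← ENNReal.ofReal_mul (by positivity), ← ENNReal.ofReal_mul (by positivity),
        abs_of_pos hz]
      congr 1
      rw [sub_mul, Real.exp_sub, one_div_mul_eq_div, neg_div, Real.exp_neg]; field_simp
    rw [setLIntegral_congr_fun measurableSet_Ioi this, lintegral_const_mul _ (by fun_prop),
      ← ofReal_integral_eq_lintegral_ofReal (integrableOn_exp_mul_Ioi ha _)
        (Filter.Eventually.of_forall fun _ => (Real.exp_pos _).le), integral_exp_mul_Ioi ha,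
      ← ENNReal.ofReal_mul (by positivity)]
    simp
  have h3 : (s + 1 / b) ≠ 0 := hc.ne'
  have h4 : (s - 1 / b) ≠ 0 := ha.ne
  have p1 : 0 ≤ 1 / (2 * b) * (1 / (s + 1 / b)) := by positivity
  have p2 : 0 ≤ 1 / (2 * b) * (-1 / (s - 1 / b)) :=
    mul_nonneg (by positivity) (div_nonneg_of_nonpos (by norm_num) ha.le)
  rw [e1, e2, ← ENNReal.ofReal_add p1 p2]
  congr 1
  have h5 : (s * b + 1) ≠ 0 := by linarith
  have h6 : (s * b - 1) ≠ 0 := by linarith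
  have h7 : (1 - (s * b) ^ 2) ≠ 0 := by nlinarith
  have h8 : s + 1 / b = (s * b + 1) / b := by field_simp
  have h9 : s - 1 / b = (s * b - 1) / b := by field_simp
  rw [h8, h9, one_div_div, div_div_eq_mul_div]
  have h10 : 1 - (s * b) ^ 2 = -((s * b + 1) * (s * b - 1)) := by ring
  rw [h10]
  generalize s * b = u at *
  field_simp
  ring

theorem isProbabilityMeasure_laplaceMeasure {b : ℝ} (hb : 0 < b) :
    IsProbabilityMeasure (laplaceMeasure b) := by
  constructor
  have := lintegral_laplace_exp (s := 0) hb (by simp) (by simp)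
  simpa using this

/-- Shifting Laplace noise of scale `1 / ε` by at most one costs a factor `exp ε`. -/
theorem lintegral_laplace_shift_le {ε t : ℝ} (hε : 0 < ε) (ht : |t| ≤ 1) {f : ℝ → ℝ≥0∞}
    (hf : Measurable f) :
    ∫⁻ z, f (z + t) ∂(laplaceMeasure (1 / ε)) ≤
      ENNReal.ofReal (Real.exp ε) * ∫⁻ z, f z ∂(laplaceMeasure (1 / ε)) := by
  rw [lintegral_laplaceMeasure _ hf,
    lintegral_laplaceMeasure _ (f := fun z => f (z + t)) (by fun_prop),
    ← lintegral_const_mul _ (by fun_prop)]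
  -- The right-hand integral is translated by `t`, so that both sides carry `f (z + t)` and only the
  -- densities remain to be compared pointwise.
  rw [← lintegral_add_right_eq_self (fun z => ENNReal.ofReal (Real.exp ε) *
    (ENNReal.ofReal (Real.exp (-|z| / (1 / ε)) / (2 * (1 / ε))) * f z)) t]
  refine lintegral_mono fun z => ?_
  rw [← mul_assoc, ← ENNReal.ofReal_mul (Real.exp_pos _).le]
  refine mul_le_mul_left (ENNReal.ofReal_le_ofReal ?_) _
  rw [← mul_div_assoc (Real.exp ε), ← Real.exp_add]
  refine div_le_div_of_nonneg_right (Real.exp_le_exp.2 ?_) (by positivity)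
  have h : |z + t| ≤ |z| + 1 := (abs_add_le _ _).trans (by linarith)
  have e1 : -|z| / (1 / ε) = -(|z| * ε) := by field_simp
  have e2 : -|z + t| / (1 / ε) = -(|z + t| * ε) := by field_simp
  rw [e1, e2]; nlinarith

end Laplace

end PrivateKL

/-! ### Differential privacy of the sampling twice algorithm. -/

namespace PrivateKL

theorem lintegral_pi_laplace_shift_le {d : ℕ} {ε t : ℝ} (hε : 0 < ε) (ht : |t| ≤ 1) (i : Fin d)
    {f : (Fin d → ℝ) → ℝ≥0∞} (hf : Measurable f) :
    ∫⁻ z, f (Function.update z i (z i + t)) ∂(Measure.pi fun _ => laplaceMeasure (1 / ε)) ≤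
      ENNReal.ofReal (Real.exp ε) *
        ∫⁻ z, f z ∂(Measure.pi fun _ => laplaceMeasure (1 / ε)) := by
  have := isProbabilityMeasure_laplaceMeasure (b := 1 / ε) (by positivity)
  have hu : Measurable fun q : (Fin d → ℝ) × ℝ => f (Function.update q.1 i q.2) :=
    hf.comp measurable_update'
  have hm : Measurable fun z : Fin d → ℝ => f (Function.update z i (z i + t)) :=
    hu.comp (show Measurable fun z : Fin d → ℝ => (z, z i + t) by fun_prop)
  rw [lintegral_pi_update (fun _ : Fin d => laplaceMeasure (1 / ε)) _ i (fun _ _ => rfl) hf,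
    lintegral_pi_update (fun _ : Fin d => laplaceMeasure (1 / ε)) _ i (fun _ _ => rfl) hm,
    ← lintegral_const_mul _ (Measurable.lintegral_prod_right' hu)]
  refine lintegral_mono fun x => ?_
  simp only [Function.update_self, Function.update_idem]
  exact lintegral_laplace_shift_le hε ht (hu.comp measurable_prodMk_left)

theorem histDist_eq_zero {d : ℕ} {x y : Fin d → ℕ} (h : histDist x y = 0) : x = y := by
  funext i
  exact Nat.eq_of_dist_eq_zero ((Finset.sum_eq_zero_iff.1 h) i (Finset.mem_univ i))

theorem exists_shift_of_histDist_le_one {d : ℕ} (hd : 0 < d) {x y : Fin d → ℕ}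
    (h : histDist x y ≤ 1) :
    ∃ i, ∃ t : ℝ, |t| ≤ 1 ∧ ∀ j, (x j : ℝ) = y j + if j = i then t else 0 := by
  rcases Nat.eq_zero_or_pos (histDist x y) with h0 | h0
  · exact ⟨⟨0, hd⟩, 0, by simp, fun j => by simp [histDist_eq_zero h0]⟩
  obtain ⟨i, -, hi⟩ := Finset.exists_ne_zero_of_sum_ne_zero (Nat.pos_iff_ne_zero.1 h0)
  have hs := Finset.add_sum_erase Finset.univ (fun i => Nat.dist (x i) (y i)) (Finset.mem_univ i)
  unfold histDist at h
  have hi1 : Nat.dist (x i) (y i) ≤ 1 := by omega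
  have hrest : ∑ j ∈ Finset.univ.erase i, Nat.dist (x j) (y j) = 0 := by omega
  refine ⟨i, (x i : ℝ) - y i, ?_, fun j => ?_⟩
  · rw [abs_le]
    unfold Nat.dist at hi1
    have h1 : x i ≤ y i + 1 := by omega
    have h2 : y i ≤ x i + 1 := by omega
    have h1' : (x i : ℝ) ≤ y i + 1 := by exact_mod_cast h1
    have h2' : (y i : ℝ) ≤ x i + 1 := by exact_mod_cast h2
    constructor <;> linarith
  · by_cases hj : j = i
    · subst hj; simp
    · have := Finset.sum_eq_zero_iff.1 hrest j (Finset.mem_erase.2 ⟨hj, Finset.mem_univ j⟩)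
      simp [hj, Nat.eq_of_dist_eq_zero this]

namespace SamplingTwice

/-- The output depends on the data only through the noisy counts that are actually used. -/
theorem output_congr {d : ℕ} {α τ ε : ℝ} {x x' y y' : Fin d → ℕ} {w v : Noise d}
    (h1 : ∀ i, noisy₁ x w i = noisy₁ y v i)
    (hm : (∑ i ∈ small τ ε y v, (x' i : ℝ)) + w.ζ = (∑ i ∈ small τ ε y v, (y' i : ℝ)) + v.ζ)
    (h2 : ∀ i ∉ small τ ε y v, noisy₂ x' w i = noisy₂ y' v i) :
    output α τ ε x x' w = output α τ ε y y' v := by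
  have hs : small τ ε x w = small τ ε y v := by
    unfold small; simp only [h1]
  have ht : trunc α τ ε x x' w = trunc α τ ε y y' v := by
    funext i
    unfold trunc
    rw [hs, h1]
    split_ifs with h
    · rfl
    · rw [h2 i h]
  have hmass : mass τ ε x x' w = mass τ ε y y' v := by
    unfold mass; rw [hs, hm]
  funext i
  unfold output total
  rw [hs, ht, hmass]

end SamplingTwice

open SamplingTwice

theorem measurable_output_comp {Ω : Type*} [MeasurableSpace Ω] {d : ℕ} (α τ ε : ℝ)
    (x x' : Fin d → ℕ) {z z' : Ω → Fin d → ℝ} {ζ : Ω → ℝ} (hz : Measurable z)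
    (hζ : Measurable ζ) (hz' : Measurable z') :
    Measurable fun ω => output α τ ε x x' ⟨z ω, ζ ω, z' ω⟩ := by
  have hg : Measurable fun ω => (z ω, ζ ω, z' ω) := hz.prodMk (hζ.prodMk hz')
  have h := (measurable_output α τ ε x x').comp hg
  simpa only [Function.comp_def] using h

theorem samplingTwice_apply {d : ℕ} {α τ ε : ℝ} (hε : 0 < ε)
    (s : (Fin d → ℕ) × (Fin d → ℕ)) {T : Set (Fin d → ℝ)} (hT : MeasurableSet T) :
    samplingTwice α τ ε s T =
      ∫⁻ z, ∫⁻ ζ, ∫⁻ z', T.indicator 1 (output α τ ε s.1 s.2 ⟨z, ζ, z'⟩)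
        ∂(Measure.pi fun _ => laplaceMeasure (1 / ε)) ∂(laplaceMeasure (1 / ε))
        ∂(Measure.pi fun _ => laplaceMeasure (1 / ε)) := by
  have := isProbabilityMeasure_laplaceMeasure (b := 1 / ε) (by positivity)
  have hm := measurable_output α τ ε s.1 s.2
  have hi : Measurable fun w : (Fin d → ℝ) × ℝ × (Fin d → ℝ) =>
      T.indicator (1 : (Fin d → ℝ) → ℝ≥0∞) (output α τ ε s.1 s.2 ⟨w.1, w.2.1, w.2.2⟩) :=
    (measurable_one.indicator hT).comp hm
  rw [← lintegral_indicator_one hT, samplingTwice,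
    lintegral_map (measurable_one.indicator hT) hm, lintegral_prod _ hi.aemeasurable]
  refine lintegral_congr fun z => ?_
  rw [lintegral_prod]
  exact (hi.comp measurable_prodMk_left).aemeasurable

/-- Only one of the two histograms changes, and only in one symbol `i`. A change in the first is
absorbed by shifting `z i`. A change in the second is absorbed, for fixed `z`, by shifting `ζ` if `i
∈ L` and `z' i` otherwise, because second counts inside L are used only through their sum. Each case
pays for one Laplace shift, so the budget `ε` is spent once although three kinds of noisy statistics
are released. -/
theorem isDP_samplingTwice {d : ℕ} (hd : 0 < d) (α τ : ℝ) {ε : ℝ} (hε : 0 < ε) :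
    IsDP (fun s s' : (Fin d → ℕ) × (Fin d → ℕ) =>
      histDist s.1 s'.1 + histDist s.2 s'.2 ≤ 1) ε 0 (samplingTwice α τ ε) := by
  have := isProbabilityMeasure_laplaceMeasure (b := 1 / ε) (by positivity)
  rintro ⟨x, x'⟩ ⟨y, y'⟩ h T hT
  simp only at h
  rw [ENNReal.ofReal_zero, add_zero, samplingTwice_apply hε _ hT, samplingTwice_apply hε _ hT]
  have hi2 : Measurable fun w : ((Fin d → ℝ) × ℝ) × (Fin d → ℝ) =>
      T.indicator (1 : (Fin d → ℝ) → ℝ≥0∞) (output α τ ε y y' ⟨w.1.1, w.1.2, w.2⟩) :=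
    (measurable_one.indicator hT).comp
      (measurable_output_comp α τ ε y y' (by fun_prop) (by fun_prop) (by fun_prop))
  have hi3 := Measurable.lintegral_prod_right'
    (ν := Measure.pi fun _ : Fin d => laplaceMeasure (1 / ε)) hi2
  have hi4 := Measurable.lintegral_prod_right' (ν := laplaceMeasure (1 / ε)) hi3
  by_cases hx : histDist x' y' = 0
  · have hx' := histDist_eq_zero hx
    obtain ⟨i, t, ht, hxy⟩ := exists_shift_of_histDist_le_one hd (x := x) (y := y) (by omega)
    refine le_trans (le_of_eq ?_) (lintegral_pi_laplace_shift_le hε ht i hi4)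
    refine lintegral_congr fun z => lintegral_congr fun ζ => lintegral_congr fun z' => ?_
    refine congrArg _ (output_congr (fun j => ?_) (by rw [hx']) fun j _ => by rw [hx']; rfl)
    unfold noisy₁
    rw [hxy]
    by_cases hj : j = i
    · subst hj; simp; ring
    · simp [hj]
  · have hx' := histDist_eq_zero (show histDist x y = 0 by omega)
    obtain ⟨i, t, ht, hxy⟩ := exists_shift_of_histDist_le_one hd (x := x') (y := y') (by omega)
    rw [hx', ← lintegral_const_mul _ hi4]
    refine lintegral_mono fun z => ?_
    -- Membership in L ignores `ζ` and `z'`, so the case distinction can be made after fixing `z`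
    -- alone.
    have hsmall : ∀ (ζ : ℝ) (v : Fin d → ℝ),
        i ∈ small τ ε y ⟨z, ζ, v⟩ ↔ i ∈ small τ ε y ⟨z, 0, 0⟩ := fun _ _ => Iff.rfl
    by_cases hL : i ∈ small τ ε y ⟨z, 0, 0⟩
    · refine le_trans (le_of_eq ?_) (lintegral_laplace_shift_le hε ht
        (hi3.comp (measurable_prodMk_left (x := z))))
      refine lintegral_congr fun ζ => lintegral_congr fun z' => ?_
      refine congrArg _ (output_congr (fun j => rfl) ?_ fun j hj => ?_)
      · simp only [hxy, Finset.sum_add_distrib]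
        rw [Finset.sum_ite_eq' _ i, if_pos ((hsmall _ _).2 hL)]
        ring
      · unfold noisy₂
        rw [hxy, if_neg, add_zero]
        rintro rfl
        exact hj ((hsmall _ _).2 hL)
    · have hi5 := hi3.comp (measurable_prodMk_left (x := z))
      simp only [Function.comp_def] at hi5
      rw [← lintegral_const_mul _ hi5]
      refine lintegral_mono fun ζ => ?_
      have hi6 := hi2.comp (measurable_prodMk_left (x := (z, ζ)))
      simp only [Function.comp_def] at hi6
      refine le_trans (le_of_eq ?_) (lintegral_pi_laplace_shift_le hε ht i hi6)
      refine lintegral_congr fun z' => ?_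
      refine congrArg _ (output_congr (fun j => rfl) ?_ fun j _ => ?_)
      · simp only [hxy, Finset.sum_add_distrib]
        rw [Finset.sum_ite_eq' _ i, if_neg fun h => hL ((hsmall _ _).1 h), add_zero]
      · unfold noisy₂
        rw [hxy]
        by_cases hj : j = i
        · subst hj; simp; ring
        · simp [hj]

end PrivateKL

/-! ### The pointwise relative entropy and its elementary bounds. -/

namespace PrivateKL

noncomputable section

/-- The pointwise (unnormalized) relative entropy `a ln (a / b) - a + b`. -/
def klTerm (a b : ℝ) : ℝ := a * Real.log (a / b) - a + b

theorem klTerm_zero_left (b : ℝ) : klTerm 0 b = b := by simp [klTerm]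

/-- Comparison with the Hellinger distance: apply ln u ≥ 1 - 1/u to u = √(a / b). -/
theorem sq_sqrt_sub_le_klTerm {a b : ℝ} (ha : 0 ≤ a) (hb : 0 < b) :
    (√a - √b) ^ 2 ≤ klTerm a b := by
  rcases ha.eq_or_lt with rfl | ha
  · simp [klTerm_zero_left, Real.sq_sqrt hb.le]
  have h1 := Real.one_sub_inv_le_log_of_pos (x := √a / √b) (by positivity)
  have h2 : Real.log (a / b) = 2 * Real.log (√a / √b) := by
    rw [← Real.sqrt_div ha.le, Real.log_sqrt (by positivity)]; ring
  have h3 : a * (√a / √b)⁻¹ = √a * √b := by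
    have : √a ≠ 0 := by positivity
    rw [inv_div]; field_simp; rw [Real.sq_sqrt ha.le]
  unfold klTerm
  rw [h2, sub_sq, Real.sq_sqrt ha.le, Real.sq_sqrt hb.le]
  nlinarith [mul_le_mul_of_nonneg_left h1 ha.le]

theorem klTerm_nonneg {a b : ℝ} (ha : 0 ≤ a) (hb : 0 < b) : 0 ≤ klTerm a b :=
  (sq_nonneg _).trans (sq_sqrt_sub_le_klTerm ha hb)

/-- Follows from the Hellinger bound, as a - b = (√a - √b)(√a + √b) and (√a + √b)² ≤ 2 (a + b) ≤ 4
m. -/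
theorem sq_sub_div_le_klTerm {a b m : ℝ} (ha : 0 ≤ a) (hb : 0 < b) (ham : a ≤ m) (hbm : b ≤ m) :
    (a - b) ^ 2 / (4 * m) ≤ klTerm a b := by
  have hm : 0 < m := hb.trans_le hbm
  refine le_trans ?_ (sq_sqrt_sub_le_klTerm ha hb)
  rw [div_le_iff₀ (by positivity)]
  have e : a - b = (√a - √b) * (√a + √b) := by
    nlinarith [Real.sq_sqrt ha, Real.sq_sqrt hb.le]
  rw [e, mul_pow]
  refine mul_le_mul_of_nonneg_left ?_ (sq_nonneg _)
  nlinarith [Real.sq_sqrt ha, Real.sq_sqrt hb.le, sq_nonneg (√a - √b)]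

theorem klTerm_le {a b : ℝ} (ha : 0 ≤ a) (hb : 0 < b) : klTerm a b ≤ (a - b) ^ 2 / b := by
  rcases ha.eq_or_lt with rfl | ha
  · rw [klTerm_zero_left]; apply le_of_eq; field_simp; ring
  have h1 := Real.log_le_sub_one_of_pos (x := a / b) (by positivity)
  have : (a - b) ^ 2 / b = a * (a / b - 1) - a + b := by field_simp; ring
  rw [this]; unfold klTerm
  nlinarith [mul_le_mul_of_nonneg_left h1 ha.le]

/-- The loss forced by an estimate capped at `θ`; the logarithm is decreasing in `b` and the summand
`b ≥ 0` is dropped. -/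
theorem mul_log_sub_le_klTerm {a b θ : ℝ} (ha : 0 ≤ a) (hb : 0 < b) (h : b ≤ θ) :
    a * Real.log (a / θ) - a ≤ klTerm a b := by
  rcases ha.eq_or_lt with rfl | ha
  · simpa [klTerm] using hb.le
  have : Real.log (a / θ) ≤ Real.log (a / b) :=
    Real.log_le_log (by have := hb.trans_le h; positivity) (by gcongr)
  unfold klTerm
  nlinarith [mul_le_mul_of_nonneg_left this ha.le]

/-- Convexity in the second argument. It separates the two noisy counts that the algorithm averages
outside L when α = 1/2. -/
theorem klTerm_half_add_le {a b c : ℝ} (ha : 0 ≤ a) (hb : 0 < b) (hc : 0 < c) :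
    klTerm a ((b + c) / 2) ≤ (klTerm a b + klTerm a c) / 2 := by
  rcases ha.eq_or_lt with rfl | ha
  · simp [klTerm_zero_left]
  have h := (strictConcaveOn_log_Ioi.concaveOn).2 (Set.mem_Ioi.2 hb) (Set.mem_Ioi.2 hc)
    (by norm_num : (0 : ℝ) ≤ 1 / 2) (by norm_num : (0 : ℝ) ≤ 1 / 2) (by norm_num)
  simp only [smul_eq_mul] at h
  have e : (b + c) / 2 = 1 / 2 * b + 1 / 2 * c := by ring
  unfold klTerm
  rw [Real.log_div ha.ne' hb.ne', Real.log_div ha.ne' hc.ne', Real.log_div ha.ne' (by positivity), e]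
  nlinarith [mul_le_mul_of_nonneg_left h ha.le]

/-- `klTerm` with the value `∞` at `b = 0 ≠ a`. -/
def eklTerm (a b : ℝ) : ℝ≥0∞ :=
  open Classical in if a ≠ 0 ∧ b = 0 then ⊤ else ENNReal.ofReal (klTerm a b)

theorem measurable_eklTerm (a : ℝ) : Measurable (eklTerm a) := by
  unfold eklTerm
  refine Measurable.ite ?_ measurable_const ?_
  · by_cases h : a = 0
    · simp [h]
    · simp [h]
  · unfold klTerm; fun_prop

theorem eklTerm_of_pos (a : ℝ) {b : ℝ} (hb : b ≠ 0) :
    eklTerm a b = ENNReal.ofReal (klTerm a b) := if_neg fun h => hb h.2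

theorem eklTerm_zero (b : ℝ) : eklTerm 0 b = ENNReal.ofReal b := by
  simp [eklTerm, klTerm_zero_left]

theorem ofReal_sq_sub_div_le_eklTerm {a b m : ℝ} (ha : 0 ≤ a) (hb : 0 ≤ b) (ham : a ≤ m)
    (hbm : b ≤ m) : ENNReal.ofReal ((a - b) ^ 2 / (4 * m)) ≤ eklTerm a b := by
  rcases hb.eq_or_lt with rfl | hb
  · unfold eklTerm
    split_ifs with h
    · exact le_top
    · simp only [and_true, not_not] at h; simp [h]
  · rw [eklTerm_of_pos _ hb.ne']
    exact ENNReal.ofReal_le_ofReal (sq_sub_div_le_klTerm ha hb ham hbm)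

theorem ofReal_mul_log_sub_le_eklTerm {a b θ : ℝ} (ha : 0 < a) (hb : 0 ≤ b) (h : b ≤ θ) :
    ENNReal.ofReal (a * Real.log (a / θ) - a) ≤ eklTerm a b := by
  rcases hb.eq_or_lt with rfl | hb
  · simp [eklTerm, ha.ne']
  · rw [eklTerm_of_pos _ hb.ne']
    exact ENNReal.ofReal_le_ofReal (mul_log_sub_le_klTerm ha.le hb h)

/-- The correction terms -a + b cancel because both vectors sum to one. Their presence makes every
summand nonnegative, so that parts of the sum can be discarded in lower bounds. -/
theorem kl_eq_sum_eklTerm {d : ℕ} (p q : stdSimplex ℝ (Fin d)) :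
    kl p q = ∑ i, eklTerm (p i) (q i) := by
  by_cases h : ∃ i, p i ≠ 0 ∧ q i = 0
  · obtain ⟨i, hi⟩ := h
    rw [kl, if_pos ⟨i, hi⟩, eq_comm, ENNReal.sum_eq_top]
    exact ⟨i, Finset.mem_univ i, if_pos hi⟩
  · rw [kl, if_neg h]
    push Not at h
    have hz : ∀ i, eklTerm (p i) (q i) = ENNReal.ofReal (klTerm (p i) (q i)) := fun i =>
      if_neg fun hi => h i hi.1 hi.2
    have hn : ∀ i, 0 ≤ klTerm (p i) (q i) := fun i => by
      by_cases hq : q i = 0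
      · have hp : p i = 0 := by by_contra hp; exact h i hp hq
        rw [hp, klTerm_zero_left]; exact q.2.1 i
      · exact klTerm_nonneg (p.2.1 i) (lt_of_le_of_ne (q.2.1 i) (Ne.symm hq))
    rw [Finset.sum_congr rfl fun i _ => hz i, ← ENNReal.ofReal_sum_of_nonneg fun i _ => hn i]
    congr 1
    have hp := p.2.2
    have hq := q.2.2
    unfold klTerm
    rw [Finset.sum_add_distrib, Finset.sum_sub_distrib]
    change ∑ i, p i = 1 at hp
    change ∑ i, q i = 1 at hq
    rw [hp, hq]; ring

end

end PrivateKL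

/-! ### Stability of expectations when a Poisson mean changes. -/

namespace PrivateKL

section Step

/-- Group privacy. The exact additive error is η (1 + B + ... + B^(w-1)); the cruder η w B^w has a
simple Poisson expectation. -/
theorem le_of_step {B η : ℝ} (hB : 1 ≤ B) (hη : 0 ≤ η) {f : ℕ → ℝ≥0∞}
    (h : ∀ k, f (k + 1) ≤ ENNReal.ofReal B * f k + ENNReal.ofReal η) (k w : ℕ) :
    f (k + w) ≤ ENNReal.ofReal (B ^ w) * f k + ENNReal.ofReal (η * (w * B ^ w)) := by
  induction w with
  | zero => simp
  | succ w ih =>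
    have hB0 : 0 ≤ B := by linarith
    calc f (k + (w + 1)) ≤ ENNReal.ofReal B * f (k + w) + ENNReal.ofReal η := h (k + w)
      _ ≤ ENNReal.ofReal B * (ENNReal.ofReal (B ^ w) * f k + ENNReal.ofReal (η * (w * B ^ w)))
          + ENNReal.ofReal η := by gcongr
      _ = ENNReal.ofReal (B ^ (w + 1)) * f k + ENNReal.ofReal (B * (η * (w * B ^ w)) + η) := by
        rw [mul_add, ← mul_assoc, ← ENNReal.ofReal_mul hB0, ← ENNReal.ofReal_mul hB0, add_assoc,
          ← ENNReal.ofReal_add (by positivity) hη, pow_succ']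
      _ ≤ _ := by
        gcongr
        push_cast
        have : (1 : ℝ) ≤ B ^ (w + 1) := one_le_pow₀ hB
        have e : B * (η * (w * B ^ w)) = η * (w * B ^ (w + 1)) := by rw [pow_succ]; ring
        rw [e]
        nlinarith

/-- Group privacy in the other direction: dividing by `B ≥ 1` at each step keeps the errors from
being amplified, so they only add up to η w. -/
theorem le_of_step' {B η : ℝ} (hB : 1 ≤ B) (hη : 0 ≤ η) {f : ℕ → ℝ≥0∞}
    (h : ∀ k, f k ≤ ENNReal.ofReal B * f (k + 1) + ENNReal.ofReal η) (k w : ℕ) :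
    ENNReal.ofReal (B⁻¹ ^ w) * f k ≤ f (k + w) + ENNReal.ofReal (η * w) := by
  have hB0 : 0 < B := by linarith
  induction w with
  | zero => simp
  | succ w ih =>
    calc ENNReal.ofReal (B⁻¹ ^ (w + 1)) * f k
        = ENNReal.ofReal B⁻¹ * (ENNReal.ofReal (B⁻¹ ^ w) * f k) := by
          rw [pow_succ', ENNReal.ofReal_mul (by positivity), mul_assoc]
      _ ≤ ENNReal.ofReal B⁻¹ * (f (k + w) + ENNReal.ofReal (η * w)) := by gcongr
      _ ≤ ENNReal.ofReal B⁻¹ * ((ENNReal.ofReal B * f (k + w + 1) + ENNReal.ofReal η)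
            + ENNReal.ofReal (η * w)) := by gcongr; exact h _
      _ = f (k + (w + 1)) + ENNReal.ofReal B⁻¹ * ENNReal.ofReal (η * (w + 1)) := by
          rw [add_assoc, ← ENNReal.ofReal_add hη (by positivity), mul_add, ← mul_assoc,
            ← ENNReal.ofReal_mul (by positivity), inv_mul_cancel₀ hB0.ne', ENNReal.ofReal_one,
            one_mul, add_assoc]
          congr 3; ring
      _ ≤ _ := by
          push_cast
          gcongr
          calc ENNReal.ofReal B⁻¹ * ENNReal.ofReal (η * (w + 1))
              ≤ 1 * ENNReal.ofReal (η * (w + 1)) := by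
                gcongr
                rw [← ENNReal.ofReal_one]
                exact ENNReal.ofReal_le_ofReal (inv_le_one_of_one_le₀ hB)
            _ = _ := one_mul _

/-- Raising the mean of a Poisson count changes the expectation of a differentially private
statistic by little. -/
theorem lintegral_poisson_add_le (r a : ℝ≥0) {B η : ℝ} (hB : 1 ≤ B) (hη : 0 ≤ η)
    {f : ℕ → ℝ≥0∞} (h : ∀ k, f (k + 1) ≤ ENNReal.ofReal B * f k + ENNReal.ofReal η) :
    ∫⁻ k, f k ∂(poissonMeasure (r + a)) ≤
      ENNReal.ofReal (Real.exp (a * (B - 1))) * ∫⁻ k, f k ∂(poissonMeasure r) +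
        ENNReal.ofReal (η * (a * B * Real.exp (a * (B - 1)))) := by
  have hB0 : 0 ≤ B := by linarith
  rw [lintegral_poissonMeasure_add]
  calc ∫⁻ k, ∫⁻ w, f (k + w) ∂(poissonMeasure a) ∂(poissonMeasure r)
      ≤ ∫⁻ k, (ENNReal.ofReal (Real.exp (a * (B - 1))) * f k +
          ENNReal.ofReal (η * (a * B * Real.exp (a * (B - 1))))) ∂(poissonMeasure r) := by
        refine lintegral_mono fun k => ?_
        calc ∫⁻ w, f (k + w) ∂(poissonMeasure a)
            ≤ ∫⁻ w : ℕ, (ENNReal.ofReal (B ^ w) * f k + ENNReal.ofReal η *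
                ENNReal.ofReal (w * B ^ w)) ∂(poissonMeasure a) := by
              refine lintegral_mono fun w => ?_
              rw [← ENNReal.ofReal_mul hη]
              exact le_of_step hB hη h k w
          _ = _ := by
              rw [lintegral_add_left .of_discrete, lintegral_mul_const _ .of_discrete,
                lintegral_const_mul _ .of_discrete, lintegral_poisson_pow _ hB0,
                lintegral_poisson_cast_mul_pow _ hB0, ← ENNReal.ofReal_mul hη]
    _ = _ := by
        rw [lintegral_add_left .of_discrete, lintegral_const_mul _ .of_discrete, lintegral_const,
          measure_univ, mul_one]

/-- Integrates `le_of_step'` over the increment w ∼ Poi(a), for which the mean of B^(-w) is exp(-a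
(1 - 1/B)). -/
theorem lintegral_poisson_le_add (r a : ℝ≥0) {B η : ℝ} (hB : 1 ≤ B) (hη : 0 ≤ η)
    {f : ℕ → ℝ≥0∞} (h : ∀ k, f k ≤ ENNReal.ofReal B * f (k + 1) + ENNReal.ofReal η) :
    ∫⁻ k, f k ∂(poissonMeasure r) ≤
      ENNReal.ofReal (Real.exp (a * (1 - B⁻¹))) * (∫⁻ k, f k ∂(poissonMeasure (r + a)) +
        ENNReal.ofReal (η * a)) := by
  have hB0 : 0 < B := by linarith
  have key : ENNReal.ofReal (Real.exp (a * (B⁻¹ - 1))) * ∫⁻ k, f k ∂(poissonMeasure r) ≤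
      ∫⁻ k, f k ∂(poissonMeasure (r + a)) + ENNReal.ofReal (η * a) := by
    rw [lintegral_poissonMeasure_add, ← lintegral_const_mul _ .of_discrete]
    calc ∫⁻ k, ENNReal.ofReal (Real.exp (a * (B⁻¹ - 1))) * f k ∂(poissonMeasure r)
        ≤ ∫⁻ k, (∫⁻ w, f (k + w) ∂(poissonMeasure a) + ENNReal.ofReal (η * a))
            ∂(poissonMeasure r) := by
          refine lintegral_mono fun k => ?_
          rw [← lintegral_poisson_pow _ (by positivity), ← lintegral_mul_const _ .of_discrete]
          have e : ENNReal.ofReal (η * a) =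
              ∫⁻ w : ℕ, ENNReal.ofReal (η * w) ∂(poissonMeasure a) := by
            have := lintegral_poisson_cast_mul_pow a zero_le_one
            simp only [one_pow, mul_one, sub_self, mul_zero, Real.exp_zero] at this
            simp_rw [ENNReal.ofReal_mul hη]
            rw [lintegral_const_mul _ .of_discrete, this]
          rw [e, ← lintegral_add_left .of_discrete]
          exact lintegral_mono fun w => le_of_step' hB hη h k w
      _ = _ := by
          rw [lintegral_add_left .of_discrete, lintegral_const, measure_univ, mul_one]
  calc ∫⁻ k, f k ∂(poissonMeasure r)
      = ENNReal.ofReal (Real.exp (a * (1 - B⁻¹))) *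
          (ENNReal.ofReal (Real.exp (a * (B⁻¹ - 1))) * ∫⁻ k, f k ∂(poissonMeasure r)) := by
        rw [← mul_assoc, ← ENNReal.ofReal_mul (Real.exp_pos _).le, ← Real.exp_add]
        ring_nf; simp
    _ ≤ _ := by gcongr

/-- Two Poisson laws with small `χ²` divergence are statistically close. -/
theorem lintegral_poisson_le_of_sq (x y : ℝ≥0) (hy : 0 < y) {κ v : ℝ} (hκ : 0 < κ)
    (hv : Real.exp ((x - y) ^ 2 / y) - 1 ≤ v) {f : ℕ → ℝ≥0∞} (hf : ∀ k, f k ≤ 1) :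
    ∫⁻ k, f k ∂(poissonMeasure x) ≤
      ∫⁻ k, f k ∂(poissonMeasure y) + ENNReal.ofReal (κ / 2 + v / (2 * κ)) := by
  have hy' : (0 : ℝ) < y := hy
  set P : ℝ → ℕ → ℝ := fun r k => Real.exp (-r) * r ^ k / k.factorial with hP
  -- This is the ratio P_x² / P_y of the mass functions, written as a multiple of the Poisson mass
  -- function of mean x² / y. Its total is exp((x - y)² / y), one more than the χ² divergence.
  set R : ℕ → ℝ := fun k => Real.exp ((x : ℝ) ^ 2 / y - 2 * x + y) *
    (Real.exp (-((x : ℝ) ^ 2 / y)) * ((x : ℝ) ^ 2 / y) ^ k / k.factorial) with hR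
  have hsum : ∀ r : ℝ, HasSum (P r) 1 := fun r => by simpa [hP] using hasSum_poisson_pow r 1
  have hRs : HasSum R (Real.exp ((x : ℝ) ^ 2 / y - 2 * x + y)) := by
    simpa [hR, hP] using (hsum ((x : ℝ) ^ 2 / y)).mul_left (Real.exp ((x : ℝ) ^ 2 / y - 2 * x + y))
  have hPR : ∀ k, R k * P y k = P x k ^ 2 := fun k => by
    simp only [hR, hP]
    have e1 : Real.exp ((x : ℝ) ^ 2 / y - 2 * x + y) * Real.exp (-((x : ℝ) ^ 2 / y)) *
        Real.exp (-(y : ℝ)) = Real.exp (-x) ^ 2 := by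
      rw [← Real.exp_add, ← Real.exp_add, ← Real.exp_nat_mul]; congr 1; push_cast; ring
    have e2 : ((x : ℝ) ^ 2 / y) ^ k * (y : ℝ) ^ k = ((x : ℝ) ^ k) ^ 2 := by
      rw [← mul_pow, div_mul_cancel₀ _ hy'.ne']; ring
    calc _ = (Real.exp ((x : ℝ) ^ 2 / y - 2 * x + y) * Real.exp (-((x : ℝ) ^ 2 / y)) *
        Real.exp (-(y : ℝ))) * (((x : ℝ) ^ 2 / y) ^ k * (y : ℝ) ^ k) /
          (k.factorial : ℝ) ^ 2 := by ring
      _ = _ := by rw [e1, e2]; ring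
  -- `H` is κ P_y / 2 + (P_x - P_y)² / (2 κ P_y), which dominates P_x - P_y by the
  -- arithmetic-geometric mean inequality and is summable in closed form.
  set H : ℕ → ℝ := fun k => κ / 2 * P y k + (R k - 2 * P x k + P y k) / (2 * κ) with hH
  have hyP : ∀ k, 0 < P y k := fun k => by simp only [hP]; positivity
  have hxP : ∀ k, 0 ≤ P x k := fun k => by simp only [hP]; positivity
  have hPH : ∀ k, P x k ≤ P y k + H k := fun k => by
    have h1 := hPR k
    have h2 := hyP k
    have hRk : R k = P x k ^ 2 / P y k := by rw [← h1]; field_simp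
    have : H k - (P x k - P y k) = (P x k - P y k - κ * P y k) ^ 2 / (2 * κ * P y k) := by
      simp only [hH, hRk]; field_simp; ring
    have h3 : 0 ≤ (P x k - P y k - κ * P y k) ^ 2 / (2 * κ * P y k) := by positivity
    linarith
  have hH0 : ∀ k, 0 ≤ H k := fun k => by
    have h1 := hPR k
    have h2 := hyP k
    have hRk : R k = P x k ^ 2 / P y k := by rw [← h1]; field_simp
    have : H k = κ / 2 * P y k + (P x k - P y k) ^ 2 / (2 * κ * P y k) := by
      simp only [hH, hRk]; field_simp; ring
    rw [this]; positivity
  have hHs : HasSum H (κ / 2 * 1 + (Real.exp ((x : ℝ) ^ 2 / y - 2 * x + y) - 2 * 1 + 1) / (2 * κ)) :=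
    ((hsum y).mul_left _).add ((((hRs.sub ((hsum x).mul_left 2))).add (hsum y)).div_const _)
  have hle : ∑' k, ENNReal.ofReal (H k) ≤ ENNReal.ofReal (κ / 2 + v / (2 * κ)) := by
    rw [← ENNReal.ofReal_tsum_of_nonneg hH0 hHs.summable, hHs.tsum_eq]
    refine ENNReal.ofReal_le_ofReal ?_
    have : ((x : ℝ) - y) ^ 2 / y = (x : ℝ) ^ 2 / y - 2 * x + y := by field_simp; ring
    rw [this] at hv
    rw [mul_one]
    gcongr
    linarith
  rw [lintegral_poissonMeasure, lintegral_poissonMeasure]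
  refine le_trans ?_ (add_le_add_right hle _)
  rw [← ENNReal.tsum_add]
  refine ENNReal.tsum_le_tsum fun k => ?_
  calc ENNReal.ofReal (P x k) * f k ≤ ENNReal.ofReal (P y k + H k) * f k := by
        gcongr; exact hPH k
    _ = ENNReal.ofReal (P y k) * f k + ENNReal.ofReal (H k) * f k := by
        rw [ENNReal.ofReal_add (hyP k).le (hH0 k), add_mul]
    _ ≤ ENNReal.ofReal (P y k) * f k + ENNReal.ofReal (H k) * 1 := by gcongr; exact hf k
    _ = _ := by rw [mul_one]

end Step

end PrivateKL

/-! ### Indistinguishability of the output laws of an estimator. -/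

namespace PrivateKL

section Law

variable {d : ℕ}

theorem simplex_nonneg (q : stdSimplex ℝ (Fin d)) (i : Fin d) : 0 ≤ q i := q.2.1 i

theorem simplex_sum (q : stdSimplex ℝ (Fin d)) : ∑ i, q i = 1 := q.2.2

theorem simplex_le_one (q : stdSimplex ℝ (Fin d)) (i : Fin d) : q i ≤ 1 := by
  rw [← simplex_sum q]
  exact Finset.single_le_sum (fun j _ => simplex_nonneg q j) (Finset.mem_univ i)

instance (m : ℝ) (p : stdSimplex ℝ (Fin d)) : IsProbabilityMeasure (poissonHistogram m p) := by
  unfold poissonHistogram; infer_instance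

/-- The law of the output of the estimator `A` on a sample `x ∼ Poi(n q)`. -/
noncomputable def outputLaw (n : ℕ) (A : Kernel (Fin d → ℕ) (stdSimplex ℝ (Fin d)))
    (q : stdSimplex ℝ (Fin d)) : Measure (stdSimplex ℝ (Fin d)) :=
  (poissonHistogram n q).bind A

instance (n : ℕ) (A : Kernel (Fin d → ℕ) (stdSimplex ℝ (Fin d))) [IsMarkovKernel A]
    (q : stdSimplex ℝ (Fin d)) : IsProbabilityMeasure (outputLaw n A q) :=
  isProbabilityMeasure_bind A.measurable.aemeasurable (Filter.Eventually.of_forall fun _ =>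
    inferInstance)

theorem outputLaw_apply (n : ℕ) (A : Kernel (Fin d → ℕ) (stdSimplex ℝ (Fin d)))
    (q : stdSimplex ℝ (Fin d)) {T : Set (stdSimplex ℝ (Fin d))} (hT : MeasurableSet T) :
    outputLaw n A q T = ∫⁻ x, A x T ∂(poissonHistogram n q) :=
  Measure.bind_apply hT A.measurable.aemeasurable

theorem lintegral_outputLaw_le (n : ℕ) (A : Kernel (Fin d → ℕ) (stdSimplex ℝ (Fin d)))
    (q : stdSimplex ℝ (Fin d)) {f : stdSimplex ℝ (Fin d) → ℝ≥0∞} (hf : Measurable f)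
    (h : ∀ a, f a ≤ kl q a) : ∫⁻ a, f a ∂(outputLaw n A q) ≤ expectedKL n q A := by
  rw [outputLaw, Measure.lintegral_bind A.measurable.aemeasurable hf.aemeasurable]
  exact lintegral_mono fun x => lintegral_mono fun a => h a

/-- Under `q` and `q'` the estimator `A` has output laws that cannot be told apart reliably. -/
def Indist (n : ℕ) (A : Kernel (Fin d → ℕ) (stdSimplex ℝ (Fin d)))
    (q q' : stdSimplex ℝ (Fin d)) : Prop :=
  ∀ T, MeasurableSet T → outputLaw n A q T ≤ 2 * outputLaw n A q' T + ENNReal.ofReal (1 / 4)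

theorem lintegral_pi_le_of_step {μ ν : Fin d → Measure ℕ} [∀ i, IsProbabilityMeasure (μ i)]
    [∀ i, IsProbabilityMeasure (ν i)] (i : Fin d) (h : ∀ j, j ≠ i → μ j = ν j)
    {f : (Fin d → ℕ) → ℝ≥0∞} {B η : ℝ≥0∞}
    (hf : ∀ x, ∫⁻ y, f (Function.update x i y) ∂(μ i) ≤
      B * ∫⁻ y, f (Function.update x i y) ∂(ν i) + η) :
    ∫⁻ x, f x ∂(Measure.pi μ) ≤ B * ∫⁻ x, f x ∂(Measure.pi ν) + η := by
  rw [lintegral_pi_update μ μ i (fun _ _ => rfl) .of_discrete,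
    lintegral_pi_update μ ν i h .of_discrete, ← lintegral_const_mul _ .of_discrete]
  refine (lintegral_mono hf).trans ?_
  rw [lintegral_add_left .of_discrete, lintegral_const, measure_univ, mul_one]

/-- The two Poisson means are changed one after the other, through an intermediate product law. The
errors compose to the factor 1.1² ≤ 2 and the additive term 0.11 + 1.1 · 0.11 ≤ 1/4. -/
theorem indist_of_step {n : ℕ} {A : Kernel (Fin d → ℕ) (stdSimplex ℝ (Fin d))}
    {q q' : stdSimplex ℝ (Fin d)} {i j : Fin d} (hij : i ≠ j)
    (h : ∀ k, k ≠ i → k ≠ j → q k = q' k)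
    (H : ∀ k, k = i ∨ k = j → ∀ T, MeasurableSet T → ∀ x,
      ∫⁻ y, A (Function.update x k y) T ∂(poissonMeasure (n * q k).toNNReal) ≤
        ENNReal.ofReal (11 / 10) *
          ∫⁻ y, A (Function.update x k y) T ∂(poissonMeasure (n * q' k).toNNReal) +
        ENNReal.ofReal (11 / 100)) :
    Indist n A q q' := by
  intro T hT
  rw [outputLaw_apply _ _ _ hT, outputLaw_apply _ _ _ hT]
  unfold poissonHistogram
  set r : Fin d → ℝ≥0 := Function.update (fun k => (n * q k).toNNReal) i (n * q' i).toNNReal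
    with hr
  have hri : r i = (n * q' i).toNNReal := by simp [hr]
  have hrk : ∀ k, k ≠ i → r k = (n * q k).toNNReal := fun k hk => by simp [hr, hk]
  have s1 := lintegral_pi_le_of_step (μ := fun k => poissonMeasure (n * q k).toNNReal)
    (ν := fun k => poissonMeasure (r k)) i (fun k hk => by simp only [hrk k hk])
    (f := fun x => A x T) (B := ENNReal.ofReal (11 / 10)) (η := ENNReal.ofReal (11 / 100))
    (fun x => by simp only [hri]; exact H i (Or.inl rfl) T hT x)
  have s2 := lintegral_pi_le_of_step (μ := fun k => poissonMeasure (r k))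
    (ν := fun k => poissonMeasure (n * q' k).toNNReal) j
    (fun k hk => by
      by_cases hki : k = i
      · subst hki; simp only [hri]
      · simp only [hrk k hki, h k hki hk])
    (f := fun x => A x T) (B := ENNReal.ofReal (11 / 10)) (η := ENNReal.ofReal (11 / 100))
    (fun x => by simp only [hrk j hij.symm]; exact H j (Or.inr rfl) T hT x)
  refine s1.trans ((add_le_add_left (mul_le_mul_right s2 _) _).trans ?_)
  rw [mul_add, ← mul_assoc, add_assoc, ← ENNReal.ofReal_mul (by norm_num),
    ← ENNReal.ofReal_mul (by norm_num), ← ENNReal.ofReal_add (by norm_num) (by norm_num)]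
  gcongr
  · rw [show (2 : ℝ≥0∞) = ENNReal.ofReal 2 by simp]
    exact ENNReal.ofReal_le_ofReal (by norm_num)
  · norm_num

theorem histDist_update_le {x : Fin d → ℕ} {i : Fin d} {k l : ℕ} (h : Nat.dist k l ≤ 1) :
    histDist (Function.update x i k) (Function.update x i l) ≤ 1 := by
  unfold histDist
  rw [Finset.sum_eq_single i]
  · simpa using h
  · intro j _ hj; simp [hj, Nat.dist_self]
  · simp

/-- Under differential privacy, moving mass of order `1 / (n e)` between two symbols cannot be
detected. -/
theorem indist_of_isDP {n : ℕ} (hn : 1 ≤ n) {e : ℝ} (he : 0 < e) (he1 : e ≤ 1)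
    {A : Kernel (Fin d → ℕ) (stdSimplex ℝ (Fin d))} [IsMarkovKernel A]
    (hA : IsDP (fun x y => histDist x y ≤ 1) e e A)
    {q q' : stdSimplex ℝ (Fin d)} {i j : Fin d} (hij : i ≠ j)
    (h : ∀ k, k ≠ i → k ≠ j → q k = q' k) {s : ℝ} (hs : 0 ≤ s) (hsn : s ≤ 1 / (32 * (n * e)))
    (hi : q' i = q i + s) (hj : q j = q' j + s) : Indist n A q q' := by
  have hn0 : (0 : ℝ) < n := by exact_mod_cast hn
  set a : ℝ≥0 := (n * s).toNNReal with ha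
  have haR : (a : ℝ) = n * s := Real.coe_toNNReal _ (by positivity)
  -- On average `a = n s` records change at such a coordinate, and privacy costs `e` per record. The
  -- multiplicative loss is therefore about exp(a e), and the additive loss about a e.
  have hae : (a : ℝ) * e ≤ 1 / 32 := by
    rw [haR]
    calc n * s * e ≤ n * (1 / (32 * (n * e))) * e := by gcongr
      _ = 1 / 32 := by field_simp
  have ha0 : (0 : ℝ) ≤ a := a.2
  have hadd : ∀ u v : ℝ, 0 ≤ v → u = v + s →
      (n * u).toNNReal = (n * v).toNNReal + a := fun u v hv huv => by
    rw [huv, mul_add, Real.toNNReal_add (by positivity) (by positivity)]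
  have hB : 1 ≤ Real.exp e := Real.one_le_exp he.le
  have hBe : Real.exp e - 1 ≤ 2 * e := by
    have := (abs_le.1 (Real.abs_exp_sub_one_sub_id_le (x := e) (by rwa [abs_of_pos he]))).2
    nlinarith
  have hB3 : Real.exp e ≤ 3 := (Real.exp_le_exp.2 he1).trans (by linarith [Real.exp_one_lt_d9])
  have hexp : ∀ t : ℝ, 0 ≤ t → t ≤ 1 / 16 → Real.exp t ≤ 107 / 100 := fun t h0 h1 => by
    have := (abs_le.1 (Real.abs_exp_sub_one_sub_id_le (x := t)
      (by rw [abs_of_nonneg h0]; linarith))).2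
    nlinarith
  have E1 : Real.exp (a * (Real.exp e - 1)) ≤ 107 / 100 := by
    refine hexp _ (mul_nonneg ha0 (by linarith)) ?_
    calc (a : ℝ) * (Real.exp e - 1) ≤ a * (2 * e) := by gcongr
      _ ≤ 1 / 16 := by linarith
  have E2 : Real.exp (a * (1 - (Real.exp e)⁻¹)) ≤ 107 / 100 := by
    have h1 : 1 - (Real.exp e)⁻¹ ≤ e := by
      rw [← Real.exp_neg]; linarith [Real.add_one_le_exp (-e)]
    refine hexp _ (mul_nonneg ha0 ?_) ?_
    · rw [sub_nonneg]; exact inv_le_one_of_one_le₀ hB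
    · calc (a : ℝ) * (1 - (Real.exp e)⁻¹) ≤ a * e := by gcongr
        _ ≤ 1 / 16 := by linarith
  have hstep : ∀ (T : Set (stdSimplex ℝ (Fin d))), MeasurableSet T → ∀ (x : Fin d → ℕ) (l : Fin d)
      (k k' : ℕ), Nat.dist k k' ≤ 1 → A (Function.update x l k) T ≤
      ENNReal.ofReal (Real.exp e) * A (Function.update x l k') T + ENNReal.ofReal e :=
    fun T hT x l k k' hk => hA _ _ (histDist_update_le hk) T hT
  refine indist_of_step hij h fun k hk T hT x => ?_
  rcases hk with rfl | rfl
  -- At the coordinate that receives mass, `q` has the smaller Poisson mean; at the other one it has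
  -- the larger. Hence the two different comparison lemmas.
  · rw [hadd _ _ (simplex_nonneg q k) hi]
    refine (lintegral_poisson_le_add _ a hB he.le (f := fun y => A (Function.update x k y) T)
      fun m => hstep T hT x k _ _ (by unfold Nat.dist; omega)).trans ?_
    rw [mul_add, ← ENNReal.ofReal_mul (Real.exp_pos _).le]
    refine add_le_add (mul_le_mul_left (ENNReal.ofReal_le_ofReal ?_) _)
      (ENNReal.ofReal_le_ofReal ?_)
    · linarith
    · nlinarith [Real.exp_pos (a * (1 - (Real.exp e)⁻¹))]
  · rw [hadd _ _ (simplex_nonneg q' k) hj]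
    refine (lintegral_poisson_add_le _ a hB he.le (f := fun y => A (Function.update x k y) T)
      fun m => hstep T hT x k _ _ (by unfold Nat.dist; omega)).trans ?_
    refine add_le_add (mul_le_mul_left (ENNReal.ofReal_le_ofReal ?_) _)
      (ENNReal.ofReal_le_ofReal ?_)
    · linarith
    · have h1 : 0 ≤ a * e := by positivity
      have h2 : Real.exp e * Real.exp (a * (Real.exp e - 1)) ≤ 3 * (107 / 100) := by gcongr
      calc e * (a * Real.exp e * Real.exp (a * (Real.exp e - 1)))
          = (a * e) * (Real.exp e * Real.exp (a * (Real.exp e - 1))) := by ring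
        _ ≤ 1 / 32 * (3 * (107 / 100)) := by gcongr
        _ ≤ 11 / 100 := by norm_num

/-- Moving mass of order `√(q / n)` between two symbols cannot be detected from the sample. -/
theorem indist_of_sq {n : ℕ} (hn : 1 ≤ n)
    {A : Kernel (Fin d → ℕ) (stdSimplex ℝ (Fin d))} [IsMarkovKernel A]
    {q q' : stdSimplex ℝ (Fin d)} {i j : Fin d} (hij : i ≠ j)
    (h : ∀ k, k ≠ i → k ≠ j → q k = q' k) {s : ℝ}
    (hi0 : 0 < q' i) (hj0 : 0 < q' j) (hsi : n * s ^ 2 ≤ q' i / 100)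
    (hsj : n * s ^ 2 ≤ q' j / 100)
    (hi : q' i = q i + s) (hj : q j = q' j + s) : Indist n A q q' := by
  have hn0 : (0 : ℝ) < n := by exact_mod_cast hn
  refine indist_of_step hij h fun k hk T hT x => ?_
  have hk0 : 0 < q' k := by rcases hk with rfl | rfl <;> assumption
  have hsk : n * s ^ 2 ≤ q' k / 100 := by rcases hk with rfl | rfl <;> assumption
  have hd : (q k - q' k) ^ 2 = s ^ 2 := by
    rcases hk with rfl | rfl
    · rw [hi]; ring
    · rw [hj]; ring
  have c1 : ((n * q k).toNNReal : ℝ) = n * q k :=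
    Real.coe_toNNReal _ (mul_nonneg hn0.le (simplex_nonneg q k))
  have c2 : ((n * q' k).toNNReal : ℝ) = n * q' k := Real.coe_toNNReal _ (by positivity)
  have hz : (((n * q k).toNNReal : ℝ) - (n * q' k).toNNReal) ^ 2 / (n * q' k).toNNReal
      ≤ 1 / 100 := by
    rw [c1, c2, ← mul_sub, mul_pow, hd, div_le_iff₀ (by positivity)]
    nlinarith
  have hz0 : 0 ≤ (((n * q k).toNNReal : ℝ) - (n * q' k).toNNReal) ^ 2 / (n * q' k).toNNReal := by
    positivity
  have hv : Real.exp ((((n * q k).toNNReal : ℝ) - (n * q' k).toNNReal) ^ 2 /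
      (n * q' k).toNNReal) - 1 ≤ 102 / 10000 := by
    have := (abs_le.1 (Real.abs_exp_sub_one_sub_id_le (abs_le.2 ⟨by linarith, hz.trans
      (by norm_num)⟩))).2
    nlinarith
  -- With κ = 1/10 the additive error is 0.05 + 0.051, below the allowed 11/100.
  refine (lintegral_poisson_le_of_sq _ _ (Real.toNNReal_pos.2 (by positivity))
    (by norm_num : (0 : ℝ) < 1 / 10) hv (f := fun y => A (Function.update x k y) T)
    fun y => prob_le_one).trans ?_
  gcongr
  · refine le_mul_of_one_le_left zero_le ?_
    rw [← ENNReal.ofReal_one]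
    exact ENNReal.ofReal_le_ofReal (by norm_num)
  · norm_num

end Law

/-! ### Assouad's method. -/

section Assouad

variable {d : ℕ} {ι K : Type*} [Fintype ι] [DecidableEq ι] [Fintype K]

/-- Exchanging `κ` with the value `c β` is an involution on the pairs `(c, κ)`: resampling one
coordinate preserves the uniform distribution. -/
theorem card_mul_sum_pi_eq (β : ι) (G : (ι → K) → ℝ≥0∞) :
    (Fintype.card K : ℝ≥0∞) * ∑ c, G c = ∑ c, ∑ κ, G (Function.update c β κ) := by
  have hinv : Function.Involutive fun x : (ι → K) × K => (Function.update x.1 β x.2, x.1 β) :=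
    fun x => by simp
  have h := Equiv.sum_comp hinv.toPerm fun x : (ι → K) × K => G x.1
  rw [Fintype.sum_prod_type, Fintype.sum_prod_type] at h
  simp only [Function.Involutive.coe_toPerm, Finset.sum_const, Finset.card_univ, nsmul_eq_mul] at h
  rw [h, Finset.mul_sum]

/-- Assouad's method: local lower bounds on the loss of each block add up to a lower bound on the
worst-case expected KL error over a product family. -/
theorem sum_le_of_local_loss [Nonempty K] {n : ℕ}
    (A : Kernel (Fin d → ℕ) (stdSimplex ℝ (Fin d)))
    (Q : (ι → K) → stdSimplex ℝ (Fin d)) {R : ℝ≥0∞} (hR : ∀ c, expectedKL n (Q c) A ≤ R)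
    (loss : ι → K → stdSimplex ℝ (Fin d) → ℝ≥0∞) (hm : ∀ β κ, Measurable (loss β κ))
    (hkl : ∀ c a, ∑ β, loss β (c β) a ≤ kl (Q c) a) (σ : ι → ℝ≥0∞)
    (hloc : ∀ c β, Fintype.card K * σ β ≤
      ∑ κ, ∫⁻ a, loss β κ a ∂(outputLaw n A (Q (Function.update c β κ)))) :
    ∑ β, σ β ≤ R := by
  set G : ι → (ι → K) → ℝ≥0∞ := fun β c => ∫⁻ a, loss β (c β) a ∂(outputLaw n A (Q c)) with hG
  have hK0 : (Fintype.card K : ℝ≥0∞) ≠ 0 := by simp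
  have hKt : (Fintype.card K : ℝ≥0∞) ≠ ⊤ := ENNReal.natCast_ne_top _
  have hN0 : (Fintype.card (ι → K) : ℝ≥0∞) ≠ 0 := by simp
  have hNt : (Fintype.card (ι → K) : ℝ≥0∞) ≠ ⊤ := ENNReal.natCast_ne_top _
  have h1 : ∀ c, ∑ β, G β c ≤ R := fun c => by
    have hmeas : Measurable fun a => ∑ β, loss β (c β) a :=
      Finset.measurable_fun_sum _ fun β _ => hm β (c β)
    have := (lintegral_outputLaw_le n A (Q c) hmeas (hkl c)).trans (hR c)
    rwa [lintegral_finsetSum _ fun β _ => hm β (c β)] at this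
  -- Sum the local bound over all configurations; by resampling coordinate `β`, the average loss of
  -- the block is at least `σ β`.
  have h2 : ∀ β, Fintype.card (ι → K) * σ β ≤ ∑ c, G β c := fun β => by
    rw [← ENNReal.mul_le_mul_iff_right hK0 hKt, card_mul_sum_pi_eq β]
    calc (Fintype.card K : ℝ≥0∞) * (Fintype.card (ι → K) * σ β)
        = ∑ _c : ι → K, Fintype.card K * σ β := by
          rw [Finset.sum_const, Finset.card_univ, nsmul_eq_mul]; ring
      _ ≤ _ := by
          refine Finset.sum_le_sum fun c _ => (hloc c β).trans (le_of_eq ?_)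
          simp [hG]
  rw [← ENNReal.mul_le_mul_iff_right hN0 hNt]
  calc (Fintype.card (ι → K) : ℝ≥0∞) * ∑ β, σ β
      = ∑ β, Fintype.card (ι → K) * σ β := Finset.mul_sum _ _ _
    _ ≤ ∑ β, ∑ c, G β c := Finset.sum_le_sum fun β _ => h2 β
    _ = ∑ c, ∑ β, G β c := Finset.sum_comm
    _ ≤ ∑ _c : ι → K, R := Finset.sum_le_sum fun c _ => h1 c
    _ = _ := by rw [Finset.sum_const, Finset.card_univ, nsmul_eq_mul]

end Assouad

end PrivateKL

/-! ### Local lower bounds for one block. -/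

namespace PrivateKL

section TwoPoint

variable {Ω : Type*} [MeasurableSpace Ω]

theorem ofReal_mul_measure_le_lintegral {ν : Measure Ω} {T : Set Ω} (hT : MeasurableSet T)
    {c : ℝ≥0∞} {f : Ω → ℝ≥0∞} (h : ∀ a ∈ T, c ≤ f a) : c * ν T ≤ ∫⁻ a, f a ∂ν := by
  rw [← setLIntegral_const]
  exact (setLIntegral_mono' hT h).trans (setLIntegral_le_lintegral _ _)

/-- The two error probabilities of a test cannot both be small. -/
theorem three_quarters_le_of_indist {ν₀ ν : Measure Ω} [IsProbabilityMeasure ν₀] {T : Set Ω}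
    (hT : MeasurableSet T) (h : ν₀ T ≤ 2 * ν T + ENNReal.ofReal (1 / 4)) :
    ENNReal.ofReal (3 / 4) ≤ 2 * ν T + ν₀ Tᶜ := by
  have h1 : ν₀ T + ν₀ Tᶜ = 1 := prob_add_prob_compl hT
  have h2 : ENNReal.ofReal (3 / 4) + ENNReal.ofReal (1 / 4) = 1 := by
    rw [← ENNReal.ofReal_add (by norm_num) (by norm_num)]; norm_num
  refine ENNReal.le_of_add_le_add_right (a := ENNReal.ofReal (1 / 4)) ENNReal.ofReal_ne_top ?_
  rw [h2, ← h1]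
  calc ν₀ T + ν₀ Tᶜ ≤ 2 * ν T + ENNReal.ofReal (1 / 4) + ν₀ Tᶜ := by gcongr
    _ = _ := by ring

/-- One block of the lower bound: a mass `s` at an unknown one of the positions `v`, or nowhere,
costs `s (1 + ln |υ|)` up to constants. -/
theorem block_loss_le {υ : Type*} [Fintype υ] [Nonempty υ] {ν₀ : Measure Ω}
    [IsProbabilityMeasure ν₀] {ν : υ → Measure Ω} {X : υ → Ω → ℝ} (hX : ∀ v, Measurable (X v))
    (hX0 : ∀ v a, 0 ≤ X v a) {s : ℝ} (hs : 0 < s)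
    (hind : ∀ v T, MeasurableSet T → ν₀ T ≤ 2 * ν v T + ENNReal.ofReal (1 / 4)) :
    Fintype.card υ * ENNReal.ofReal (s * (1 + Real.log (Fintype.card υ)) / 16) ≤
      ∑ v, (∫⁻ a, ∑ u, ENNReal.ofReal (X u a) ∂ν₀ + ∫⁻ a, eklTerm s (X v a) ∂(ν v)) := by
  set g : ℝ := (Fintype.card υ : ℝ) with hg
  have hg1 : 1 ≤ g := by rw [hg]; exact_mod_cast Fintype.card_pos
  have hsg : 0 < √g := by positivity
  have hsg2 : √g * √g = g := Real.mul_self_sqrt (by linarith)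
  have hsg1 : 1 ≤ √g := Real.one_le_sqrt.2 hg1
  have hlg : 0 ≤ Real.log g := Real.log_nonneg hg1
  set L : ℝ := (1 + Real.log g) / 3 with hL
  have hL0 : 0 < L := by positivity
  have hLg : L ≤ √g := by
    have h1 := Real.log_le_sub_one_of_pos hsg
    rw [Real.log_sqrt (by linarith)] at h1
    rw [hL]; linarith
  -- The threshold balances two losses. An estimate below `θ` at the true position loses s ln(s / θ)
  -- - s ≥ s L. Reserving more than `θ` at each of the `g` positions wastes g θ = s √g / 4 ≥ s L / 4
  -- when no mass is hidden.
  set θ : ℝ := s / (4 * √g) with hθ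
  have hθ0 : 0 < θ := by positivity
  have hlog : s * L ≤ s * Real.log (s / θ) - s := by
    have : s / θ = 4 * √g := by rw [hθ]; field_simp
    rw [this, Real.log_mul (by norm_num) hsg.ne', Real.log_sqrt (by linarith),
      show (4 : ℝ) = 2 ^ 2 by norm_num, Real.log_pow]
    have := Real.log_two_gt_d9
    push_cast
    have : L ≤ 2 * Real.log 2 + Real.log g / 2 - 1 := by rw [hL]; linarith
    nlinarith
  have key : ∀ v, ENNReal.ofReal (s * L) * ENNReal.ofReal (3 / 4) ≤
      4 * (∫⁻ a, eklTerm s (X v a) ∂(ν v) + ENNReal.ofReal g * ∫⁻ a, ENNReal.ofReal (X v a) ∂ν₀) := by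
    intro v
    have hT : MeasurableSet {a | X v a ≤ θ} := measurableSet_le (hX v) measurable_const
    have h1 : ENNReal.ofReal (s * L) * ν v {a | X v a ≤ θ} ≤ ∫⁻ a, eklTerm s (X v a) ∂(ν v) :=
      ofReal_mul_measure_le_lintegral hT fun a ha => (ENNReal.ofReal_le_ofReal hlog).trans
        (ofReal_mul_log_sub_le_eklTerm hs (hX0 v a) ha)
    have h2 : ENNReal.ofReal θ * ν₀ {a | X v a ≤ θ}ᶜ ≤ ∫⁻ a, ENNReal.ofReal (X v a) ∂ν₀ :=
      ofReal_mul_measure_le_lintegral hT.compl fun a ha =>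
        ENNReal.ofReal_le_ofReal (not_le.1 (show ¬ X v a ≤ θ from ha)).le
    have h3 : s * L ≤ 4 * g * θ := by
      have : 4 * g * θ = s * √g := by
        rw [hθ]; nth_rewrite 1 [← hsg2]; field_simp
      rw [this]; gcongr
    calc ENNReal.ofReal (s * L) * ENNReal.ofReal (3 / 4)
        ≤ ENNReal.ofReal (s * L) * (2 * ν v {a | X v a ≤ θ} + ν₀ {a | X v a ≤ θ}ᶜ) := by
          gcongr; exact three_quarters_le_of_indist hT (hind v _ hT)
      _ = 2 * (ENNReal.ofReal (s * L) * ν v {a | X v a ≤ θ}) +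
          ENNReal.ofReal (s * L) * ν₀ {a | X v a ≤ θ}ᶜ := by ring
      _ ≤ 4 * (ENNReal.ofReal (s * L) * ν v {a | X v a ≤ θ}) +
          4 * ENNReal.ofReal g * (ENNReal.ofReal θ * ν₀ {a | X v a ≤ θ}ᶜ) := by
          refine add_le_add (mul_le_mul_left (by norm_num) _) ?_
          rw [← mul_assoc]
          refine mul_le_mul_left ?_ _
          rw [show (4 : ℝ≥0∞) = ENNReal.ofReal 4 by simp, ← ENNReal.ofReal_mul (by norm_num),
            ← ENNReal.ofReal_mul (by linarith)]
          exact ENNReal.ofReal_le_ofReal h3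
      _ ≤ 4 * (∫⁻ a, eklTerm s (X v a) ∂(ν v)) +
          4 * ENNReal.ofReal g * ∫⁻ a, ENNReal.ofReal (X v a) ∂ν₀ := by gcongr
      _ = _ := by ring
  have hgN : ENNReal.ofReal g = Fintype.card υ := by rw [hg]; simp
  have hsum : Fintype.card υ * (ENNReal.ofReal (s * L) * ENNReal.ofReal (3 / 4)) ≤
      4 * (∑ v, ∫⁻ a, eklTerm s (X v a) ∂(ν v) +
        ENNReal.ofReal g * ∑ v, ∫⁻ a, ENNReal.ofReal (X v a) ∂ν₀) := by
    rw [Finset.mul_sum, ← Finset.sum_add_distrib, Finset.mul_sum, ← nsmul_eq_mul,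
      ← Finset.card_univ, ← Finset.sum_const]
    exact Finset.sum_le_sum fun v _ => key v
  rw [Finset.sum_add_distrib, Finset.sum_const, Finset.card_univ, nsmul_eq_mul,
    lintegral_finsetSum _ fun u _ => by fun_prop, add_comm, ← hgN]
  rw [← hgN] at hsum
  refine (ENNReal.mul_le_mul_iff_right (a := 4) (by norm_num) (by norm_num)).1 (le_trans ?_ (hsum.trans (by rw [add_comm])))
  rw [show (4 : ℝ≥0∞) = ENNReal.ofReal 4 by simp, ← ENNReal.ofReal_mul (by linarith),
    ← ENNReal.ofReal_mul (by norm_num), ← ENNReal.ofReal_mul (by positivity),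
    ← ENNReal.ofReal_mul (by linarith)]
  refine ENNReal.ofReal_le_ofReal (le_of_eq ?_)
  rw [hL]; ring

/-- Two-point lower bound around a mass `y`. -/
theorem pair_loss_le {ν₀ ν : Measure Ω} [IsProbabilityMeasure ν₀] {X : Ω → ℝ}
    (hX : Measurable X) (hX0 : ∀ a, 0 ≤ X a) {s y : ℝ} (hs : 0 < s) (hsy : s ≤ y)
    (hind : ∀ T, MeasurableSet T → ν₀ T ≤ 2 * ν T + ENNReal.ofReal (1 / 4)) :
    ENNReal.ofReal (s ^ 2 / (128 * y)) ≤
      ∫⁻ a, eklTerm y (X a) ∂ν₀ + ∫⁻ a, eklTerm (y + s) (X a) ∂ν := by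
  have hy : 0 < y := hs.trans_le hsy
  set T := {a | X a ≤ y + s / 2} with hTdef
  have hT : MeasurableSet T := measurableSet_le hX measurable_const
  -- An estimate on the wrong side of the midpoint y + s/2 loses at least this much: under y + s
  -- because y + s ≤ 2 y, and under y because w² / (4 (y + w)) increases with the excess w ≥ s/2.
  set c : ℝ := s ^ 2 / (32 * y) with hc
  have hc0 : 0 ≤ c := by positivity
  have h1 : ENNReal.ofReal c * ν T ≤ ∫⁻ a, eklTerm (y + s) (X a) ∂ν := by
    refine ofReal_mul_measure_le_lintegral hT fun a ha => le_trans ?_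
      (ofReal_sq_sub_div_le_eklTerm (by linarith) (hX0 a) le_rfl
        (le_trans ha (by linarith) : X a ≤ y + s))
    refine ENNReal.ofReal_le_ofReal ?_
    have h : s / 2 ≤ y + s - X a := by have : X a ≤ y + s / 2 := ha; linarith
    rw [hc, div_le_div_iff₀ (by positivity) (by positivity)]
    nlinarith [mul_self_le_mul_self (by positivity) h, sq_nonneg s, mul_pos hs hy]
  have h2 : ENNReal.ofReal c * ν₀ Tᶜ ≤ ∫⁻ a, eklTerm y (X a) ∂ν₀ := by
    refine ofReal_mul_measure_le_lintegral hT.compl fun a ha => ?_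
    have ha : y + s / 2 < X a := not_le.1 ha
    refine le_trans ?_
      (ofReal_sq_sub_div_le_eklTerm hy.le (hX0 a) (by linarith : y ≤ X a) le_rfl)
    refine ENNReal.ofReal_le_ofReal ?_
    obtain ⟨w, hw⟩ : ∃ w, X a = y + w := ⟨X a - y, by ring⟩
    rw [hw] at ha ⊢
    have hw1 : s / 2 ≤ w := by linarith
    rw [hc, div_le_div_iff₀ (by positivity) (by nlinarith)]
    have e1 : s ^ 2 * y ≤ 4 * w ^ 2 * y := by
      refine mul_le_mul_of_nonneg_right ?_ hy.le; nlinarith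
    have e2 : s ^ 2 * w ≤ 2 * w ^ 2 * y := by
      have : s * s * w ≤ (2 * w) * y * w := by gcongr <;> linarith
      nlinarith
    nlinarith
  have h3 := three_quarters_le_of_indist hT (hind T hT)
  calc ENNReal.ofReal (s ^ 2 / (128 * y)) ≤ ENNReal.ofReal c * ENNReal.ofReal (3 / 8) := by
        rw [← ENNReal.ofReal_mul hc0]
        refine ENNReal.ofReal_le_ofReal ?_
        have : s ^ 2 / (128 * y) = c * (1 / 4) := by rw [hc]; ring
        rw [this]; exact mul_le_mul_of_nonneg_left (by norm_num) hc0
    _ ≤ ENNReal.ofReal c * (ν T + ν₀ Tᶜ) := by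
        gcongr
        refine (ENNReal.mul_le_mul_iff_right (a := 2) (by norm_num) (by norm_num)).1 ?_
        calc 2 * ENNReal.ofReal (3 / 8) = ENNReal.ofReal (3 / 4) := by
              rw [show (2 : ℝ≥0∞) = ENNReal.ofReal 2 by simp, ← ENNReal.ofReal_mul (by norm_num)]
              norm_num
          _ ≤ 2 * ν T + ν₀ Tᶜ := h3
          _ ≤ 2 * ν T + 2 * ν₀ Tᶜ := by
              gcongr; exact le_mul_of_one_le_left zero_le (by norm_num)
          _ = _ := by ring
    _ = ENNReal.ofReal c * ν₀ Tᶜ + ENNReal.ofReal c * ν T := by ring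
    _ ≤ _ := add_le_add h2 h1

end TwoPoint

/-! ### Product families of perturbations. -/

/-- A product family of perturbations of a probability vector: the block `β` may move the mass
`s β` from the reservoir `o β` to one of the positions `V β v`. -/
structure BlockDesign (d : ℕ) (ι υ : Type*) where
  base : stdSimplex ℝ (Fin d)
  o : ι → Fin d
  V : ι → υ → Fin d
  s : ι → ℝ
  o_injective : Function.Injective o
  V_injective : Function.Injective fun x : ι × υ => V x.1 x.2
  V_ne_o : ∀ β v β', V β v ≠ o β'
  s_pos : ∀ β, 0 < s β
  s_le : ∀ β, s β ≤ base (o β)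

namespace BlockDesign

section

variable {d : ℕ} {ι υ : Type*} (D : BlockDesign d ι υ)

theorem measurable_coord (i : Fin d) : Measurable fun a : stdSimplex ℝ (Fin d) => a i :=
  (measurable_pi_apply i).comp measurable_subtype_coe

/-- The part of the KL error that is charged to a block. -/
noncomputable def loss [Fintype υ] (β : ι) (κ : Bool × υ) (a : stdSimplex ℝ (Fin d)) : ℝ≥0∞ :=
  if κ.1 then eklTerm (D.base (D.V β κ.2) + D.s β) (a (D.V β κ.2))
  else ∑ v, eklTerm (D.base (D.V β v)) (a (D.V β v))

theorem measurable_loss [Fintype υ] (β : ι) (κ : Bool × υ) : Measurable (D.loss β κ) := by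
  unfold loss
  rcases κ with ⟨b, u⟩
  cases b
  · simp only [Bool.false_eq_true, if_false]
    exact Finset.measurable_fun_sum _ fun v _ =>
      (measurable_eklTerm _).comp (measurable_coord (D.V β v))
  · simp only [if_true]
    exact (measurable_eklTerm _).comp (measurable_coord (D.V β u))

variable [Fintype ι]

/-- The coordinates of the perturbed probability vector. -/
noncomputable def point (c : ι → Bool × υ) (i : Fin d) : ℝ :=
  D.base i + ∑ β, if (c β).1 then
    D.s β * ((if i = D.V β (c β).2 then 1 else 0) - if i = D.o β then 1 else 0) else 0

theorem point_of_notMem (c : ι → Bool × υ) {i : Fin d} (hV : ∀ β v, i ≠ D.V β v)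
    (ho : ∀ β, i ≠ D.o β) : D.point c i = D.base i := by
  unfold point
  simp [hV, ho]

theorem point_o (c : ι → Bool × υ) (β : ι) :
    D.point c (D.o β) = D.base (D.o β) - if (c β).1 then D.s β else 0 := by
  unfold point
  rw [sub_eq_add_neg, Finset.sum_eq_single β]
  · have h2 : D.o β ≠ D.V β (c β).2 := (D.V_ne_o β _ β).symm
    by_cases h : (c β).1 <;> simp [h, h2]
  · intro β' _ hβ
    have h1 : D.o β ≠ D.V β' (c β').2 := (D.V_ne_o β' _ β).symm
    have h2 : D.o β ≠ D.o β' := fun h => hβ (D.o_injective h).symm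
    simp [h1, h2]
  · simp

variable [DecidableEq υ]

theorem point_V (c : ι → Bool × υ) (β : ι) (v : υ) :
    D.point c (D.V β v) = D.base (D.V β v) + if c β = (true, v) then D.s β else 0 := by
  unfold point
  rw [Finset.sum_eq_single β]
  · have h1 : D.V β v = D.V β (c β).2 ↔ v = (c β).2 := by
      constructor
      · intro h
        have := D.V_injective (a₁ := (β, v)) (a₂ := (β, (c β).2)) h
        exact congrArg Prod.snd this
      · intro h; rw [← h]
    have h2 : D.V β v ≠ D.o β := D.V_ne_o β v β
    rcases hc : c β with ⟨b, u⟩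
    rw [hc] at h1
    cases b
    · simp
    · by_cases huv : u = v
      · subst huv; simp [h2]
      · have : ¬ v = u := fun h => huv h.symm
        simp [h1, h2, this, huv]
  · intro β' _ hβ
    have h1 : D.V β v ≠ D.V β' (c β').2 := fun h => hβ
      (congrArg Prod.fst (D.V_injective (a₁ := (β, v)) (a₂ := (β', (c β').2)) h)).symm
    simp [h1, D.V_ne_o β v β']
  · simp

/-- A perturbed probability vector. -/
noncomputable def config (c : ι → Bool × υ) : stdSimplex ℝ (Fin d) :=
  ⟨D.point c, fun i => by
    by_cases hV : ∃ β v, i = D.V β v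
    · obtain ⟨β, v, rfl⟩ := hV
      rw [point_V]
      have := simplex_nonneg D.base (D.V β v)
      have := (D.s_pos β).le
      split_ifs <;> linarith
    by_cases ho : ∃ β, i = D.o β
    · obtain ⟨β, rfl⟩ := ho
      rw [point_o]
      have := D.s_le β
      have := (D.s_pos β).le
      split_ifs <;> linarith
    · push Not at hV ho
      rw [point_of_notMem D c hV ho]
      exact simplex_nonneg D.base i, by
    unfold point
    rw [Finset.sum_add_distrib, simplex_sum, Finset.sum_comm, Finset.sum_eq_zero, add_zero]
    intro β _
    split_ifs
    · rw [← Finset.mul_sum, Finset.sum_sub_distrib]; simp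
    · simp⟩

theorem config_apply (c : ι → Bool × υ) (i : Fin d) : D.config c i = D.point c i := rfl

/-- The positions of different blocks are disjoint, so the charged terms are distinct summands of
the relative entropy. All other summands, in particular those of the reservoirs, are dropped as
nonnegative. -/
theorem sum_loss_le_kl [Fintype υ] (c : ι → Bool × υ) (a : stdSimplex ℝ (Fin d)) :
    ∑ β, D.loss β (c β) a ≤ kl (D.config c) a := by
  rw [kl_eq_sum_eklTerm]
  calc ∑ β, D.loss β (c β) a
      ≤ ∑ β, ∑ v, eklTerm (D.config c (D.V β v)) (a (D.V β v)) := by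
        refine Finset.sum_le_sum fun β _ => ?_
        unfold loss
        simp only [config_apply, point_V]
        rcases hc : c β with ⟨b, u⟩
        cases b
        · simp
        · simp only [if_true]
          refine le_trans (le_of_eq ?_) (Finset.single_le_sum (fun _ _ => zero_le)
            (Finset.mem_univ u))
          simp
    _ = ∑ x : ι × υ, eklTerm (D.config c (D.V x.1 x.2)) (a (D.V x.1 x.2)) :=
        (Fintype.sum_prod_type fun x : ι × υ =>
          eklTerm (D.config c (D.V x.1 x.2)) (a (D.V x.1 x.2))).symm
    _ = ∑ i ∈ Finset.univ.map ⟨_, D.V_injective⟩, eklTerm (D.config c i) (a i) := by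
        rw [Finset.sum_map]; rfl
    _ ≤ _ := Finset.sum_le_sum_of_subset (Finset.subset_univ _)

variable [DecidableEq ι]

/-- The position is a dummy label when nothing is moved. It gives the unperturbed state of a block
multiplicity |υ|, hence probability 1/2 under the uniform choice, as `block_loss_le` requires. -/
theorem config_update_false (c : ι → Bool × υ) (β : ι) (v v' : υ) :
    D.config (Function.update c β (false, v)) = D.config (Function.update c β (false, v')) := by
  refine Subtype.ext (funext fun i => ?_)
  change D.point _ i = D.point _ i
  unfold point
  congr 1
  refine Finset.sum_congr rfl fun β' _ => ?_
  by_cases h : β' = β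
  · subst h; simp
  · simp [h]

theorem config_update_true_V (c : ι → Bool × υ) (β : ι) (v v' : υ) :
    D.config (Function.update c β (true, v)) (D.V β v) =
      D.config (Function.update c β (false, v')) (D.V β v) + D.s β := by
  simp [config_apply, point_V]

theorem config_update_true_o (c : ι → Bool × υ) (β : ι) (v v' : υ) :
    D.config (Function.update c β (false, v')) (D.o β) =
      D.config (Function.update c β (true, v)) (D.o β) + D.s β := by
  simp [config_apply, point_o]

theorem config_update_of_ne (c : ι → Bool × υ) (β : ι) (v v' : υ) {i : Fin d}
    (h1 : i ≠ D.V β v) (h2 : i ≠ D.o β) :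
    D.config (Function.update c β (false, v')) i =
      D.config (Function.update c β (true, v)) i := by
  rw [config_apply, config_apply]
  unfold point
  congr 1
  refine Finset.sum_congr rfl fun β' _ => ?_
  by_cases h : β' = β
  · subst h; simp [h1, h2]
  · simp [h]

variable [Fintype υ] [Nonempty υ] {n : ℕ} {A : Kernel (Fin d → ℕ) (stdSimplex ℝ (Fin d))}

/-- Assouad's method with `block_loss_le` in each block. The constant 16 becomes 32 because a block
has 2 |υ| states. -/
theorem sum_block_le [IsMarkovKernel A] (hbase : ∀ β v, D.base (D.V β v) = 0)
    (hind : ∀ c β v v', Indist n A (D.config (Function.update c β (false, v')))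
      (D.config (Function.update c β (true, v)))) {R : ℝ≥0∞}
    (hR : ∀ c, expectedKL n (D.config c) A ≤ R) :
    ∑ β, ENNReal.ofReal (D.s β * (1 + Real.log (Fintype.card υ)) / 32) ≤ R := by
  have v₀ : υ := Classical.arbitrary υ
  refine sum_le_of_local_loss A D.config hR D.loss D.measurable_loss D.sum_loss_le_kl _
    fun c β => ?_
  have h := block_loss_le (ν₀ := outputLaw n A (D.config (Function.update c β (false, v₀))))
    (ν := fun v => outputLaw n A (D.config (Function.update c β (true, v))))
    (X := fun v a => a (D.V β v)) (fun v => measurable_coord _) (fun v a => simplex_nonneg a _)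
    (D.s_pos β) (fun v T hT => hind c β v v₀ T hT)
  have e₀ : ∀ v, ∫⁻ a, D.loss β (false, v) a
      ∂(outputLaw n A (D.config (Function.update c β (false, v)))) =
      ∫⁻ a, ∑ u, ENNReal.ofReal (a (D.V β u))
        ∂(outputLaw n A (D.config (Function.update c β (false, v₀)))) := fun v => by
    rw [D.config_update_false c β v v₀]
    simp only [loss, hbase, Bool.false_eq_true, if_false, eklTerm_zero]
  have e₁ : ∀ v, ∫⁻ a, D.loss β (true, v) a
      ∂(outputLaw n A (D.config (Function.update c β (true, v)))) =
      ∫⁻ a, eklTerm (D.s β) (a (D.V β v))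
        ∂(outputLaw n A (D.config (Function.update c β (true, v)))) := fun v => by
    simp only [loss, hbase, if_true, zero_add]
  rw [Fintype.sum_prod_type, Fintype.sum_bool, Finset.sum_congr rfl fun v _ => e₀ v,
    Finset.sum_congr rfl fun v _ => e₁ v, ← Finset.sum_add_distrib]
  refine le_trans (le_of_eq ?_)
    (h.trans (le_of_eq (Finset.sum_congr rfl fun v _ => add_comm _ _)))
  have hl : 0 ≤ Real.log (Fintype.card υ) := Real.log_natCast_nonneg _
  have := D.s_pos β
  rw [Fintype.card_prod, Fintype.card_bool, Nat.cast_mul, mul_comm ((2 : ℕ) : ℝ≥0∞), mul_assoc]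
  congr 1
  rw [show ((2 : ℕ) : ℝ≥0∞) = ENNReal.ofReal 2 by simp, ← ENNReal.ofReal_mul (by norm_num)]
  congr 1; ring

end

/-- Assouad's method with `pair_loss_le`; each block has two states, which doubles the constant 128.
-/
theorem sum_pair_le {d n : ℕ} {ι : Type*} [Fintype ι] [DecidableEq ι]
    {A : Kernel (Fin d → ℕ) (stdSimplex ℝ (Fin d))} [IsMarkovKernel A] (D : BlockDesign d ι Unit)
    (hbase : ∀ β, D.s β ≤ D.base (D.V β ()))
    (hind : ∀ c β v v', Indist n A (D.config (Function.update c β (false, v')))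
      (D.config (Function.update c β (true, v)))) {R : ℝ≥0∞}
    (hR : ∀ c, expectedKL n (D.config c) A ≤ R) :
    ∑ β, ENNReal.ofReal (D.s β ^ 2 / (256 * D.base (D.V β ()))) ≤ R := by
  refine sum_le_of_local_loss A D.config hR D.loss D.measurable_loss D.sum_loss_le_kl _
    fun c β => ?_
  have h := pair_loss_le (ν₀ := outputLaw n A (D.config (Function.update c β (false, ()))))
    (ν := outputLaw n A (D.config (Function.update c β (true, ()))))
    (measurable_coord (D.V β ())) (fun a => simplex_nonneg a _)
    (D.s_pos β) (hbase β) (fun T hT => hind c β () () T hT)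
  rw [Fintype.sum_prod_type, Fintype.sum_bool]
  simp only [loss, if_true, Bool.false_eq_true, if_false, Finset.univ_unique, Finset.sum_singleton,
    PUnit.default_eq_unit]
  rw [add_comm]
  refine le_trans (le_of_eq ?_) h
  rw [Fintype.card_prod, Fintype.card_bool, Fintype.card_unit, mul_one,
    show ((2 : ℕ) : ℝ≥0∞) = ENNReal.ofReal 2 by simp, ← ENNReal.ofReal_mul (by norm_num)]
  congr 1
  ring

end BlockDesign

end PrivateKL

/-! ### From product families to the per-instance lower bounds. -/

namespace PrivateKL

theorem isDP_mono {X Y : Type*} [MeasurableSpace Y] {adj : X → X → Prop} {ε δ δ' : ℝ}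
    (h : δ ≤ δ') {M : X → Measure Y} (hM : IsDP adj ε δ M) : IsDP adj ε δ' M :=
  fun x y hxy T hT => (hM x y hxy T hT).trans (by gcongr)

theorem lowerDP_le_lowerDP {d n : ℕ} {ε δ δ' : ℝ} (h : δ ≤ δ') (p : stdSimplex ℝ (Fin d))
    (N : stdSimplex ℝ (Fin d) → Set (stdSimplex ℝ (Fin d))) :
    lowerDP ε δ' p n N ≤ lowerDP ε δ p n N :=
  le_iInf fun A => le_iInf fun hA => le_iInf fun hdp =>
    iInf_le_of_le A (iInf_le_of_le hA (iInf_le_of_le (isDP_mono h hdp) le_rfl))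

/-- Every Markov kernel is (ε, 1)-private. This turns private lower bounds at e = 1 into bounds for
all estimators. -/
theorem lowerDP_one_le_lower {d n : ℕ} {ε : ℝ} (p : stdSimplex ℝ (Fin d))
    (N : stdSimplex ℝ (Fin d) → Set (stdSimplex ℝ (Fin d))) :
    lowerDP ε 1 p n N ≤ lower p n N :=
  le_iInf fun A => le_iInf fun hA => iInf_le_of_le A (iInf_le_of_le hA (iInf_le_of_le
    (fun x y _ T _ => by
      rw [ENNReal.ofReal_one]
      exact prob_le_one.trans le_add_self) le_rfl))

namespace BlockDesign

variable {d n : ℕ} {ι υ : Type*} [Fintype ι] [DecidableEq ι] [DecidableEq υ]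

/-- Used to check that configurations lie in a neighbourhood: only touched coordinates need a bound,
and `s β` is one. -/
theorem config_cases (D : BlockDesign d ι υ) (c : ι → Bool × υ) (i : Fin d) :
    D.config c i = D.base i ∨
      ∃ β, (i = D.o β ∨ ∃ v, i = D.V β v) ∧ |D.config c i - D.base i| ≤ D.s β := by
  by_cases hV : ∃ β v, i = D.V β v
  · obtain ⟨β, v, rfl⟩ := hV
    refine Or.inr ⟨β, Or.inr ⟨v, rfl⟩, ?_⟩
    rw [config_apply, point_V, add_sub_cancel_left]
    have := (D.s_pos β).le
    split_ifs <;> simp [abs_of_nonneg, this]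
  by_cases ho : ∃ β, i = D.o β
  · obtain ⟨β, rfl⟩ := ho
    refine Or.inr ⟨β, Or.inl rfl, ?_⟩
    rw [config_apply, point_o, sub_sub_cancel_left, abs_neg]
    have := (D.s_pos β).le
    split_ifs <;> simp [abs_of_nonneg, this]
  · push Not at hV ho
    exact Or.inl (point_of_notMem D c hV ho)

theorem indist_config_of_isDP (D : BlockDesign d ι υ) (hn : 1 ≤ n) {e : ℝ} (he : 0 < e)
    (he1 : e ≤ 1) (hs : ∀ β, D.s β ≤ 1 / (32 * (n * e)))
    {A : Kernel (Fin d → ℕ) (stdSimplex ℝ (Fin d))} [IsMarkovKernel A]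
    (hA : IsDP (fun x y => histDist x y ≤ 1) e e A) (c : ι → Bool × υ) (β : ι) (v v' : υ) :
    Indist n A (D.config (Function.update c β (false, v')))
      (D.config (Function.update c β (true, v))) :=
  indist_of_isDP hn he he1 hA (D.V_ne_o β v β)
    (fun _ h1 h2 => D.config_update_of_ne c β v v' h1 h2) (D.s_pos β).le (hs β)
    (D.config_update_true_V c β v v') (D.config_update_true_o c β v v')

theorem sum_block_le_lowerDP [Fintype υ] [Nonempty υ] (D : BlockDesign d ι υ) (hn : 1 ≤ n)
    {e : ℝ} (he : 0 < e) (he1 : e ≤ 1) (hs : ∀ β, D.s β ≤ 1 / (32 * (n * e)))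
    (hbase : ∀ β v, D.base (D.V β v) = 0) {p : stdSimplex ℝ (Fin d)}
    {N : stdSimplex ℝ (Fin d) → Set (stdSimplex ℝ (Fin d))} (hN : ∀ c, D.config c ∈ N p) :
    ∑ β, ENNReal.ofReal (D.s β * (1 + Real.log (Fintype.card υ)) / 32) ≤ lowerDP e e p n N :=
  le_iInf fun _ => le_iInf fun _ => le_iInf fun hA =>
    D.sum_block_le hbase (D.indist_config_of_isDP hn he he1 hs hA)
      fun c => le_iSup₂_of_le (D.config c) (hN c) le_rfl

theorem sum_pair_le_lowerDP (D : BlockDesign d ι Unit) (hn : 1 ≤ n)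
    {e : ℝ} (he : 0 < e) (he1 : e ≤ 1) (hs : ∀ β, D.s β ≤ 1 / (32 * (n * e)))
    (hbase : ∀ β, D.s β ≤ D.base (D.V β ())) {p : stdSimplex ℝ (Fin d)}
    {N : stdSimplex ℝ (Fin d) → Set (stdSimplex ℝ (Fin d))} (hN : ∀ c, D.config c ∈ N p) :
    ∑ β, ENNReal.ofReal (D.s β ^ 2 / (256 * D.base (D.V β ()))) ≤ lowerDP e e p n N :=
  le_iInf fun _ => le_iInf fun _ => le_iInf fun hA =>
    sum_pair_le D hbase (D.indist_config_of_isDP hn he he1 hs hA)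
      fun c => le_iSup₂_of_le (D.config c) (hN c) le_rfl

theorem sum_pair_le_lower (D : BlockDesign d ι Unit) (hn : 1 ≤ n)
    (hbase : ∀ β, D.s β ≤ D.base (D.V β ())) (hV : ∀ β, n * D.s β ^ 2 ≤ D.base (D.V β ()) / 100)
    (ho0 : ∀ β, D.s β < D.base (D.o β))
    (ho : ∀ β, n * D.s β ^ 2 ≤ (D.base (D.o β) - D.s β) / 100) {p : stdSimplex ℝ (Fin d)}
    {N : stdSimplex ℝ (Fin d) → Set (stdSimplex ℝ (Fin d))} (hN : ∀ c, D.config c ∈ N p) :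
    ∑ β, ENNReal.ofReal (D.s β ^ 2 / (256 * D.base (D.V β ()))) ≤ lower p n N := by
  refine le_iInf fun A => le_iInf fun _ => sum_pair_le D hbase (fun c β v v' => ?_)
    fun c => le_iSup₂_of_le (D.config c) (hN c) le_rfl
  have e1 : D.config (Function.update c β (true, v)) (D.V β v) =
      D.base (D.V β v) + D.s β := by simp [config_apply, point_V]
  have e2 : D.config (Function.update c β (true, v)) (D.o β) = D.base (D.o β) - D.s β := by
    simp [config_apply, point_o]
  have h1 := D.s_pos β
  have h2 := hbase β
  have h3 := hV β
  have h4 := ho0 β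
  have h5 := ho β
  refine indist_of_sq hn (D.V_ne_o β v β)
    (fun _ h1 h2 => D.config_update_of_ne c β v v' h1 h2) ?_ ?_ ?_ ?_
    (D.config_update_true_V c β v v') (D.config_update_true_o c β v v')
  · rw [e1]; linarith
  · rw [e2]; linarith
  · rw [e1]; linarith
  · rw [e2]; linarith

end BlockDesign

/-! ### Lower bounds for the heavy symbols. -/

section Pairs

theorem exists_sorted_enum {d : ℕ} (U : Finset (Fin d)) (f : Fin d → ℝ) :
    ∃ e : Fin U.card → Fin d, Function.Injective e ∧ (∀ k, e k ∈ U) ∧ (∀ i ∈ U, ∃ k, e k = i) ∧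
      Monotone (f ∘ e) := by
  let g := U.orderEmbOfFin rfl
  refine ⟨g ∘ Tuple.sort (f ∘ g), g.injective.comp (Equiv.injective _),
    fun k => U.orderEmbOfFin_mem rfl _, fun i hi => ?_, Tuple.monotone_sort (f ∘ g)⟩
  have : i ∈ Set.range g := by rw [Finset.range_orderEmbOfFin]; exact hi
  obtain ⟨k, hk⟩ := this
  exact ⟨(Tuple.sort (f ∘ g)).symm k, by simp [hk]⟩

/-- The even terms dominate the odd ones that follow them. If the length is odd, the unpaired last
term is at most the first even one, which raises the factor from 2 to 3. -/
theorem sum_range_le_three_mul {G : ℕ → ℝ} (hG : Antitone G) (h0 : ∀ j, 0 ≤ G j) {k : ℕ}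
    (hk : 2 ≤ k) :
    ∑ j ∈ Finset.range k, G j ≤ 3 * ∑ β ∈ Finset.range (k / 2), G (2 * β) := by
  have h1 : ∀ h, ∑ j ∈ Finset.range (2 * h), G j ≤ 2 * ∑ β ∈ Finset.range h, G (2 * β) := by
    intro h
    induction h with
    | zero => simp
    | succ h ih =>
      rw [show 2 * (h + 1) = 2 * h + 1 + 1 by ring, Finset.sum_range_succ, Finset.sum_range_succ,
        Finset.sum_range_succ]
      have := hG (Nat.le_succ (2 * h))
      linarith
  have h2 : G (2 * (k / 2)) ≤ ∑ β ∈ Finset.range (k / 2), G (2 * β) := by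
    refine (hG (Nat.zero_le _)).trans ?_
    have := Finset.single_le_sum (f := fun β => G (2 * β)) (fun β _ => h0 _)
      (Finset.mem_range.2 (show 0 < k / 2 by omega))
    simpa using this
  have h3 : ∑ j ∈ Finset.range k, G j ≤ ∑ j ∈ Finset.range (2 * (k / 2) + 1), G j :=
    Finset.sum_le_sum_of_subset_of_nonneg (Finset.range_subset_range.2 (by omega))
      fun j _ _ => h0 j
  rw [Finset.sum_range_succ] at h3
  linarith [h1 (k / 2)]

variable {d n : ℕ}

/-- The symbols of `U` can be paired up so that the lighter symbols of the pairs carry a third of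
every sum that is antitone in the mass. -/
theorem exists_pairing (p : Fin d → ℝ) (U : Finset (Fin d)) (hU : 2 ≤ U.card) :
    ∃ V o : Fin (U.card / 2) → Fin d, Function.Injective V ∧ Function.Injective o ∧
      (∀ β β', V β ≠ o β') ∧ (∀ β, V β ∈ U) ∧ (∀ β, o β ∈ U) ∧ (∀ β, p (V β) ≤ p (o β)) ∧
      ∀ f : ℝ → ℝ, (∀ i ∈ U, 0 ≤ f (p i)) → (∀ i ∈ U, ∀ j ∈ U, p i ≤ p j → f (p j) ≤ f (p i)) →
        ∑ i ∈ U, f (p i) ≤ 3 * ∑ β, f (p (V β)) := by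
  obtain ⟨e, he, heU, hsurj, hmono⟩ := exists_sorted_enum U p
  have b0 : ∀ β : Fin (U.card / 2), 2 * (β : ℕ) < U.card := fun β => by omega
  have b1 : ∀ β : Fin (U.card / 2), 2 * (β : ℕ) + 1 < U.card := fun β => by omega
  -- Neighbours in increasing order of mass form the pairs; the heavier one serves as the reservoir.
  refine ⟨fun β => e ⟨2 * β, b0 β⟩, fun β => e ⟨2 * β + 1, b1 β⟩, fun β β' h => ?_,
    fun β β' h => ?_, fun β β' h => ?_, fun β => heU _, fun β => heU _, fun β => hmono ?_,
    fun f hf0 hf => ?_⟩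
  · have := he h; simp only [Fin.mk.injEq] at this; omega
  · have := he h; simp only [Fin.mk.injEq] at this; omega
  · have := he h; simp only [Fin.mk.injEq] at this; omega
  · simp
  · set G : ℕ → ℝ := fun j => if h : j < U.card then f (p (e ⟨j, h⟩)) else 0 with hG
    have hG0 : ∀ j, 0 ≤ G j := fun j => by
      simp only [hG]; split_ifs with h
      · exact hf0 _ (heU _)
      · exact le_rfl
    have hGa : Antitone G := fun j j' hjj => by
      by_cases h' : j' < U.card
      · have h : j < U.card := by omega
        simp only [hG, h, h', dif_pos]
        exact hf _ (heU _) _ (heU _) (hmono (by simpa using hjj))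
      · have : G j' = 0 := by simp only [hG, h', dif_neg, not_false_eq_true]
        rw [this]; exact hG0 j
    have key := sum_range_le_three_mul hGa hG0 hU
    have l1 : ∑ i ∈ U, f (p i) = ∑ j ∈ Finset.range U.card, G j := by
      rw [Finset.sum_range]
      have himg : U = Finset.univ.map ⟨e, he⟩ := by
        ext i
        simp only [Finset.mem_map, Finset.mem_univ, true_and, Function.Embedding.coeFn_mk]
        exact ⟨hsurj i, fun ⟨k, hk⟩ => hk ▸ heU k⟩
      conv_lhs => rw [himg]
      rw [Finset.sum_map]
      refine Finset.sum_congr rfl fun k _ => ?_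
      simp [hG]
    have l2 : ∑ β ∈ Finset.range (U.card / 2), G (2 * β) =
        ∑ β : Fin (U.card / 2), f (p (e ⟨2 * β, b0 β⟩)) := by
      rw [Finset.sum_range]
      refine Finset.sum_congr rfl fun β _ => ?_
      simp only [hG, b0 β, dif_pos]
    rw [l1, ← l2]; exact key

/-- The statistical cost of the symbols of mass at least `1 / n`. -/
theorem card_div_le_lower_nbhdStat (hn : 1 ≤ n) (p : stdSimplex ℝ (Fin d)) (U : Finset (Fin d))
    (hU : 2 ≤ U.card) (hp : ∀ i ∈ U, 1 / (n : ℝ) ≤ p i) :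
    ENNReal.ofReal (U.card / (196608 * n)) ≤ lower p n (nbhdStat n) := by
  have hn0 : (0 : ℝ) < n := by exact_mod_cast hn
  obtain ⟨V, o, hV, ho, hVo, hVU, hoU, hle, -⟩ := exists_pairing p U hU
  have hpos : ∀ i ∈ U, 0 < p i := fun i hi => lt_of_lt_of_le (by positivity) (hp i hi)
  have hsq : ∀ i ∈ U, √(p i / n) ≤ p i := fun i hi => by
    rw [Real.sqrt_le_left (hpos i hi).le, div_le_iff₀ hn0]
    have := hp i hi
    rw [div_le_iff₀ hn0] at this
    nlinarith [hpos i hi]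
  -- Since p ≥ 1/n, √(p / n) ≤ p, so the square root is the active bound in N_stat. The factor 1/16
  -- gives n s² = p / 256, which stays below a hundredth of both masses even after the reservoir has
  -- lost s ≤ p / 16. Each pair then costs 1 / (65536 n).
  set s : Fin (U.card / 2) → ℝ := fun β => √(p (V β) / n) / 16 with hs
  have hs0 : ∀ β, 0 < s β := fun β => by
    have := hpos _ (hVU β)
    simp only [hs]; positivity
  have hs2 : ∀ β, n * s β ^ 2 = p (V β) / 256 := fun β => by
    have := hpos _ (hVU β)
    simp only [hs]
    rw [div_pow, Real.sq_sqrt (by positivity)]; field_simp; norm_num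
  have hsV : ∀ β, s β ≤ p (V β) / 16 := fun β => by
    simp only [hs]; have := hsq _ (hVU β); linarith
  let D : BlockDesign d (Fin (U.card / 2)) Unit :=
    { base := p
      o := o
      V := fun β _ => V β
      s := s
      o_injective := ho
      V_injective := fun x y h => Prod.ext (hV h) rfl
      V_ne_o := fun β _ β' => hVo β β'
      s_pos := hs0
      s_le := fun β => (hsV β).trans (by linarith [hle β, hpos _ (hVU β)]) }
  have hb : ∀ i, D.base i = p i := fun _ => rfl
  have hDs : ∀ β, D.s β = s β := fun _ => rfl
  have h := D.sum_pair_le_lower hn (p := p) (N := nbhdStat n)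
    (fun β => (hsV β).trans (by linarith [hpos _ (hVU β), hb (V β), show D.V β () = V β from rfl]))
    (fun β => by
      rw [hDs, hs2]; change p (V β) / 256 ≤ p (V β) / 100; linarith [hpos _ (hVU β)])
    (fun β => by
      change s β < p (o β); linarith [hsV β, hle β, hpos _ (hVU β)])
    (fun β => by
      rw [hDs, hs2]; change p (V β) / 256 ≤ (p (o β) - s β) / 100
      linarith [hsV β, hle β, hpos _ (hVU β)])
    (fun c => Or.inl fun i => by
      rcases D.config_cases c i with h | ⟨β, hi, h⟩
      · rw [h, hb, sub_self, abs_zero]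
        exact le_min (simplex_nonneg p i) (Real.sqrt_nonneg _)
      · have hiU : i ∈ U ∧ p (V β) ≤ p i := by
          rcases hi with rfl | ⟨_, rfl⟩
          · exact ⟨hoU β, hle β⟩
          · exact ⟨hVU β, le_rfl⟩
        have h1 : √(p (V β) / n) ≤ √(p i / n) := by gcongr; exact hiU.2
        have h2 : s β ≤ √(p i / n) := by
          simp only [hs]; linarith [Real.sqrt_nonneg (p i / n)]
        exact h.trans (le_min (h2.trans (hsq i hiU.1)) h2))
  refine le_trans ?_ h
  have hterm : ∀ β, D.s β ^ 2 / (256 * D.base (D.V β ())) = 1 / (65536 * n) := fun β => by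
    have h1 := hs2 β
    have h2 := hpos _ (hVU β)
    change s β ^ 2 / (256 * p (V β)) = _
    have : s β ^ 2 = p (V β) / 256 / n := by rw [← h1]; field_simp
    rw [this]; field_simp; norm_num
  simp only [hterm]
  rw [Finset.sum_const, Finset.card_univ, Fintype.card_fin, nsmul_eq_mul, ← ENNReal.ofReal_natCast,
    ← ENNReal.ofReal_mul (by positivity)]
  refine ENNReal.ofReal_le_ofReal ?_
  have h3 : (U.card : ℝ) ≤ 3 * ((U.card / 2 : ℕ) : ℝ) := by
    have : U.card ≤ 3 * (U.card / 2) := by omega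
    exact_mod_cast this
  calc (U.card : ℝ) / (196608 * n) ≤ 3 * ((U.card / 2 : ℕ) : ℝ) / (196608 * n) := by gcongr
    _ = _ := by field_simp; ring

/-- The privacy cost of the symbols of mass above `1 / (n e)`. -/
theorem sum_div_le_lowerDP_nbhdAdd (hn : 1 ≤ n) {e : ℝ} (he : 0 < e) (he1 : e ≤ 1)
    (p : stdSimplex ℝ (Fin d)) (U : Finset (Fin d))
    (hU : 2 ≤ U.card) (hp : ∀ i ∈ U, 1 / (n * e) < p i) :
    ENNReal.ofReal (∑ i ∈ U, 1 / (786432 * (n * e) ^ 2 * p i)) ≤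
      lowerDP e e p n (nbhdAdd (1 / (n * e))) := by
  have hn0 : (0 : ℝ) < n := by exact_mod_cast hn
  have hne : 0 < n * e := by positivity
  obtain ⟨V, o, hV, ho, hVo, hVU, hoU, hle, hsum⟩ := exists_pairing p U hU
  have hpos : ∀ i ∈ U, 0 < p i := fun i hi => lt_trans (by positivity) (hp i hi)
  set s : ℝ := 1 / (32 * (n * e)) with hs
  have hs0 : 0 < s := by positivity
  have hs1 : s ≤ 1 / (n * e) := by
    rw [hs]; apply one_div_le_one_div_of_le hne; linarith
  let D : BlockDesign d (Fin (U.card / 2)) Unit :=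
    { base := p
      o := o
      V := fun β _ => V β
      s := fun _ => s
      o_injective := ho
      V_injective := fun x y h => Prod.ext (hV h) rfl
      V_ne_o := fun β _ β' => hVo β β'
      s_pos := fun _ => hs0
      s_le := fun β => hs1.trans (hp _ (hoU β)).le }
  -- Only symbols above the scale 1 / (n e) are moved, so the mass constraint on the symbols below
  -- it holds with equality.
  have hcfg : ∀ c i, p i ≤ 1 / (n * e) → D.config c i = p i := fun c i hi => by
    rcases D.config_cases c i with h | ⟨β, hi', -⟩
    · exact h
    · exfalso
      have : i ∈ U := by
        rcases hi' with rfl | ⟨_, rfl⟩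
        · exact hoU β
        · exact hVU β
      exact absurd (hp i this) (not_lt.2 hi)
  have h := D.sum_pair_le_lowerDP hn he he1 (p := p) (N := nbhdAdd (1 / (n * e)))
    (fun β => le_rfl) (fun β => hs1.trans (hp _ (hVU β)).le)
    (fun c => ⟨fun i => by
      rcases D.config_cases c i with h | ⟨β, -, h⟩
      · rw [h]; change |p i - p i| ≤ _; rw [sub_self, abs_zero]; positivity
      · exact h.trans hs1,
      (Finset.sum_congr rfl fun i hi => hcfg c i (Finset.mem_filter.1 hi).2).le.trans
        (le_max_right _ _)⟩)
  refine le_trans ?_ h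
  have hterm : ∀ β, D.s β ^ 2 / (256 * D.base (D.V β ())) =
      3 * (1 / (786432 * (n * e) ^ 2 * p (V β))) := fun β => by
    have h2 := hpos _ (hVU β)
    change s ^ 2 / (256 * p (V β)) = _
    rw [hs]; field_simp; norm_num
  simp only [hterm]
  rw [← ENNReal.ofReal_sum_of_nonneg fun β _ => by
    have := hpos _ (hVU β); positivity]
  refine ENNReal.ofReal_le_ofReal ?_
  rw [← Finset.mul_sum]
  refine hsum (fun x => 1 / (786432 * (n * e) ^ 2 * x)) (fun i hi => ?_) fun i hi j hj hij => ?_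
  · have := hpos i hi; positivity
  · have := hpos i hi; have := hpos j hj
    apply one_div_le_one_div_of_le (by positivity)
    gcongr

end Pairs

end PrivateKL

/-! ### Lower bounds for the light symbols. -/

namespace PrivateKL

variable {d n : ℕ}

/-- The point mass at a symbol. -/
noncomputable def vertex (o : Fin d) : stdSimplex ℝ (Fin d) :=
  ⟨fun i => if i = o then 1 else 0, fun i => by positivity, by simp⟩

theorem vertex_apply (o i : Fin d) : vertex o i = if i = o then 1 else 0 := rfl

/-- With few samples nothing is known about a point mass. -/
theorem le_lowerDP_nbhdAdd_of_one_le (hd : 2 ≤ d) (hn : 1 ≤ n) {e : ℝ} (he : 0 < e)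
    (he1 : e ≤ 1) (p : stdSimplex ℝ (Fin d)) {r : ℝ} (hr : 1 ≤ r) :
    ENNReal.ofReal (min (1 / (32 * (n * e))) 1 * (1 + Real.log (d - 1 : ℕ)) / 32) ≤
      lowerDP e e p n (nbhdAdd r) := by
  have hn0 : (0 : ℝ) < n := by exact_mod_cast hn
  let o : Fin d := ⟨0, by omega⟩
  have hne : Nonempty {i : Fin d // i ≠ o} := ⟨⟨⟨1, by omega⟩, by simp [o]⟩⟩
  let D : BlockDesign d Unit {i : Fin d // i ≠ o} :=
    { base := vertex o
      o := fun _ => o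
      V := fun _ v => v.1
      s := fun _ => min (1 / (32 * (n * e))) 1
      o_injective := fun _ _ _ => rfl
      V_injective := fun x y h => Prod.ext rfl (Subtype.ext h)
      V_ne_o := fun _ v _ => v.2
      s_pos := fun _ => by positivity
      s_le := fun _ => by rw [vertex_apply, if_pos rfl]; exact min_le_right _ _ }
  -- As r ≥ 1, the neighbourhood is the whole simplex.
  have h := D.sum_block_le_lowerDP hn he he1 (p := p) (N := nbhdAdd r)
    (fun _ => min_le_left _ _) (fun _ v => (vertex_apply o v.1).trans (if_neg v.2))
    (fun c => ⟨fun i => by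
      have h1 := simplex_nonneg (D.config c) i
      have h2 := simplex_le_one (D.config c) i
      have h3 := simplex_nonneg p i
      have h4 := simplex_le_one p i
      rw [abs_le]; constructor <;> linarith,
      le_trans ((Finset.sum_le_sum_of_subset_of_nonneg (Finset.filter_subset _ _)
        fun i _ _ => simplex_nonneg _ i).trans ((simplex_sum (D.config c)).le.trans hr))
        (le_max_left _ _)⟩)
  refine le_trans (le_of_eq ?_) h
  rw [Finset.univ_unique, Finset.sum_singleton]
  have hc : Fintype.card {i : Fin d // i ≠ o} = d - 1 := by
    rw [Fintype.card_subtype_compl]; simp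
  rw [hc]

/-- Move the mass of `S` to an outside symbol `o`. -/
noncomputable def evacuate (p : stdSimplex ℝ (Fin d)) (S : Finset (Fin d)) {o : Fin d}
    (ho : o ∉ S) : stdSimplex ℝ (Fin d) :=
  ⟨fun i => if i ∈ S then 0 else p i + if i = o then ∑ j ∈ S, p j else 0, fun i => by
    have h1 := simplex_nonneg p i
    have h2 : 0 ≤ ∑ j ∈ S, p j := Finset.sum_nonneg fun j _ => simplex_nonneg p j
    dsimp only
    split_ifs <;> linarith, by
    rw [← Finset.sum_add_sum_compl S, Finset.sum_congr rfl fun i hi => if_pos hi,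
      Finset.sum_congr rfl fun i hi => if_neg (Finset.mem_compl.1 hi), Finset.sum_add_distrib,
      Finset.sum_ite_eq', if_pos (Finset.mem_compl.2 ho), Finset.sum_const_zero, zero_add, add_comm,
      Finset.sum_add_sum_compl, simplex_sum]⟩

theorem evacuate_apply (p : stdSimplex ℝ (Fin d)) (S : Finset (Fin d)) {o : Fin d}
    (ho : o ∉ S) (i : Fin d) :
    evacuate p S ho i = if i ∈ S then 0 else p i + if i = o then ∑ j ∈ S, p j else 0 := rfl

/-- One unit of mass `1 / (n e)` hidden at one of the small symbols. -/
theorem le_lowerDP_nbhdAdd_of_sum_le (hn : 1 ≤ n) {e : ℝ} (he : 0 < e) (he1 : e ≤ 1)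
    (p : stdSimplex ℝ (Fin d)) {r : ℝ} (hr : 1 / (32 * (n * e)) ≤ r)
    {S : Finset (Fin d)} (hS : S = Finset.univ.filter fun i => p i ≤ r) (hS0 : S.Nonempty)
    (hS1 : S ≠ Finset.univ) (hP : ∑ i ∈ S, p i ≤ r) :
    ENNReal.ofReal (1 / (32 * (n * e)) * (1 + Real.log S.card) / 32) ≤
      lowerDP e e p n (nbhdAdd r) := by
  have hn0 : (0 : ℝ) < n := by exact_mod_cast hn
  obtain ⟨o, ho⟩ : ∃ o, o ∉ S := by
    by_contra h; push Not at h; exact hS1 (Finset.eq_univ_iff_forall.2 h)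
  have hpo : r < p o := by
    by_contra h; exact ho (by rw [hS]; simpa using h)
  have hne : Nonempty {i : Fin d // i ∈ S} := ⟨⟨hS0.choose, hS0.choose_spec⟩⟩
  set s : ℝ := 1 / (32 * (n * e)) with hs
  have hs0 : 0 < s := by positivity
  have hP0 : 0 ≤ ∑ i ∈ S, p i := Finset.sum_nonneg fun j _ => simplex_nonneg p j
  -- A single block: the heavy symbol `o` is the reservoir and all light symbols are possible
  -- places. Both the evacuated and the hidden mass are at most `r`, so the mass constraint holds
  -- through the alternative `r` in the maximum.
  let D : BlockDesign d Unit {i : Fin d // i ∈ S} :=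
    { base := evacuate p S ho
      o := fun _ => o
      V := fun _ v => v.1
      s := fun _ => s
      o_injective := fun _ _ _ => rfl
      V_injective := fun x y h => Prod.ext rfl (Subtype.ext h)
      V_ne_o := fun _ v _ h => ho (h ▸ v.2)
      s_pos := fun _ => hs0
      s_le := fun _ => by
        rw [evacuate_apply, if_neg ho, if_pos rfl]; linarith }
  have hbo : D.base o = p o + ∑ i ∈ S, p i := by
    change evacuate p S ho o = _; rw [evacuate_apply, if_neg ho, if_pos rfl]
  have hcS : ∀ c, ∀ i ∈ S, D.config c i ≤ s := fun c i hi => by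
    have : D.config c i = D.base i + if c () = (true, (⟨i, hi⟩ : {i // i ∈ S})) then s else 0 :=
      D.point_V c () ⟨i, hi⟩
    rw [this]
    have hb : D.base i = 0 := by change evacuate p S ho i = 0; rw [evacuate_apply, if_pos hi]
    rw [hb, zero_add]; split_ifs <;> linarith
  have hco : ∀ c, p o + (∑ i ∈ S, p i) - s ≤ D.config c o ∧
      D.config c o ≤ p o + ∑ i ∈ S, p i := fun c => by
    have : D.config c o = D.base o - if (c ()).1 then s else 0 := D.point_o c ()
    rw [this, hbo]; split_ifs <;> constructor <;> linarith
  have hce : ∀ c i, i ∉ S → i ≠ o → D.config c i = p i := fun c i hi hio => by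
    have : D.config c i = D.base i :=
      D.point_of_notMem c (fun _ v h => hi (h ▸ v.2)) (fun _ => hio)
    rw [this]; change evacuate p S ho i = p i
    rw [evacuate_apply, if_neg hi, if_neg hio, add_zero]
  have h := D.sum_block_le_lowerDP hn he he1 (p := p) (N := nbhdAdd r)
    (fun _ => le_rfl) (fun _ v => by
      change evacuate p S ho v.1 = 0; rw [evacuate_apply, if_pos v.2])
    (fun c => ⟨fun i => by
      by_cases hi : i ∈ S
      · have h1 := simplex_nonneg (D.config c) i
        have h2 := hcS c i hi
        have h3 := simplex_nonneg p i
        have h4 : p i ≤ r := by rw [hS] at hi; exact (Finset.mem_filter.1 hi).2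
        rw [abs_le]; constructor <;> linarith
      · by_cases hio : i = o
        · subst hio
          have := hco c
          rw [abs_le]; constructor <;> linarith
        · rw [hce c i hi hio, sub_self, abs_zero]; linarith,
      le_trans (by
        rw [← hS]
        have h1 := simplex_sum (D.config c)
        have h2 := simplex_sum p
        rw [← Finset.sum_add_sum_compl S] at h1 h2
        have h3 : (∑ i ∈ Sᶜ, p i) + (∑ i ∈ S, p i) - s ≤ ∑ i ∈ Sᶜ, D.config c i := by
          have ho' : o ∈ Sᶜ := Finset.mem_compl.2 ho
          rw [← Finset.add_sum_erase _ _ ho', ← Finset.add_sum_erase _ _ ho',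
            Finset.sum_congr rfl fun i hi => hce c i
              (Finset.mem_compl.1 (Finset.mem_of_mem_erase hi)) (Finset.ne_of_mem_erase hi)]
          linarith [(hco c).1]
        linarith) (le_max_left _ _)⟩)
  refine le_trans (le_of_eq ?_) h
  rw [Finset.univ_unique, Finset.sum_singleton, Fintype.card_coe]

section Inner

variable {ι : Type*} [Fintype ι]

/-- Redistribute the mass of `S` among the symbols `o β ∈ S` with weights `w β`. -/
noncomputable def gather (p : stdSimplex ℝ (Fin d)) (S : Finset (Fin d)) (o : ι → Fin d)
    (ho : ∀ β, o β ∈ S) (w : ι → ℝ) (hw : ∀ β, 0 ≤ w β) (hsum : ∑ β, w β = ∑ i ∈ S, p i) :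
    stdSimplex ℝ (Fin d) :=
  ⟨fun i => if i ∈ S then ∑ β, if i = o β then w β else 0 else p i, fun i => by
    dsimp only
    split_ifs
    · exact Finset.sum_nonneg fun β _ => by split_ifs; exacts [hw β, le_rfl]
    · exact simplex_nonneg p i, by
    rw [← Finset.sum_add_sum_compl S, Finset.sum_congr rfl fun i hi => if_pos hi,
      Finset.sum_congr rfl fun i hi => if_neg (Finset.mem_compl.1 hi), Finset.sum_comm]
    have : ∀ β, (∑ i ∈ S, if i = o β then w β else 0) = w β := fun β => by
      rw [Finset.sum_ite_eq', if_pos (ho β)]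
    simp only [this]
    rw [hsum, Finset.sum_add_sum_compl, simplex_sum]⟩

/-- Blocks of small symbols, each with a reservoir and hiding places for the mass `s`. -/
theorem card_mul_le_lowerDP_nbhdAdd [DecidableEq ι] {υ : Type*} [Fintype υ] [DecidableEq υ]
    [Nonempty υ] (hn : 1 ≤ n)
    {e : ℝ} (he : 0 < e) (he1 : e ≤ 1) (p : stdSimplex ℝ (Fin d)) {r : ℝ}
    {S : Finset (Fin d)} (hS : ∀ i ∈ S, p i ≤ r) {o : ι → Fin d} {V : ι → υ → Fin d}
    (ho : Function.Injective o) (hV : Function.Injective fun x : ι × υ => V x.1 x.2)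
    (hVo : ∀ β v β', V β v ≠ o β') (hoS : ∀ β, o β ∈ S) (hVS : ∀ β v, V β v ∈ S)
    {s : ℝ} (hs : 0 < s) (hsn : s ≤ 1 / (32 * (n * e))) (hsr : s ≤ r) {w : ι → ℝ}
    (hw : ∀ β, s ≤ w β) (hwr : ∀ β, w β ≤ p (o β) + r) (hsum : ∑ β, w β = ∑ i ∈ S, p i) :
    ENNReal.ofReal (Fintype.card ι * (s * (1 + Real.log (Fintype.card υ)) / 32)) ≤
      lowerDP e e p n (nbhdAdd r) := by
  have hw0 : ∀ β, 0 ≤ w β := fun β => hs.le.trans (hw β)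
  let b := gather p S o hoS w hw0 hsum
  have hb : ∀ i, b i = if i ∈ S then ∑ β, if i = o β then w β else 0 else p i := fun _ => rfl
  have hbo : ∀ β, b (o β) = w β := fun β => by
    rw [hb, if_pos (hoS β), Finset.sum_eq_single β (fun β' _ h => if_neg fun h' => h (ho h').symm)
      (by simp), if_pos rfl]
  have hb0 : ∀ i ∈ S, (∀ β, i ≠ o β) → b i = 0 := fun i hi h => by
    rw [hb, if_pos hi]; exact Finset.sum_eq_zero fun β _ => if_neg (h β)
  let D : BlockDesign d ι υ :=
    { base := b
      o := o
      V := V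
      s := fun _ => s
      o_injective := ho
      V_injective := hV
      V_ne_o := hVo
      s_pos := fun _ => hs
      s_le := fun β => by rw [hbo]; exact hw β }
  have hce : ∀ c i, i ∉ S → D.config c i = p i := fun c i hi => by
    have : D.config c i = b i :=
      D.point_of_notMem c (fun β v h => hi (h ▸ hVS β v)) (fun β h => hi (h ▸ hoS β))
    rw [this, hb, if_neg hi]
  have hcS : ∀ c, ∀ i ∈ S, D.config c i ≤ p i + r := fun c i hi => by
    have hpi := simplex_nonneg p i
    by_cases h1 : ∃ β v, i = V β v
    · obtain ⟨β, v, rfl⟩ := h1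
      have : D.config c (V β v) = b (V β v) + if c β = (true, v) then s else 0 := D.point_V c β v
      rw [this, hb0 _ hi (hVo β v)]
      split_ifs <;> linarith
    by_cases h2 : ∃ β, i = o β
    · obtain ⟨β, rfl⟩ := h2
      have : D.config c (o β) = b (o β) - if (c β).1 then s else 0 := D.point_o c β
      have := hwr β
      rw [‹D.config c (o β) = _›, hbo]
      split_ifs <;> linarith
    · push Not at h1 h2
      have : D.config c i = b i := D.point_of_notMem c h1 h2
      rw [this, hb0 i hi h2]; linarith
  have h := D.sum_block_le_lowerDP hn he he1 (p := p) (N := nbhdAdd r)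
    (fun _ => hsn) (fun β v => hb0 _ (hVS β v) (hVo β v))
    (fun c => ⟨fun i => by
      by_cases hi : i ∈ S
      · have h1 := simplex_nonneg (D.config c) i
        have h2 := hcS c i hi
        have h4 := hS i hi
        rw [abs_le]; constructor <;> linarith
      · rw [hce c i hi, sub_self, abs_zero]; linarith,
      -- All mass moves inside `S`, which consists of light symbols, so the combined light mass is
      -- unchanged and the second alternative in the maximum applies.
      le_trans (le_of_eq (by
        have h1 := simplex_sum (D.config c)
        have h2 := simplex_sum p
        rw [← Finset.sum_add_sum_compl (Finset.univ.filter fun i => p i ≤ r)] at h1 h2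
        have h3 : ∀ i ∈ (Finset.univ.filter fun i => p i ≤ r)ᶜ, D.config c i = p i :=
          fun i hi => hce c i fun hiS => by
            have h5 : r < p i := by simpa using hi
            exact absurd (hS i hiS) (not_le.2 h5)
        rw [Finset.sum_congr rfl h3] at h1
        linarith)) (le_max_right _ _)⟩)
  refine le_trans (le_of_eq ?_) h
  have hl : 0 ≤ Real.log (Fintype.card υ) := Real.log_natCast_nonneg _
  change _ = ∑ _β : ι, ENNReal.ofReal (s * (1 + Real.log (Fintype.card υ)) / 32)
  rw [Finset.sum_const, Finset.card_univ, nsmul_eq_mul, ← ENNReal.ofReal_natCast,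
    ← ENNReal.ofReal_mul (by positivity)]

end Inner

/-- Many small symbols of small combined mass: one unit of mass is hidden in each of many large
blocks. -/
theorem le_lowerDP_nbhdAdd_of_sparse (hn : 1 ≤ n) {e : ℝ} (he : 0 < e) (he1 : e ≤ 1)
    (p : stdSimplex ℝ (Fin d)) {r : ℝ} (hr : 2 / (n * e) ≤ r) {S : Finset (Fin d)}
    (hS : ∀ i ∈ S, p i ≤ r) (hP : 2 ≤ n * e * ∑ i ∈ S, p i)
    (hk : 16 * (n * e * ∑ i ∈ S, p i) ≤ S.card) :
    ENNReal.ofReal ((∑ i ∈ S, p i) *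
      (1 + Real.log (S.card / (n * e * ∑ i ∈ S, p i))) / 4096) ≤
      lowerDP e e p n (nbhdAdd r) := by
  have hn0 : (0 : ℝ) < n := by exact_mod_cast hn
  set E : ℝ := n * e with hE
  have hE0 : 0 < E := by positivity
  set P : ℝ := ∑ i ∈ S, p i with hPdef
  set k := S.card with hkdef
  -- With this number of blocks each reservoir receives P / j, which lies between 1/E and 2/E:
  -- enough to give away s = 1 / (32 E), and at most r.
  set j : ℕ := ⌈E * P / 2⌉₊ with hj
  have hj1 : E * P / 2 ≤ j := Nat.le_ceil _
  have hj2 : (j : ℝ) ≤ E * P := by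
    have := Nat.ceil_lt_add_one (show 0 ≤ E * P / 2 by linarith)
    rw [← hj] at this; linarith
  have hj0 : 0 < (j : ℝ) := by linarith
  have hjN : 0 < j := by exact_mod_cast hj0
  have h16 : 16 * (j : ℝ) ≤ k := by linarith
  have h16N : 16 * j ≤ k := by exact_mod_cast h16
  set q := k / j with hq
  have hq16 : 16 ≤ q := (Nat.le_div_iff_mul_le hjN).2 h16N
  -- One of the `q` symbols of a block is its reservoir, the other `g` are places.
  obtain ⟨g, hg⟩ : ∃ g, q = g + 1 := ⟨q - 1, by omega⟩
  have hg0 : 0 < g := by omega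
  have hjg : j * (g + 1) ≤ k := by rw [← hg, hq]; exact Nat.mul_div_le k j
  have hne : Nonempty (Fin g) := ⟨⟨0, hg0⟩⟩
  have hidx : ∀ (β : Fin j) (a : ℕ), a ≤ g → (β : ℕ) * (g + 1) + a < k := fun β a ha => by
    have : ((β : ℕ) + 1) * (g + 1) ≤ j * (g + 1) := Nat.mul_le_mul_right _ β.2
    nlinarith
  have huniq : ∀ (β β' : Fin j) (a a' : ℕ), a ≤ g → a' ≤ g →
      (β : ℕ) * (g + 1) + a = (β' : ℕ) * (g + 1) + a' → β = β' ∧ a = a' := by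
    intro β β' a a' ha ha' h
    have h1 : ((β : ℕ) * (g + 1) + a) / (g + 1) = β := by
      rw [mul_comm, Nat.mul_add_div (by omega), Nat.div_eq_of_lt (by omega), add_zero]
    have h2 : ((β' : ℕ) * (g + 1) + a') / (g + 1) = β' := by
      rw [mul_comm, Nat.mul_add_div (by omega), Nat.div_eq_of_lt (by omega), add_zero]
    have h3 : (β : ℕ) = β' := by rw [← h1, ← h2, h]
    refine ⟨Fin.ext h3, ?_⟩
    rw [h3] at h; omega
  let en := S.orderEmbOfFin (k := k) rfl
  have henS : ∀ a, en a ∈ S := fun a => S.orderEmbOfFin_mem rfl a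
  have hinj : ∀ {a b : ℕ} {ha : a < k} {hb : b < k}, en ⟨a, ha⟩ = en ⟨b, hb⟩ → a = b := by
    intro a b ha hb h; simpa using en.injective h
  have hP0 : 0 < P := by
    by_contra h; push Not at h; nlinarith
  have hw2 : P / j ≤ 2 / E := by
    rw [div_le_div_iff₀ hj0 hE0]; linarith
  have hw1 : 1 / E ≤ P / j := by
    rw [div_le_div_iff₀ hE0 hj0]; linarith
  have hsE : 1 / (32 * E) ≤ 1 / E := one_div_le_one_div_of_le hE0 (by linarith)
  have h := card_mul_le_lowerDP_nbhdAdd (ι := Fin j) (υ := Fin g) hn he he1 p hS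
    (o := fun β => en ⟨β * (g + 1) + 0, hidx β 0 (by omega)⟩)
    (V := fun β v => en ⟨β * (g + 1) + (v + 1), hidx β (v + 1) (by omega)⟩)
    (fun β β' h => (huniq β β' 0 0 (by omega) (by omega) (hinj h)).1)
    (fun x y h => by
      obtain ⟨h1, h2⟩ := huniq x.1 y.1 (x.2 + 1) (y.2 + 1) (by omega) (by omega) (hinj h)
      exact Prod.ext h1 (Fin.ext (by omega)))
    (fun β v β' h => by
      obtain ⟨-, h2⟩ := huniq β β' (v + 1) 0 (by omega) (by omega) (hinj h)
      omega)
    (fun β => henS _) (fun β v => henS _) (s := 1 / (32 * E)) (by positivity) le_rfl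
    (by
      have : 1 / E ≤ 2 / E := by gcongr; norm_num
      linarith) (w := fun _ => P / j) (fun β => hsE.trans hw1)
    (fun β => by have := simplex_nonneg p (en ⟨β * (g + 1) + 0, hidx β 0 (by omega)⟩); linarith)
    (by rw [Finset.sum_const, Finset.card_univ, Fintype.card_fin, nsmul_eq_mul]; field_simp; rfl)
  refine le_trans (ENNReal.ofReal_le_ofReal ?_) h
  rw [Fintype.card_fin, Fintype.card_fin]
  set x : ℝ := k / (E * P) with hx
  have hEP : 0 < E * P := by positivity
  have hx16 : 16 ≤ x := by rw [hx, le_div_iff₀ hEP]; exact hk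
  have hgx : x / 2 ≤ g := by
    have h1 : (k : ℝ) / j < q + 1 := by
      rw [div_lt_iff₀ hj0]
      have := Nat.lt_mul_div_succ k hjN
      rw [mul_comm]
      exact_mod_cast this
    have h2 : x ≤ k / j := by rw [hx]; gcongr
    have h3 : (q : ℝ) = g + 1 := by exact_mod_cast hg
    linarith
  -- g ≥ x / 2 and x ≥ 4 give g ≥ √x.
  have hlog : Real.log x / 2 ≤ Real.log g := by
    have h1 : Real.log (x / 2) ≤ Real.log g := Real.log_le_log (by linarith) hgx
    rw [Real.log_div (by linarith) (by norm_num)] at h1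
    have h2 : Real.log 4 ≤ Real.log x := Real.log_le_log (by norm_num) (by linarith)
    rw [show (4 : ℝ) = 2 ^ 2 by norm_num, Real.log_pow] at h2
    push_cast at h2
    linarith
  have hlx : 0 ≤ Real.log x := Real.log_nonneg (by linarith)
  calc P * (1 + Real.log x) / 4096 = (E * P / 2) * (1 / (32 * E) * ((1 + Real.log x) / 2) / 32) * 2
        / 2 := by field_simp; norm_num
    _ ≤ (E * P / 2) * (1 / (32 * E) * (1 + Real.log g) / 32) := by
        rw [mul_div_assoc, div_self two_ne_zero, mul_one]
        gcongr; linarith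
    _ ≤ j * (1 / (32 * E) * (1 + Real.log g) / 32) := by
        have : 0 ≤ Real.log g := by linarith
        gcongr

/-- Many small symbols of large combined mass: they are paired up. -/
theorem le_lowerDP_nbhdAdd_of_dense (hn : 1 ≤ n) {e : ℝ} (he : 0 < e) (he1 : e ≤ 1)
    (p : stdSimplex ℝ (Fin d)) {r : ℝ} (hr : 1 / (32 * (n * e)) ≤ r) {S : Finset (Fin d)}
    (hS : ∀ i ∈ S, p i ≤ r) (hk2 : 2 ≤ S.card)
    (hk : S.card ≤ 16 * (n * e * ∑ i ∈ S, p i)) :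
    ENNReal.ofReal (S.card / (3072 * (n * e))) ≤ lowerDP e e p n (nbhdAdd r) := by
  have hn0 : (0 : ℝ) < n := by exact_mod_cast hn
  set E : ℝ := n * e with hE
  have hE0 : 0 < E := by positivity
  -- Decreasing order of mass, so that a symbol left over when the number is odd is the lightest.
  have hex := exists_sorted_enum S fun i => -p i
  obtain ⟨k, hkdef⟩ : ∃ k, k = S.card := ⟨_, rfl⟩
  rw [← hkdef] at hex hk hk2 ⊢
  obtain ⟨en, hinj, henS, hsurj, hmono⟩ := hex
  have hanti : ∀ a b, a ≤ b → p (en b) ≤ p (en a) := fun a b hab => by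
    have := hmono hab; simpa using this
  set h := k / 2 with hh
  have hh1 : 1 ≤ h := by omega
  have b0 : ∀ β : Fin h, 2 * (β : ℕ) < k := fun β => by omega
  have b1 : ∀ β : Fin h, 2 * (β : ℕ) + 1 < k := fun β => by omega
  set o : Fin h → Fin d := fun β => en ⟨2 * β, b0 β⟩ with ho
  set V : Fin h → Unit → Fin d := fun β _ => en ⟨2 * β + 1, b1 β⟩ with hV
  have hoi : Function.Injective o := fun β β' hb => by
    have := hinj hb; simp only [Fin.mk.injEq] at this; omega
  have hVi : Function.Injective fun x : Fin h × Unit => V x.1 x.2 := fun x y hb => by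
    have := hinj hb; simp only [Fin.mk.injEq] at this
    exact Prod.ext (by omega) rfl
  have hVi' : Function.Injective fun β => V β () := fun x y hb =>
    congrArg Prod.fst (hVi (a₁ := (x, ())) (a₂ := (y, ())) hb)
  have hVo : ∀ β v β', V β v ≠ o β' := fun β v β' hb => by
    have := hinj hb; simp only [Fin.mk.injEq] at this; omega
  set T : Finset (Fin d) := Finset.univ.image o ∪ Finset.univ.image fun β => V β () with hT
  have hoT : ∀ β, o β ∈ T := fun β =>
    Finset.mem_union_left _ (Finset.mem_image_of_mem _ (Finset.mem_univ _))
  have hVT : ∀ β v, V β v ∈ T := fun β v =>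
    Finset.mem_union_right _ (Finset.mem_image_of_mem (fun β => V β ()) (Finset.mem_univ _))
  have hTS : T ⊆ S := by
    intro i hi
    rcases Finset.mem_union.1 hi with hi | hi
    · obtain ⟨β, -, rfl⟩ := Finset.mem_image.1 hi; exact henS _
    · obtain ⟨β, -, rfl⟩ := Finset.mem_image.1 hi; exact henS _
  have hsumT : ∑ i ∈ T, p i = ∑ β, (p (o β) + p (V β ())) := by
    rw [hT, Finset.sum_union, Finset.sum_image fun x _ y _ h => hoi h,
      Finset.sum_image fun x _ y _ h => hVi' h, Finset.sum_add_distrib]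
    rw [Finset.disjoint_left]
    intro i hi hi'
    obtain ⟨β, -, rfl⟩ := Finset.mem_image.1 hi
    obtain ⟨β', -, hβ⟩ := Finset.mem_image.1 hi'
    exact hVo β' () β hβ
  have hle : ∀ β, p (V β ()) ≤ p (o β) := fun β => hanti _ _ (by simp)
  set W : ℝ := ∑ i ∈ T, p i with hW
  set P : ℝ := ∑ i ∈ S, p i with hP
  have hW0 : 0 ≤ W := Finset.sum_nonneg fun j _ => simplex_nonneg p j
  have hh0 : (0 : ℝ) < h := by exact_mod_cast hh1
  -- At most the lightest symbol is unpaired, and its mass is at most that of the first reservoir.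
  have hPW : P ≤ 2 * W := by
    have hdiff : ∀ i ∈ S \ T, ∀ i' ∈ S \ T, i = i' := by
      have hlast : ∀ i ∈ S \ T, ∃ hk1 : k - 1 < k, i = en ⟨k - 1, hk1⟩ := by
        intro i hi
        obtain ⟨hiS, hiT⟩ := Finset.mem_sdiff.1 hi
        obtain ⟨⟨a, ha⟩, rfl⟩ := hsurj i hiS
        refine ⟨by omega, ?_⟩
        congr 2
        by_contra hne
        rcases Nat.even_or_odd' a with ⟨b, hb | hb⟩
        · have hb' : b < h := by omega
          subst hb
          exact hiT (hoT ⟨b, hb'⟩)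
        · have hb' : b < h := by omega
          subst hb
          exact hiT (hVT ⟨b, hb'⟩ ())
      intro i hi i' hi'
      obtain ⟨_, h1⟩ := hlast i hi
      obtain ⟨_, h2⟩ := hlast i' hi'
      rw [h1, h2]
    have hsub : ∑ i ∈ S \ T, p i ≤ W := by
      rcases (S \ T).eq_empty_or_nonempty with h0 | ⟨i, hi⟩
      · rw [h0]; simpa using hW0
      · have hs : S \ T = {i} := Finset.eq_singleton_iff_unique_mem.2 ⟨hi, fun i' hi' =>
          hdiff i' hi' i hi⟩
        rw [hs, Finset.sum_singleton]
        obtain ⟨⟨a, ha⟩, rfl⟩ := hsurj i (Finset.mem_sdiff.1 hi).1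
        calc p (en ⟨a, ha⟩) ≤ p (o ⟨0, hh1⟩) := hanti _ _ (by simp)
          _ ≤ W := Finset.single_le_sum (fun j _ => simplex_nonneg p j) (hoT _)
    have := Finset.sum_sdiff hTS (f := fun i => p i)
    linarith
  have hWr : W ≤ h * (2 * r) := by
    rw [hsumT]
    calc ∑ β, (p (o β) + p (V β ())) ≤ ∑ _β : Fin h, 2 * r :=
          Finset.sum_le_sum fun β _ => by
            linarith [hS _ (hTS (hoT β)), hS _ (hTS (hVT β ()))]
      _ = h * (2 * r) := by
          rw [Finset.sum_const, Finset.card_univ, Fintype.card_fin, nsmul_eq_mul]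
  have hc1 : 1 / (32 * E) ≤ W / (2 * h) := by
    rw [div_le_div_iff₀ (by positivity) (by positivity)]
    have : (2 * h : ℝ) ≤ k := by exact_mod_cast (show 2 * h ≤ k by omega)
    nlinarith
  have hc2 : W / (2 * h) ≤ r := by
    rw [div_le_iff₀ (by positivity)]; linarith
  have hmain := card_mul_le_lowerDP_nbhdAdd (ι := Fin h) (υ := Unit) hn he he1 p
    (fun i hi => hS i (hTS hi)) hoi hVi hVo hoT hVT (s := 1 / (32 * E)) (by positivity) le_rfl hr
    -- Half of the paired mass stays within its pair, which is at most p (o β); the other half is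
    -- spread evenly, which secures at least s for every reservoir and adds at most r. The weights
    -- sum to W/2 + W/2.
    (w := fun β => (p (o β) + p (V β ())) / 2 + W / (2 * h))
    (fun β => by have := simplex_nonneg p (o β); have := simplex_nonneg p (V β ()); linarith)
    (fun β => by have := hle β; linarith)
    (by
      rw [Finset.sum_add_distrib, ← Finset.sum_div, ← hsumT, Finset.sum_const, Finset.card_univ,
        Fintype.card_fin, nsmul_eq_mul]
      field_simp; ring)
  refine le_trans (ENNReal.ofReal_le_ofReal ?_) hmain
  rw [Fintype.card_fin, Fintype.card_unit, Nat.cast_one, Real.log_one, add_zero, mul_one]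
  have h3 : (k : ℝ) ≤ 3 * h := by exact_mod_cast (show k ≤ 3 * h by omega)
  calc (k : ℝ) / (3072 * E) ≤ 3 * h / (3072 * E) := by gcongr
    _ = _ := by field_simp; norm_num

end PrivateKL

/-! ### Exponential moments of noisy counts and the errors they control. -/

namespace PrivateKL

/-- The moment generating function of `Y` is, up to a constant factor and on `[-e / 2, e / 2]`, at
most that of a Poisson variable of mean `l`. -/
structure HasMGFBound {Ω : Type*} [MeasurableSpace Ω] (μ : Measure Ω) (Y : Ω → ℝ) (l e : ℝ) :
    Prop where
  measurable : Measurable Y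
  bound : ∀ s : ℝ, |s| ≤ e / 2 →
    ∫⁻ ω, ENNReal.ofReal (Real.exp (s * Y ω)) ∂μ ≤
      ENNReal.ofReal (4 / 3 * Real.exp (l * (Real.exp s - 1)))

namespace HasMGFBound

variable {Ω : Type*} [MeasurableSpace Ω] {μ : Measure Ω} {X Y : Ω → ℝ} {l e : ℝ}

theorem lintegral_exp_le (hY : HasMGFBound μ Y l e) {K s c : ℝ} (hK : 0 ≤ K) (hs : |s| ≤ e / 2) :
    ∫⁻ ω, ENNReal.ofReal (K * Real.exp (s * (Y ω - c))) ∂μ ≤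
      ENNReal.ofReal (K * (4 / 3 * Real.exp (l * (Real.exp s - 1) - s * c))) := by
  have hm := hY.measurable
  have h1 : ∀ ω, ENNReal.ofReal (K * Real.exp (s * (Y ω - c))) =
      ENNReal.ofReal (K * Real.exp (-(s * c))) * ENNReal.ofReal (Real.exp (s * Y ω)) := fun ω => by
    rw [← ENNReal.ofReal_mul (by positivity), mul_assoc, ← Real.exp_add]
    ring_nf
  simp only [h1]
  rw [lintegral_const_mul _ (by fun_prop)]
  refine (mul_le_mul_right (hY.bound s hs) _).trans (le_of_eq ?_)
  rw [← ENNReal.ofReal_mul (by positivity), sub_eq_add_neg (l * _), Real.exp_add]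
  ring_nf

/-- A bound by a combination of exponentials passes to expectations. -/
theorem lintegral_ofReal_le [IsProbabilityMeasure μ] (hY : HasMGFBound μ Y l e) {f : Ω → ℝ}
    {K₀ K₁ K₂ K₃ s₁ s₂ s₃ c₁ c₂ c₃ : ℝ} (h0 : 0 ≤ K₀) (h1 : 0 ≤ K₁) (h2 : 0 ≤ K₂) (h3 : 0 ≤ K₃)
    (hs1 : |s₁| ≤ e / 2) (hs2 : |s₂| ≤ e / 2) (hs3 : |s₃| ≤ e / 2)
    (hf : ∀ ω, f ω ≤ K₀ + K₁ * Real.exp (s₁ * (Y ω - c₁)) + K₂ * Real.exp (s₂ * (Y ω - c₂)) +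
      K₃ * Real.exp (s₃ * (Y ω - c₃))) :
    ∫⁻ ω, ENNReal.ofReal (f ω) ∂μ ≤ ENNReal.ofReal (K₀ +
      K₁ * (4 / 3 * Real.exp (l * (Real.exp s₁ - 1) - s₁ * c₁)) +
      K₂ * (4 / 3 * Real.exp (l * (Real.exp s₂ - 1) - s₂ * c₂)) +
      K₃ * (4 / 3 * Real.exp (l * (Real.exp s₃ - 1) - s₃ * c₃))) := by
  have hm := hY.measurable
  calc ∫⁻ ω, ENNReal.ofReal (f ω) ∂μ
      ≤ ∫⁻ ω, (ENNReal.ofReal K₀ + ENNReal.ofReal (K₁ * Real.exp (s₁ * (Y ω - c₁))) +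
        ENNReal.ofReal (K₂ * Real.exp (s₂ * (Y ω - c₂))) +
        ENNReal.ofReal (K₃ * Real.exp (s₃ * (Y ω - c₃)))) ∂μ := by
        refine lintegral_mono fun ω => (ENNReal.ofReal_le_ofReal (hf ω)).trans (le_of_eq ?_)
        rw [ENNReal.ofReal_add (by positivity) (by positivity),
          ENNReal.ofReal_add (by positivity) (by positivity),
          ENNReal.ofReal_add (by positivity) (by positivity)]
    _ ≤ _ := by
        rw [lintegral_add_left (by fun_prop), lintegral_add_left (by fun_prop),
          lintegral_add_left (by fun_prop), lintegral_const, measure_univ, mul_one,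
          ENNReal.ofReal_add (by positivity) (by positivity),
          ENNReal.ofReal_add (by positivity) (by positivity),
          ENNReal.ofReal_add (by positivity) (by positivity)]
        gcongr
        · exact hY.lintegral_exp_le h1 hs1
        · exact hY.lintegral_exp_le h2 hs2
        · exact hY.lintegral_exp_le h3 hs3

end HasMGFBound

theorem exp_sub_one_le_of_nonneg {s : ℝ} (h0 : 0 ≤ s) (h1 : s ≤ 1) : Real.exp s - 1 ≤ 2 * s := by
  have := Real.abs_exp_sub_one_sub_id_le (x := s) (by rw [abs_le]; constructor <;> linarith)
  have := (abs_le.1 this).2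
  nlinarith

/-- (1 + y + y²/2)(1 - y + y²/2) = 1 + y⁴/4 ≥ 1, and the first factor is at most exp y. -/
theorem exp_neg_le_quadratic {y : ℝ} (hy : 0 ≤ y) : Real.exp (-y) ≤ 1 - y + y ^ 2 / 2 := by
  have h1 := Real.quadratic_le_exp_of_nonneg hy
  have h2 : 0 < 1 + y + y ^ 2 / 2 := by positivity
  rw [Real.exp_neg, inv_le_comm₀ (Real.exp_pos y) (by nlinarith [sq_nonneg (1 - y)])]
  refine le_trans ?_ h1
  rw [inv_le_iff_one_le_mul₀ (by nlinarith [sq_nonneg (1 - y)])]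
  nlinarith [sq_nonneg (y ^ 2)]

theorem sq_le_exp_of_nonneg {u : ℝ} (h : 0 ≤ u) : u ^ 2 ≤ Real.exp u := by
  have h1 := Real.quadratic_le_exp_of_nonneg (x := u / 2) (by positivity)
  have h2 : Real.exp u = Real.exp (u / 2) ^ 2 := by
    rw [sq, ← Real.exp_add]; congr 1; ring
  have h3 : (1 + u / 2 + (u / 2) ^ 2 / 2) ^ 2 ≤ Real.exp (u / 2) ^ 2 :=
    pow_le_pow_left₀ (by positivity) h1 2
  rw [h2]
  nlinarith [mul_nonneg h (show 0 ≤ 1 - u / 2 + u ^ 2 / 8 by nlinarith [sq_nonneg (u - 2)]),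
    sq_nonneg (u ^ 2)]

theorem sq_le_exp_add_exp_neg (u : ℝ) : u ^ 2 ≤ Real.exp u + Real.exp (-u) := by
  rcases le_total 0 u with h | h
  · linarith [sq_le_exp_of_nonneg h, Real.exp_pos (-u)]
  · have := sq_le_exp_of_nonneg (neg_nonneg.2 h)
    rw [neg_sq] at this
    linarith [Real.exp_pos u]

theorem cube_mul_exp_neg_le {u : ℝ} (hu : 0 ≤ u) : u ^ 3 * Real.exp (-(u / 8)) ≤ 3072 := by
  have h := Real.pow_div_factorial_le_exp (u / 8) (by positivity) 3
  rw [Real.exp_neg, ← div_eq_mul_inv, div_le_iff₀ (Real.exp_pos _)]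
  have : (Nat.factorial 3 : ℝ) = 6 := by norm_num [Nat.factorial]
  rw [this] at h
  have e : (u / 8) ^ 3 / 6 = u ^ 3 / 3072 := by ring
  rw [e] at h
  linarith

theorem mul_exp_neg_le {u : ℝ} : u * Real.exp (-(u / 8)) ≤ 8 := by
  have h := Real.add_one_le_exp (u / 8)
  rw [Real.exp_neg, ← div_eq_mul_inv, div_le_iff₀ (Real.exp_pos _)]
  linarith

theorem klTerm_le_right {a b : ℝ} (ha : 0 ≤ a) (hab : a ≤ b) : klTerm a b ≤ b := by
  rcases ha.eq_or_lt with rfl | ha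
  · rw [klTerm_zero_left]
  have : Real.log (a / b) ≤ 0 :=
    Real.log_nonpos (by have := ha.trans_le hab; positivity)
      ((div_le_one (ha.trans_le hab)).2 hab)
  unfold klTerm
  nlinarith

/-- Shrinking the second argument by a factor `M`. -/
theorem klTerm_div_eq {a b M : ℝ} (hb : 0 < b) (hM : 0 < M) :
    klTerm a (b / M) = a * Real.log M + (klTerm a b - b + b / M) := by
  by_cases ha : a = 0
  · simp [ha, klTerm]
  unfold klTerm
  rw [div_div_eq_mul_div, Real.log_div (mul_ne_zero ha hM.ne') hb.ne', Real.log_mul ha hM.ne',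
    Real.log_div ha hb.ne']
  ring

theorem max_le_exp {e y c : ℝ} (he : 0 < e) (hc : 0 < c) :
    max y (1 / e) ≤ 1 / e + c / e * Real.exp (e / c * y) := by
  have h0 : 0 ≤ c / e * Real.exp (e / c * y) := by positivity
  refine max_le ?_ (by linarith)
  have h1 := Real.add_one_le_exp (e / c * y)
  have h2 : y = c / e * (e / c * y) := by field_simp
  have h3 : 0 ≤ c / e := by positivity
  have h4 : 0 < 1 / e := by positivity
  calc y = c / e * (e / c * y) := h2
    _ ≤ c / e * Real.exp (e / c * y) := by gcongr; linarith
    _ ≤ _ := by linarith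

/-- The pointwise error of a truncated noisy count of large mean. -/
theorem klTerm_max_le {l e y : ℝ} (he : 0 < e) (hl : 1 ≤ e * l) :
    klTerm l (max y (1 / e)) ≤
      2 / l * (l - y) ^ 2 + l ^ 2 * e * Real.exp (-(e / 2) * (y - l / 2)) := by
  have hl1 : 1 / e ≤ l := by rw [div_le_iff₀ he]; linarith
  have he1 : 0 < 1 / e := by positivity
  have hl0 : 0 < l := by linarith
  set b := max y (1 / e) with hb
  have hb0 : 0 < b := lt_max_of_lt_right he1
  have h := klTerm_le hl0.le hb0
  have hE := Real.exp_pos (-(e / 2) * (y - l / 2))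
  -- If the truncated count is at least l/2, the χ² bound gives the square, and truncation at 1/e ≤
  -- l only helps. Otherwise truncation bounds the loss by l² e, and the exponential dominates the
  -- indicator of y ≤ l/2.
  rcases le_total (l / 2) b with h2 | h2
  · have h3 : (l - b) ^ 2 ≤ (l - y) ^ 2 := by
      rcases le_total y (1 / e) with hy | hy
      · rw [hb, max_eq_right hy]; nlinarith
      · rw [hb, max_eq_left hy]
    calc klTerm l b ≤ (l - b) ^ 2 / b := h
      _ ≤ (l - y) ^ 2 / (l / 2) := by gcongr
      _ = 2 / l * (l - y) ^ 2 := by field_simp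
      _ ≤ _ := by nlinarith [mul_pos (mul_pos (sq_pos_of_pos hl0) he) hE]
  · have h3 : y ≤ l / 2 := (le_max_left _ _).trans h2
    have h4 : 1 ≤ Real.exp (-(e / 2) * (y - l / 2)) := Real.one_le_exp (by nlinarith)
    have h5 : 1 / e ≤ b := le_max_right _ _
    calc klTerm l b ≤ (l - b) ^ 2 / b := h
      _ ≤ l ^ 2 / (1 / e) := by gcongr <;> linarith
      _ = l ^ 2 * e * 1 := by field_simp
      _ ≤ l ^ 2 * e * Real.exp (-(e / 2) * (y - l / 2)) := by gcongr
      _ ≤ _ := by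
        have : 0 ≤ 2 / l * (l - y) ^ 2 := by positivity
        linarith

namespace HasMGFBound

variable {Ω : Type*} [MeasurableSpace Ω] {μ : Measure Ω} [IsProbabilityMeasure μ] {X Y : Ω → ℝ}
  {l e : ℝ}

/-- The error is (variance) / l, where the variance is of order l + 1/e² (Poisson plus Laplace),
together with an exponentially small contribution from the event that the count falls below l/2. -/
theorem lintegral_klTerm_le_of_one_le (hY : HasMGFBound μ Y l e) (he : 0 < e) (he1 : e ≤ 1)
    (hl : 1 ≤ e * l) :
    ∫⁻ ω, ENNReal.ofReal (klTerm l (max (Y ω) (1 / e))) ∂μ ≤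
      ENNReal.ofReal (4200 * (1 + 1 / (e ^ 2 * l))) := by
  have hl0 : 0 < l := by by_contra h; push Not at h; nlinarith
  have hq : 0 < √l := by positivity
  -- The second moment is bounded by u² ≤ exp u + exp(-u) for u = s (Y - l). This `s` is admissible
  -- for the moment bound and keeps the exponent l (exp s - 1 - s) ≤ l s² at most 1, while 1/s² has
  -- the order of the variance.
  set s : ℝ := min (e / 2) (1 / √l) with hs
  have hs0 : 0 < s := by positivity
  have hse : s ≤ e / 2 := min_le_left _ _
  have hs2 : l * s ^ 2 ≤ 1 := by
    have h1 : s * √l ≤ 1 := by rw [← le_div_iff₀ hq]; exact min_le_right _ _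
    have h2 : 0 ≤ s * √l := by positivity
    calc l * s ^ 2 = (s * √l) ^ 2 := by rw [mul_pow, Real.sq_sqrt hl0.le]; ring
      _ ≤ 1 := pow_le_one₀ h2 h1
  have hsi : 1 / s ^ 2 ≤ 4 / e ^ 2 + l := by
    rcases min_choice (e / 2) (1 / √l) with h | h
    · rw [hs, h]
      have : 1 / (e / 2) ^ 2 = 4 / e ^ 2 := by field_simp; norm_num
      rw [this]; linarith
    · rw [hs, h, div_pow, Real.sq_sqrt hl0.le, one_pow, one_div_one_div]
      have : 0 < 4 / e ^ 2 := by positivity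
      linarith
  have hsabs : |s| ≤ e / 2 := by rwa [abs_of_pos hs0]
  refine (hY.lintegral_ofReal_le (K₀ := 0) (K₁ := 2 / l * (1 / s ^ 2)) (K₂ := 2 / l * (1 / s ^ 2))
    (K₃ := l ^ 2 * e) (s₁ := s) (s₂ := -s) (s₃ := -(e / 2)) (c₁ := l) (c₂ := l) (c₃ := l / 2)
    le_rfl (by positivity) (by positivity) (by positivity) hsabs (by rwa [abs_neg])
    (by rw [abs_neg, abs_of_pos (by positivity)]) fun ω => ?_).trans
    (ENNReal.ofReal_le_ofReal ?_)
  · refine (klTerm_max_le he hl).trans ?_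
    have h := sq_le_exp_add_exp_neg (s * (Y ω - l))
    have h2 : (l - Y ω) ^ 2 ≤ 1 / s ^ 2 * (Real.exp (s * (Y ω - l)) + Real.exp (-s * (Y ω - l))) := by
      rw [one_div, inv_mul_eq_div, le_div_iff₀ (by positivity), neg_mul]
      nlinarith
    have h3 : 0 < 2 / l := by positivity
    have h4 := mul_le_mul_of_nonneg_left h2 h3.le
    linarith
  · have hs1 : |s| ≤ 1 := hsabs.trans (by linarith)
    have a1 := (abs_le.1 (Real.abs_exp_sub_one_sub_id_le hs1)).2
    have a2 := (abs_le.1 (Real.abs_exp_sub_one_sub_id_le (x := -s) (by rwa [abs_neg]))).2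
    have e1 : Real.exp 1 ≤ 3 := by linarith [Real.exp_one_lt_d9]
    have b1 : Real.exp (l * (Real.exp s - 1) - s * l) ≤ 3 :=
      (Real.exp_le_exp.2 (by nlinarith)).trans e1
    have b2 : Real.exp (l * (Real.exp (-s) - 1) - -s * l) ≤ 3 :=
      (Real.exp_le_exp.2 (by nlinarith)).trans e1
    have a3 := exp_neg_le_quadratic (y := e / 2) (by positivity)
    have b3 : Real.exp (l * (Real.exp (-(e / 2)) - 1) - -(e / 2) * (l / 2)) ≤
        Real.exp (-(e * l / 8)) := Real.exp_le_exp.2 (by nlinarith [mul_pos he hl0])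
    have c3 := cube_mul_exp_neg_le (u := e * l) (by positivity)
    have d1 : 2 / l * (1 / s ^ 2) ≤ 2 + 8 / (e ^ 2 * l) := by
      calc 2 / l * (1 / s ^ 2) ≤ 2 / l * (4 / e ^ 2 + l) := by gcongr
        _ = 2 + 8 / (e ^ 2 * l) := by field_simp; ring
    have d3 : l ^ 2 * e * Real.exp (-(e * l / 8)) ≤ 3072 / (e ^ 2 * l) := by
      rw [le_div_iff₀ (by positivity)]
      calc _ = (e * l) ^ 3 * Real.exp (-(e * l / 8)) := by ring
        _ ≤ _ := c3
    have d0 : 0 ≤ 2 / l * (1 / s ^ 2) := by positivity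
    have f1 : 0 ≤ 1 / (e ^ 2 * l) := by positivity
    have f8 : 8 / (e ^ 2 * l) = 8 * (1 / (e ^ 2 * l)) := by ring
    have f3 : 3072 / (e ^ 2 * l) = 3072 * (1 / (e ^ 2 * l)) := by ring
    rw [f8] at d1
    rw [f3] at d3
    have g1 := mul_le_mul_of_nonneg_left b1 d0
    have g2 := mul_le_mul_of_nonneg_left b2 d0
    have g3 := mul_le_mul_of_nonneg_left b3 (show 0 ≤ l ^ 2 * e by positivity)
    linarith

theorem lintegral_max_le (hY : HasMGFBound μ Y l e) (he : 0 < e) (he1 : e ≤ 1) (hl0 : 0 ≤ l)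
    (hl : e * l ≤ 1) {K : ℝ} (hK : 0 ≤ K) :
    ∫⁻ ω, ENNReal.ofReal (K * max (Y ω) (1 / e)) ∂μ ≤ ENNReal.ofReal (9 * (K / e)) := by
  refine (hY.lintegral_ofReal_le (K₀ := K / e) (K₁ := 2 * K / e) (K₂ := 0) (K₃ := 0)
    (s₁ := e / 2) (s₂ := 0) (s₃ := 0) (c₁ := 0) (c₂ := 0) (c₃ := 0)
    (by positivity) (by positivity) le_rfl le_rfl (by rw [abs_of_pos (by positivity)])
    (by simp; positivity) (by simp; positivity) fun ω => ?_).trans (ENNReal.ofReal_le_ofReal ?_)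
  · have := mul_le_mul_of_nonneg_left (max_le_exp (e := e) (y := Y ω) he two_pos) hK
    calc _ ≤ _ := this
      _ = _ := by rw [sub_zero]; ring
  · have a := exp_sub_one_le_of_nonneg (s := e / 2) (by positivity) (by linarith)
    have b : Real.exp (l * (Real.exp (e / 2) - 1) - e / 2 * 0) ≤ 3 :=
      (Real.exp_le_exp.2 (show _ ≤ (1 : ℝ) by nlinarith)).trans
        (by linarith [Real.exp_one_lt_d9])
    have c : 0 ≤ 2 * K / e := by positivity
    have := mul_le_mul_of_nonneg_left b c
    have f2 : 2 * K / e = 2 * (K / e) := by ring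
    rw [f2] at this ⊢
    linarith

/-- The expected error of a truncated noisy count. -/
theorem lintegral_klTerm_le (hY : HasMGFBound μ Y l e) (he : 0 < e) (he1 : e ≤ 1) (hl0 : 0 ≤ l) :
    ∫⁻ ω, ENNReal.ofReal (klTerm l (max (Y ω) (1 / e))) ∂μ ≤ ENNReal.ofReal (8400 / e) := by
  rcases le_total 1 (e * l) with h | h
  · refine (hY.lintegral_klTerm_le_of_one_le he he1 h).trans (ENNReal.ofReal_le_ofReal ?_)
    have h1 : 1 ≤ 1 / e := by rw [le_div_iff₀ he]; linarith
    have h2 : 1 / (e ^ 2 * l) ≤ 1 / e := one_div_le_one_div_of_le he (by nlinarith)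
    have : 8400 / e = 4200 * (1 / e + 1 / e) := by ring
    rw [this]; gcongr
  · refine le_trans (lintegral_mono fun ω => ENNReal.ofReal_le_ofReal ?_)
      ((hY.lintegral_max_le he he1 hl0 h zero_le_one).trans (ENNReal.ofReal_le_ofReal ?_))
    · rw [one_mul]
      refine klTerm_le_right hl0 (le_max_of_le_right ?_)
      rw [le_div_iff₀ he]; linarith
    · have : 0 < 1 / e := by positivity
      have : 8400 / e = 8400 * (1 / e) := by ring
      linarith

/-- The probability that a symbol of large mean is declared small. -/
theorem lintegral_indicator_le (hY : HasMGFBound μ Y l e) (he : 0 < e) (he1 : e ≤ 1) (hl0 : 0 < l)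
    {τ K : ℝ} (hl : 3 * τ ≤ e * l) (hK : 0 ≤ K) :
    ∫⁻ ω, ENNReal.ofReal (if Y ω ≤ τ / e then K else 0) ∂μ ≤
      ENNReal.ofReal (K * (4 / 3 * Real.exp (-(e * l / 8)))) := by
  refine (hY.lintegral_ofReal_le (K₀ := 0) (K₁ := K) (K₂ := 0) (K₃ := 0)
    (s₁ := -(e / 2)) (s₂ := 0) (s₃ := 0) (c₁ := l / 3) (c₂ := 0) (c₃ := 0)
    le_rfl hK le_rfl le_rfl (by rw [abs_neg, abs_of_pos (by positivity)])
    (by simp; positivity) (by simp; positivity) fun ω => ?_).trans (ENNReal.ofReal_le_ofReal ?_)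
  · simp only [zero_mul, add_zero, zero_add]
    split_ifs with h
    · refine le_mul_of_one_le_right hK (Real.one_le_exp ?_)
      -- The threshold is at most a third of the mean, so the lower tail is exponentially small in e
      -- l.
      have : τ / e ≤ l / 3 := by rw [div_le_div_iff₀ he (by norm_num)]; linarith
      nlinarith
    · positivity
  · simp only [zero_mul, add_zero, zero_add]
    have a := exp_neg_le_quadratic (y := e / 2) (by positivity)
    gcongr
    nlinarith [mul_pos he hl0]

end HasMGFBound

end PrivateKL

/-! ### Expected loss of a single symbol. -/

namespace PrivateKL

noncomputable section

/-- The contribution to the KL error of a symbol of mean `l` whose two noisy counts are `x` and `y`;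
`M` is the ratio of the noisy to the true combined mass of the small symbols. -/
def symbolLoss (M τ e l x y : ℝ) : ℝ :=
  if x ≤ τ / e then klTerm l (max x (1 / e) / M)
  else (klTerm l (max x (1 / e)) + klTerm l (max y (1 / e))) / 2

theorem klTerm_div_le {a b M : ℝ} (hb : 0 < b) (hM : 1 ≤ M) :
    klTerm a (b / M) ≤ a * Real.log M + klTerm a b := by
  rw [klTerm_div_eq hb (by linarith)]
  have : b / M ≤ b := div_le_self hb.le hM
  linarith

namespace HasMGFBound

theorem measurable_klTerm {Ω : Type*} [MeasurableSpace Ω] {μ : Measure Ω} {X : Ω → ℝ} {l e : ℝ}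
    (hX : HasMGFBound μ X l e) :
    Measurable fun ω => ENNReal.ofReal (klTerm l (max (X ω) (1 / e))) := by
  have := hX.measurable
  unfold klTerm; fun_prop

variable {Ω : Type*} [MeasurableSpace Ω] {μ : Measure Ω} [IsProbabilityMeasure μ] {X Y : Ω → ℝ}
  {l e : ℝ}

/-- The expected loss of a symbol of large mean. -/
theorem lintegral_symbolLoss_le_of_large (hX : HasMGFBound μ X l e) (hY : HasMGFBound μ Y l e)
    (he : 0 < e) (he1 : e ≤ 1) {τ M : ℝ} (hτ : 1 ≤ τ) (hM1 : 1 ≤ M)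
    (hM : Real.log M ≤ 1 + τ / 4) (hl : 3 * τ ≤ e * l) :
    ∫⁻ ω, ENNReal.ofReal (symbolLoss M τ e l (X ω) (Y ω)) ∂μ ≤
      ENNReal.ofReal (16600 * (1 + 1 / (e ^ 2 * l))) := by
  have hl1 : 1 ≤ e * l := by linarith
  have hl0 : 0 < l := by by_contra h; push Not at h; nlinarith
  have hinv : 0 < 1 / e := by positivity
  have hpt : ∀ ω, ENNReal.ofReal (symbolLoss M τ e l (X ω) (Y ω)) ≤
      ENNReal.ofReal (klTerm l (max (X ω) (1 / e))) +
      ENNReal.ofReal (klTerm l (max (Y ω) (1 / e))) +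
      ENNReal.ofReal (if X ω ≤ τ / e then 2 * l * (e * l) else 0) := fun ω => by
    have hc1 : 0 < max (X ω) (1 / e) := lt_max_of_lt_right hinv
    have h1 := klTerm_nonneg hl0.le hc1
    have h2 := klTerm_nonneg hl0.le (lt_max_of_lt_right hinv : 0 < max (Y ω) (1 / e))
    have hK : 0 ≤ 2 * l * (e * l) := by positivity
    rw [← ENNReal.ofReal_add h1 h2, ← ENNReal.ofReal_add (by linarith)
      (by split_ifs <;> linarith)]
    refine ENNReal.ofReal_le_ofReal ?_
    unfold symbolLoss
    split_ifs with h
    · have h3 := klTerm_div_le (a := l) hc1 hM1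
      -- ln M ≤ 1 + τ/4 ≤ 3 τ ≤ e l: declaring the symbol small costs at most a polynomial in e l,
      -- which the probability exp(-e l / 8) of doing so outweighs.
      have h4 : l * Real.log M ≤ l * (e * l) := mul_le_mul_of_nonneg_left (by linarith) hl0.le
      have : klTerm l (max (X ω) (1 / e)) ≤
        klTerm l (max (X ω) (1 / e)) + klTerm l (max (Y ω) (1 / e)) := by linarith
      nlinarith [mul_pos hl0 (mul_pos he hl0)]
    · linarith
  have hmX := hX.measurable
  have mX := hX.measurable_klTerm
  have mY := hY.measurable_klTerm
  refine (lintegral_mono hpt).trans ?_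
  rw [lintegral_add_left (by fun_prop), lintegral_add_left mX]
  have c3 := cube_mul_exp_neg_le (u := e * l) (by positivity)
  have hpos : 0 < 1 / (e ^ 2 * l) := by positivity
  have d3 : 2 * l * (e * l) * (4 / 3 * Real.exp (-(e * l / 8))) ≤ 8192 * (1 / (e ^ 2 * l)) := by
    rw [mul_one_div, le_div_iff₀ (by positivity)]
    calc _ = 8 / 3 * ((e * l) ^ 3 * Real.exp (-(e * l / 8))) := by ring
      _ ≤ 8 / 3 * 3072 := by gcongr
      _ = 8192 := by norm_num
  refine (add_le_add (add_le_add (hX.lintegral_klTerm_le_of_one_le he he1 hl1)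
    (hY.lintegral_klTerm_le_of_one_le he he1 hl1))
    (hX.lintegral_indicator_le he he1 hl0 hl (by positivity))).trans ?_
  rw [← ENNReal.ofReal_add (by positivity) (by positivity),
    ← ENNReal.ofReal_add (by positivity) (by positivity)]
  exact ENNReal.ofReal_le_ofReal (by linarith)

/-- The expected loss of a symbol of small mean. -/
theorem lintegral_symbolLoss_le_of_small (hX : HasMGFBound μ X l e) (hY : HasMGFBound μ Y l e)
    (he : 0 < e) (he1 : e ≤ 1) {τ M : ℝ} (hM1 : 1 ≤ M)
    (hM : Real.log M ≤ 1 + τ / 4) (hl0 : 0 ≤ l) :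
    ∫⁻ ω, ENNReal.ofReal (symbolLoss M τ e l (X ω) (Y ω)) ∂μ ≤
      ENNReal.ofReal (l * Real.log M + 16800 * (min l (1 / e) + 1 / (e * M))) := by
  have hinv : 0 < 1 / e := by positivity
  have hM0 : 0 < M := by linarith
  have hlog : 0 ≤ Real.log M := Real.log_nonneg hM1
  have hmX := hX.measurable
  have hmY := hY.measurable
  have hlM : 0 ≤ l * Real.log M := mul_nonneg hl0 hlog
  have hiM : 0 < 1 / (e * M) := by positivity
  have hc1 : ∀ ω, 0 < max (X ω) (1 / e) := fun ω => lt_max_of_lt_right hinv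
  have hc2 : ∀ ω, 0 < max (Y ω) (1 / e) := fun ω => lt_max_of_lt_right hinv
  -- If l ≥ 1/e, either count has error O(1/e) whatever the classification. Otherwise being declared
  -- large must be shown to be rare.
  rcases le_total 1 (e * l) with h | h
  · have hle : 1 / e ≤ l := by rw [div_le_iff₀ he]; linarith
    rw [min_eq_right hle]
    have hpt : ∀ ω, ENNReal.ofReal (symbolLoss M τ e l (X ω) (Y ω)) ≤
        ENNReal.ofReal (l * Real.log M) + ENNReal.ofReal (klTerm l (max (X ω) (1 / e))) +
        ENNReal.ofReal (klTerm l (max (Y ω) (1 / e))) := fun ω => by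
      have h1 := klTerm_nonneg hl0 (hc1 ω)
      have h2 := klTerm_nonneg hl0 (hc2 ω)
      rw [← ENNReal.ofReal_add hlM h1, ← ENNReal.ofReal_add (by linarith) h2]
      refine ENNReal.ofReal_le_ofReal ?_
      unfold symbolLoss
      split_ifs with h
      · linarith [klTerm_div_le (a := l) (hc1 ω) hM1]
      · linarith
    have mX := hX.measurable_klTerm
    have mY := hY.measurable_klTerm
    refine (lintegral_mono hpt).trans ?_
    rw [lintegral_add_left (by fun_prop), lintegral_add_left measurable_const, lintegral_const, measure_univ, mul_one]
    refine (add_le_add (add_le_add le_rfl (hX.lintegral_klTerm_le he he1 hl0))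
      (hY.lintegral_klTerm_le he he1 hl0)).trans ?_
    rw [← ENNReal.ofReal_add hlM (by positivity), ← ENNReal.ofReal_add (by positivity)
      (by positivity)]
    refine ENNReal.ofReal_le_ofReal ?_
    have : 8400 / e = 8400 * (1 / e) := by ring
    linarith
  · set q : ℝ := Real.exp (-(τ / 4)) with hq
    -- Here the bound on ln M is used: exceeding the threshold τ/e has probability of order
    -- exp(-τ/4), which is O(1/M), as needed for the term 1 / (e M).
    have hqM : q ≤ 3 / M := by
      have h1 : M ≤ Real.exp 1 * Real.exp (τ / 4) := by
        rw [← Real.exp_add, ← Real.exp_log hM0]; exact Real.exp_le_exp.2 hM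
      rw [le_div_iff₀ hM0, hq, Real.exp_neg, inv_mul_le_iff₀ (Real.exp_pos _)]
      have := Real.exp_one_lt_d9
      nlinarith [Real.exp_pos (τ / 4)]
    have hq0 : 0 < q := Real.exp_pos _
    have hexp : ∀ {Z : Ω → ℝ} (K₁ K₂ : ℝ), HasMGFBound μ Z l e → 0 ≤ K₁ → 0 ≤ K₂ →
        ∫⁻ ω, ENNReal.ofReal (K₁ * Real.exp (e / 4 * Z ω) + K₂ * Real.exp (e / 2 * Z ω)) ∂μ ≤
        ENNReal.ofReal (4 * (K₁ + K₂)) := fun {Z} K₁ K₂ hZ h1 h2 => by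
      refine (hZ.lintegral_ofReal_le (K₀ := 0) (K₁ := K₁) (K₂ := K₂) (K₃ := 0)
        (s₁ := e / 4) (s₂ := e / 2) (s₃ := 0) (c₁ := 0) (c₂ := 0) (c₃ := 0)
        le_rfl h1 h2 le_rfl (by rw [abs_of_pos (by positivity)]; linarith)
        (by rw [abs_of_pos (by positivity)]) (by simp; positivity) fun ω => by simp).trans
        (ENNReal.ofReal_le_ofReal ?_)
      have a1 := exp_sub_one_le_of_nonneg (s := e / 2) (by positivity) (by linarith)
      have a2 := exp_sub_one_le_of_nonneg (s := e / 4) (by positivity) (by linarith)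
      have b1 : Real.exp (l * (Real.exp (e / 2) - 1) - e / 2 * 0) ≤ 3 :=
        (Real.exp_le_exp.2 (show _ ≤ (1 : ℝ) by nlinarith)).trans
          (by linarith [Real.exp_one_lt_d9])
      have b2 : Real.exp (l * (Real.exp (e / 4) - 1) - e / 4 * 0) ≤ 3 :=
        (Real.exp_le_exp.2 (show _ ≤ (1 : ℝ) by nlinarith)).trans
          (by linarith [Real.exp_one_lt_d9])
      nlinarith
    have hpt : ∀ ω, ENNReal.ofReal (symbolLoss M τ e l (X ω) (Y ω)) ≤
        ENNReal.ofReal (l * Real.log M) + ENNReal.ofReal (1 / M * max (X ω) (1 / e)) +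
        ENNReal.ofReal (2 * (q / e) * Real.exp (e / 4 * X ω) +
          6 * (q / e) * Real.exp (e / 2 * X ω)) +
        ENNReal.ofReal (0 * Real.exp (e / 4 * Y ω) +
          2 * (q / e) * Real.exp (e / 2 * Y ω)) := fun ω => by
      have h1 : 0 < 1 / M * max (X ω) (1 / e) := mul_pos (by positivity) (hc1 ω)
      rw [← ENNReal.ofReal_add hlM h1.le, ← ENNReal.ofReal_add (by positivity) (by positivity),
        ← ENNReal.ofReal_add (by positivity) (by positivity)]
      refine ENNReal.ofReal_le_ofReal ?_
      have hle : l ≤ 1 / e := by rw [le_div_iff₀ he]; linarith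
      have k1 := klTerm_le_right hl0 (hle.trans (le_max_right (X ω) (1 / e)))
      have k2 := klTerm_le_right hl0 (hle.trans (le_max_right (Y ω) (1 / e)))
      unfold symbolLoss
      split_ifs with hx
      · rw [klTerm_div_eq (hc1 ω) hM0]
        have : max (X ω) (1 / e) / M = 1 / M * max (X ω) (1 / e) := by ring
        have h3 : 0 ≤ 2 * (q / e) * Real.exp (e / 4 * X ω) +
          6 * (q / e) * Real.exp (e / 2 * X ω) := by positivity
        have h4 : 0 ≤ 0 * Real.exp (e / 4 * Y ω) +
          2 * (q / e) * Real.exp (e / 2 * Y ω) := by positivity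
        linarith
      · push Not at hx
        set a := Real.exp (e / 4 * X ω) with ha
        set b := Real.exp (e / 4 * Y ω) with hb
        have ha2 : Real.exp (e / 2 * X ω) = a ^ 2 := by
          rw [ha, sq, ← Real.exp_add]; ring_nf
        have hb2 : Real.exp (e / 2 * Y ω) = b ^ 2 := by
          rw [hb, sq, ← Real.exp_add]; ring_nf
        have ha0 : 0 < a := Real.exp_pos _
        have hb0 : 0 < b := Real.exp_pos _
        -- Exponential Markov inequality: beyond the threshold, 1 is at most exp(-τ/4) exp(e X / 4),
        -- and this factor can multiply the loss.
        have hqa : 1 ≤ q * a := by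
          rw [hq, ha, ← Real.exp_add]
          refine Real.one_le_exp ?_
          rw [div_lt_iff₀ he] at hx
          nlinarith
        have m1 := max_le_exp (e := e) (y := X ω) he (c := 4) (by norm_num)
        have m2 := max_le_exp (e := e) (y := Y ω) he (c := 4) (by norm_num)
        rw [← ha] at m1
        rw [← hb] at m2
        have m3 : max (X ω) (1 / e) + max (Y ω) (1 / e) ≤ 1 / e * (2 + 4 * a + 4 * b) := by
          calc _ ≤ _ := add_le_add m1 m2
            _ = _ := by ring
        have m4 : 1 / e * (2 + 4 * a + 4 * b) ≤ 1 / e * (q * (2 * a + 6 * a ^ 2 + 2 * b ^ 2)) := by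
          gcongr
          calc 2 + 4 * a + 4 * b ≤ q * a * (2 + 4 * a + 4 * b) :=
                le_mul_of_one_le_left (by positivity) hqa
            _ ≤ q * (2 * a + 6 * a ^ 2 + 2 * b ^ 2) := by
                rw [mul_assoc]; gcongr; nlinarith [sq_nonneg (a - b)]
        rw [ha2, hb2]
        have m5 : 1 / e * (q * (2 * a + 6 * a ^ 2 + 2 * b ^ 2)) =
          2 * (q / e) * a + 6 * (q / e) * a ^ 2 + (0 * b + 2 * (q / e) * b ^ 2) := by ring
        have := hc1 ω
        have := hc2 ω
        linarith
    refine (lintegral_mono hpt).trans ?_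
    rw [lintegral_add_left (by fun_prop), lintegral_add_left (by fun_prop),
      lintegral_add_left (by fun_prop), lintegral_const, measure_univ, mul_one]
    refine (add_le_add (add_le_add (add_le_add le_rfl
      (hX.lintegral_max_le he he1 hl0 h (by positivity))) (hexp _ _ hX (by positivity)
      (by positivity))) (hexp _ _ hY le_rfl (by positivity))).trans ?_
    rw [← ENNReal.ofReal_add hlM (by positivity), ← ENNReal.ofReal_add (by positivity)
      (by positivity), ← ENNReal.ofReal_add (by positivity) (by positivity)]
    refine ENNReal.ofReal_le_ofReal ?_
    have hmin : 0 ≤ min l (1 / e) := le_min hl0 hinv.le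
    have hqe : q / e ≤ 3 * (1 / (e * M)) := by
      calc q / e ≤ 3 / M / e := by gcongr
        _ = _ := by field_simp
    have : 1 / M / e = 1 / (e * M) := by rw [div_div, mul_comm]
    rw [this]
    linarith

end HasMGFBound

end

end PrivateKL

/-! ### Decomposition of the error of the two-stage estimate. -/

namespace PrivateKL

noncomputable section

/-- The relative entropy with respect to a two-stage estimate, which distributes an estimate `c` of
the combined mass of `L` proportionally to `b`, splits into the errors of its ingredients. -/
theorem sum_mul_log_le_of_two_stage {ι : Type*} [Fintype ι] [DecidableEq ι] {a b A : ι → ℝ}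
    {L : Finset ι} {c M T : ℝ} (ha : ∀ i, 0 ≤ a i) (hb : ∀ i, 0 < b i) (hT : ∑ i, a i = T)
    (hT0 : 0 < T) (hc : L.Nonempty → 0 < c) (hc0 : L = ∅ → c = 0) (hM : 0 < M)
    (hA : ∀ i, A i = if i ∈ L then 1 / (c + ∑ j ∈ Lᶜ, b j) * c * (b i / ∑ j ∈ L, b j)
      else 1 / (c + ∑ j ∈ Lᶜ, b j) * b i) :
    ∑ i, a i * Real.log (a i / (T * A i)) ≤
      ∑ i, (if i ∈ L then klTerm (a i) (b i / M) else klTerm (a i) (b i)) +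
        if L = ∅ then 0 else klTerm (∑ i ∈ L, a i) c := by
  set N := c + ∑ j ∈ Lᶜ, b j with hN
  set B := ∑ j ∈ L, b j with hB
  have hbc : 0 ≤ ∑ j ∈ Lᶜ, b j := Finset.sum_nonneg fun j _ => (hb j).le
  have hN0 : 0 < N := by
    rcases L.eq_empty_or_nonempty with h | h
    · have : (Finset.univ : Finset ι).Nonempty := by
        by_contra h0
        rw [Finset.not_nonempty_iff_eq_empty] at h0
        rw [h0, Finset.sum_empty] at hT; linarith
      have : 0 < ∑ j ∈ Lᶜ, b j := by
        rw [h, Finset.compl_empty]; exact Finset.sum_pos (fun j _ => hb j) this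
      rw [hN, hc0 h]; linarith
    · have := hc h; linarith
  -- Normalization is free: its logarithm is paid for by the linear terms of `klTerm`.
  have hlogN : T * Real.log (N / T) ≤ N - T := by
    have := Real.log_le_sub_one_of_pos (x := N / T) (by positivity)
    calc T * Real.log (N / T) ≤ T * (N / T - 1) := by gcongr
      _ = N - T := by field_simp
  have hout : ∀ i ∈ Lᶜ, a i * Real.log (a i / (T * A i)) =
      klTerm (a i) (b i) + a i - b i + a i * Real.log (N / T) := fun i hi => by
    rw [hA, if_neg (Finset.mem_compl.1 hi)]
    by_cases h0 : a i = 0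
    · simp [h0, klTerm]
    have hb := hb i
    have : a i / (T * (1 / N * b i)) = a i / b i * (N / T) := by field_simp
    unfold klTerm
    rw [this, Real.log_mul (by positivity) (by positivity)]; ring
  have hsplit : ∀ f : ι → ℝ, ∑ i, f i = ∑ i ∈ L, f i + ∑ i ∈ Lᶜ, f i := fun f =>
    (Finset.sum_add_sum_compl L f).symm
  rw [hsplit, hsplit (fun i => if i ∈ L then _ else _), Finset.sum_congr rfl hout,
    Finset.sum_congr rfl (g := fun i => klTerm (a i) (b i / M)) fun i hi => if_pos hi,
    Finset.sum_congr (s₁ := Lᶜ) rfl (g := fun i => klTerm (a i) (b i))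
      fun i hi => if_neg (Finset.mem_compl.1 hi)]
  rw [hsplit] at hT
  simp only [Finset.sum_add_distrib, Finset.sum_sub_distrib, ← Finset.sum_mul]
  rcases L.eq_empty_or_nonempty with h | h
  · rw [if_pos h]
    have hc0 := hc0 h
    subst h
    simp only [Finset.sum_empty, zero_add] at hT ⊢
    rw [hT]
    linarith
  · rw [if_neg h.ne_empty]
    have hc := hc h
    have hB0 : 0 < B := Finset.sum_pos (fun j _ => hb j) h
    have hin : ∀ i ∈ L, a i * Real.log (a i / (T * A i)) =
        klTerm (a i) (b i / M) + a i - b i / M + a i * Real.log (B / (M * c)) +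
          a i * Real.log (N / T) := fun i hi => by
      rw [hA, if_pos hi]
      by_cases h0 : a i = 0
      · simp [h0, klTerm]
      have hb := hb i
      have : a i / (T * (1 / N * c * (b i / B))) =
          a i / (b i / M) * (B / (M * c)) * (N / T) := by field_simp
      unfold klTerm
      rw [this, Real.log_mul (by positivity) (by positivity),
        Real.log_mul (by positivity) (by positivity)]
      ring
    rw [Finset.sum_congr rfl hin]
    simp only [Finset.sum_add_distrib, Finset.sum_sub_distrib, ← Finset.sum_mul, ← Finset.sum_div]
    rw [← hB]
    set a' := ∑ i ∈ L, a i with ha'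
    have ha0 : 0 ≤ a' := Finset.sum_nonneg fun i _ => ha i
    -- The actual rescaling of the small estimates is c / B. Replacing it by 1 / M leaves ln(B / (M
    -- a')) + ln(a' / c): the first part is paid for by B / M - a', the second belongs to the error
    -- of the combined mass. Hence `M` is arbitrary.
    have hkey : a' - B / M + a' * Real.log (B / (M * c)) + c - a' ≤ klTerm a' c := by
      rcases ha0.eq_or_lt with h0 | h0
      · rw [← h0, klTerm_zero_left]
        have : 0 < B / M := by positivity
        linarith
      · have h1 := Real.log_le_sub_one_of_pos (x := B / (M * a')) (by positivity)
        have h2 : Real.log (B / (M * c)) = Real.log (B / (M * a')) + Real.log (a' / c) := by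
          rw [← Real.log_mul (by positivity) (by positivity)]; congr 1; field_simp
        have h3 : a' * (B / (M * a') - 1) = B / M - a' := by field_simp
        have h4 := mul_le_mul_of_nonneg_left h1 h0.le
        unfold klTerm
        rw [h2]; linarith
    have hTl : a' * Real.log (N / T) + (∑ i ∈ Lᶜ, a i) * Real.log (N / T) =
      T * Real.log (N / T) := by rw [← hT]; ring
    linarith

/-- The error of the estimate of the combined mass of the symbols in `L`. -/
def massLoss {d : ℕ} (e : ℝ) (l : Fin d → ℝ) (L : Finset (Fin d)) (y : ℝ) : ℝ≥0∞ :=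
  if L = ∅ then 0 else ENNReal.ofReal (klTerm (∑ i ∈ L, l i) (max y (1 / e)))

open SamplingTwice in
theorem kl_output_le {d : ℕ} (p : stdSimplex ℝ (Fin d)) {n : ℝ} (hn : 0 < n) (τ : ℝ) {ε M : ℝ}
    (hε : 0 < ε) (hM : 0 < M) (x x' : Fin d → ℕ) (w : Noise d) :
    kl p (output (1 / 2) τ ε x x' w) ≤ ENNReal.ofReal (2 / n) *
      (∑ i, ENNReal.ofReal (symbolLoss M τ (min ε 1) (n / 2 * p i) (noisy₁ x w i) (noisy₂ x' w i)) +
        massLoss (min ε 1) (fun i => n / 2 * p i) (small τ ε x w)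
          ((∑ i ∈ small τ ε x w, (x' i : ℝ)) + w.ζ)) := by
  set e := min ε 1 with he
  have he0 : 0 < 1 / e := by positivity
  set L := small τ ε x w with hL
  set a : Fin d → ℝ := fun i => n / 2 * p i with ha
  have ha0 : ∀ i, 0 ≤ a i := fun i => by have := simplex_nonneg p i; positivity
  have hc1 : ∀ i, 0 < max (noisy₁ x w i) (1 / e) := fun i => lt_max_of_lt_right he0
  have hc2 : ∀ i, 0 < max (noisy₂ x' w i) (1 / e) := fun i => lt_max_of_lt_right he0
  have ht : ∀ i, 0 < trunc (1 / 2) τ ε x x' w i := fun i => by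
    have h1 := hc1 i
    have h2 := hc2 i
    unfold trunc
    rw [← he]
    split_ifs
    · exact h1
    · have : (0 : ℝ) < 1 - 1 / 2 := by norm_num
      positivity
  have hmass : L.Nonempty → mass τ ε x x' w = max ((∑ i ∈ L, (x' i : ℝ)) + w.ζ) (1 / e) := fun h => by
    unfold mass; rw [← hL, if_neg h.ne_empty]
  have hT : ∑ i, a i = n / 2 := by
    rw [ha, ← Finset.mul_sum, simplex_sum, mul_one]
  have hA : ∀ i, output (1 / 2) τ ε x x' w i = _ := fun i => rfl
  have key := sum_mul_log_le_of_two_stage (M := M) (c := mass τ ε x x' w) ha0 ht hT (by positivity)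
    (L := L) (fun h => by rw [hmass h]; exact lt_max_of_lt_right he0)
    (fun h => by unfold mass; rw [if_pos h]) hM hA
  have hsym : ∀ i, (if i ∈ L then klTerm (a i) (trunc (1 / 2) τ ε x x' w i / M)
      else klTerm (a i) (trunc (1 / 2) τ ε x x' w i)) ≤
      symbolLoss M τ e (a i) (noisy₁ x w i) (noisy₂ x' w i) := fun i => by
    have hiff : i ∈ L ↔ noisy₁ x w i ≤ τ / e := by rw [hL, he]; simp [small]
    unfold symbolLoss trunc
    rw [← hL, ← he]
    by_cases h : i ∈ L
    · rw [if_pos h, if_pos h, if_pos (hiff.1 h)]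
    · rw [if_neg h, if_neg h, if_neg fun h' => h (hiff.2 h')]
      have := klTerm_half_add_le (ha0 i) (hc1 i) (hc2 i)
      rw [add_div] at this
      convert this using 2
      ring
  have hnn : ∀ i, 0 ≤ symbolLoss M τ e (a i) (noisy₁ x w i) (noisy₂ x' w i) := fun i => by
    refine le_trans ?_ (hsym i)
    split_ifs
    · exact klTerm_nonneg (ha0 i) (div_pos (ht i) hM)
    · exact klTerm_nonneg (ha0 i) (ht i)
  have hml : (0 : ℝ) ≤ if L = ∅ then 0 else klTerm (∑ i ∈ L, a i) (mass τ ε x x' w) := by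
    split_ifs with h
    · exact le_rfl
    · rw [hmass (Finset.nonempty_iff_ne_empty.2 h)]
      exact klTerm_nonneg (Finset.sum_nonneg fun i _ => ha0 i) (lt_max_of_lt_right he0)
  have hml' : massLoss e a L ((∑ i ∈ L, (x' i : ℝ)) + w.ζ) =
      ENNReal.ofReal (if L = ∅ then 0 else klTerm (∑ i ∈ L, a i) (mass τ ε x x' w)) := by
    unfold massLoss
    split_ifs with h
    · simp
    · rw [hmass (Finset.nonempty_iff_ne_empty.2 h)]
  have hApos : ∀ i, output (1 / 2) τ ε x x' w i ≠ 0 := fun i => by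
    have hB : i ∈ L → 0 < ∑ j ∈ L, trunc (1 / 2) τ ε x x' w j := fun h =>
      Finset.sum_pos (fun j _ => ht j) ⟨i, h⟩
    have hcpl : 0 ≤ ∑ j ∈ Lᶜ, trunc (1 / 2) τ ε x x' w j :=
      Finset.sum_nonneg fun j _ => (ht j).le
    have hti := ht i
    by_cases h : i ∈ L
    · have hmp : 0 < mass τ ε x x' w := by rw [hmass ⟨i, h⟩]; exact lt_max_of_lt_right he0
      have hN : 0 < total (1 / 2) τ ε x x' w := by unfold total; rw [← hL]; linarith
      have := hB h
      rw [output, if_pos h]; positivity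
    · have hm0 : 0 ≤ mass τ ε x x' w := by
        unfold mass; rw [← hL, ← he]; split_ifs
        · exact le_rfl
        · exact (lt_max_of_lt_right he0).le
      have hN : 0 < total (1 / 2) τ ε x x' w := by
        unfold total; rw [← hL]
        have := Finset.single_le_sum (f := trunc (1 / 2) τ ε x x' w) (fun j _ => (ht j).le)
          (Finset.mem_compl.2 h)
        linarith
      rw [output, if_neg h]; positivity
  rw [kl, if_neg (by push Not; exact fun i _ => hApos i), hml',
    ← ENNReal.ofReal_sum_of_nonneg fun i _ => hnn i,
    ← ENNReal.ofReal_add (Finset.sum_nonneg fun i _ => hnn i) hml,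
    ← ENNReal.ofReal_mul (by positivity)]
  refine ENNReal.ofReal_le_ofReal ?_
  -- Passes from frequencies to expected counts, whose total in each half of the sample is n / 2.
  have e1 : ∑ i, p i * Real.log (p i / output (1 / 2) τ ε x x' w i) =
      2 / n * ∑ i, a i * Real.log (a i / (n / 2 * output (1 / 2) τ ε x x' w i)) := by
    rw [Finset.mul_sum]
    refine Finset.sum_congr rfl fun i _ => ?_
    rw [ha]
    simp only
    rw [mul_div_mul_left _ _ (by positivity)]
    field_simp
  rw [e1]
  gcongr
  exact key.trans (by gcongr with i; exact hsym i)

end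

end PrivateKL

/-! ### Joint laws of the samples and the noise. -/

namespace PrivateKL

noncomputable section

/-- The joint law of the first histogram and the noise added to it. -/
def firstLaw {d : ℕ} (ε m : ℝ) (p : stdSimplex ℝ (Fin d)) : Measure ((Fin d → ℕ) × (Fin d → ℝ)) :=
  (poissonHistogram m p).prod (Measure.pi fun _ : Fin d => laplaceMeasure (1 / ε))

/-- The joint law of the second histogram, the noise of the combined mass, and the noise added to
the histogram. -/
def secondLaw {d : ℕ} (ε m : ℝ) (p : stdSimplex ℝ (Fin d)) :
    Measure ((Fin d → ℕ) × ℝ × (Fin d → ℝ)) :=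
  (poissonHistogram m p).prod
    ((laplaceMeasure (1 / ε)).prod (Measure.pi fun _ : Fin d => laplaceMeasure (1 / ε)))

section Laws

variable {d : ℕ} {ε m : ℝ} {p : stdSimplex ℝ (Fin d)}

theorem isProbabilityMeasure_firstLaw (hε : 0 < ε) : IsProbabilityMeasure (firstLaw ε m p) := by
  have := isProbabilityMeasure_laplaceMeasure (b := 1 / ε) (by positivity)
  unfold firstLaw; infer_instance

theorem isProbabilityMeasure_secondLaw (hε : 0 < ε) : IsProbabilityMeasure (secondLaw ε m p) := by
  have := isProbabilityMeasure_laplaceMeasure (b := 1 / ε) (by positivity)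
  unfold secondLaw; infer_instance

theorem lintegral_exp_sum_poissonHistogram (hm : 0 ≤ m) (L : Finset (Fin d)) (s : ℝ) :
    ∫⁻ x, ENNReal.ofReal (Real.exp (s * ∑ i ∈ L, (x i : ℝ))) ∂poissonHistogram m p =
      ENNReal.ofReal (Real.exp ((∑ i ∈ L, m * p i) * (Real.exp s - 1))) := by
  have h1 : ∀ x : Fin d → ℕ, ENNReal.ofReal (Real.exp (s * ∑ i ∈ L, (x i : ℝ))) =
      ∏ i ∈ L, ENNReal.ofReal (Real.exp (s * (x i : ℝ))) := fun x => by
    rw [Finset.mul_sum, Real.exp_sum, ENNReal.ofReal_prod_of_nonneg fun i _ => (Real.exp_pos _).le]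
  simp only [h1]
  rw [poissonHistogram, lintegral_pi_prod _ L
    (fun _ (k : ℕ) => ENNReal.ofReal (Real.exp (s * k))) fun i => .of_discrete,
    Finset.sum_mul, Real.exp_sum, ENNReal.ofReal_prod_of_nonneg fun i _ => (Real.exp_pos _).le]
  refine Finset.prod_congr rfl fun i _ => ?_
  rw [lintegral_poisson_exp, Real.coe_toNNReal _ (mul_nonneg hm (simplex_nonneg p i))]

/-- The constant is 1 / (1 - u²) at |u| = 1/2, where u = s / ε. -/
theorem lintegral_exp_laplace_le (hε : 0 < ε) {s : ℝ} (hs : |s| ≤ min ε 1 / 2) :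
    ∫⁻ z, ENNReal.ofReal (Real.exp (s * z)) ∂laplaceMeasure (1 / ε) ≤
      ENNReal.ofReal (4 / 3) := by
  have h1 : |s * (1 / ε)| ≤ 1 / 2 := by
    rw [abs_mul, abs_of_pos (by positivity : 0 < 1 / ε), mul_one_div, div_le_iff₀ hε]
    have := min_le_left ε 1
    linarith
  obtain ⟨h2, h3⟩ := abs_le.1 h1
  rw [lintegral_laplace_exp (by positivity) (by linarith) (by linarith)]
  refine ENNReal.ofReal_le_ofReal ?_
  rw [div_le_div_iff₀ (by nlinarith) (by norm_num)]
  nlinarith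

theorem HasMGFBound.comp {Ω Ω' : Type*} [MeasurableSpace Ω] [MeasurableSpace Ω'] {μ : Measure Ω}
    {ν : Measure Ω'} {Y : Ω → ℝ} {l e : ℝ} (hY : HasMGFBound μ Y l e) {T : Ω' → Ω}
    (hT : MeasurePreserving T ν μ) : HasMGFBound ν (fun ω => Y (T ω)) l e where
  measurable := hY.measurable.comp hT.measurable
  bound s hs := by
    have hm := hY.measurable
    rw [hT.lintegral_comp (f := fun ω => ENNReal.ofReal (Real.exp (s * Y ω))) (by fun_prop)]
    exact hY.bound s hs

/-- A partial sum of independent Poisson counts is Poisson, and independent noise multiplies the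
exponential moments. The sums needed are single counts and the combined mass. -/
theorem hasMGFBound_add {Ω : Type*} [MeasurableSpace Ω] {ν : Measure Ω} [IsProbabilityMeasure ν]
    (hm : 0 ≤ m) (L : Finset (Fin d)) {g : Ω → ℝ} (hgm : Measurable g) {e : ℝ}
    (hg : ∀ s, |s| ≤ e / 2 → ∫⁻ ω, ENNReal.ofReal (Real.exp (s * g ω)) ∂ν ≤ ENNReal.ofReal (4 / 3)) :
    HasMGFBound ((poissonHistogram m p).prod ν) (fun w => (∑ i ∈ L, (w.1 i : ℝ)) + g w.2)
      (∑ i ∈ L, m * p i) e where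
  measurable := by
    have : Measurable fun x : Fin d → ℕ => ∑ i ∈ L, (x i : ℝ) := .of_discrete
    exact (this.comp measurable_fst).add (hgm.comp measurable_snd)
  bound s hs := by
    have h1 : ∀ w : (Fin d → ℕ) × Ω, ENNReal.ofReal (Real.exp (s * ((∑ i ∈ L, (w.1 i : ℝ)) + g w.2))) =
        ENNReal.ofReal (Real.exp (s * ∑ i ∈ L, (w.1 i : ℝ))) *
          ENNReal.ofReal (Real.exp (s * g w.2)) := fun w => by
      rw [← ENNReal.ofReal_mul (Real.exp_pos _).le, ← Real.exp_add, mul_add]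
    simp only [h1]
    rw [lintegral_prod_mul (f := fun x : Fin d → ℕ => ENNReal.ofReal (Real.exp (s * ∑ i ∈ L, (x i : ℝ))))
      (g := fun w => ENNReal.ofReal (Real.exp (s * g w)))
      Measurable.of_discrete.aemeasurable (by fun_prop),
      lintegral_exp_sum_poissonHistogram hm, mul_comm (4 / 3 : ℝ),
      ENNReal.ofReal_mul (Real.exp_pos _).le]
    gcongr
    exact hg s hs

theorem hasMGFBound_first (hε : 0 < ε) (hm : 0 ≤ m) (i : Fin d) :
    HasMGFBound (firstLaw ε m p) (fun w => (w.1 i : ℝ) + w.2 i) (m * p i) (min ε 1) := by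
  have := isProbabilityMeasure_laplaceMeasure (b := 1 / ε) (by positivity)
  have h := hasMGFBound_add (p := p) hm {i}
    (ν := Measure.pi fun _ : Fin d => laplaceMeasure (1 / ε)) (g := fun z => z i) (by fun_prop)
    (e := min ε 1) fun s hs => by
      rw [lintegral_pi_eval (fun _ : Fin d => laplaceMeasure (1 / ε)) i
        (f := fun z => ENNReal.ofReal (Real.exp (s * z))) (by fun_prop)]
      exact lintegral_exp_laplace_le hε hs
  simp only [Finset.sum_singleton] at h
  exact h

theorem hasMGFBound_second (hε : 0 < ε) (hm : 0 ≤ m) (i : Fin d) :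
    HasMGFBound (secondLaw ε m p) (fun w => (w.1 i : ℝ) + w.2.2 i) (m * p i) (min ε 1) := by
  have := isProbabilityMeasure_laplaceMeasure (b := 1 / ε) (by positivity)
  have h := hasMGFBound_add (p := p) hm {i}
    (ν := (laplaceMeasure (1 / ε)).prod (Measure.pi fun _ : Fin d => laplaceMeasure (1 / ε)))
    (g := fun w => w.2 i) (by fun_prop) (e := min ε 1) fun s hs => by
      rw [(measurePreserving_snd (μ := laplaceMeasure (1 / ε))
        (ν := Measure.pi fun _ : Fin d => laplaceMeasure (1 / ε))).lintegral_comp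
        (f := fun z => ENNReal.ofReal (Real.exp (s * z i))) (by fun_prop),
        lintegral_pi_eval (fun _ : Fin d => laplaceMeasure (1 / ε)) i
        (f := fun z => ENNReal.ofReal (Real.exp (s * z))) (by fun_prop)]
      exact lintegral_exp_laplace_le hε hs
  simp only [Finset.sum_singleton] at h
  exact h

theorem hasMGFBound_mass (hε : 0 < ε) (hm : 0 ≤ m) (L : Finset (Fin d)) :
    HasMGFBound (secondLaw ε m p) (fun w => (∑ i ∈ L, (w.1 i : ℝ)) + w.2.1) (∑ i ∈ L, m * p i)
      (min ε 1) := by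
  have := isProbabilityMeasure_laplaceMeasure (b := 1 / ε) (by positivity)
  exact hasMGFBound_add (p := p) hm L
    (ν := (laplaceMeasure (1 / ε)).prod (Measure.pi fun _ : Fin d => laplaceMeasure (1 / ε)))
    (g := fun w => w.1) (by fun_prop) (e := min ε 1) fun s hs => by
      rw [(measurePreserving_fst (μ := laplaceMeasure (1 / ε))
        (ν := Measure.pi fun _ : Fin d => laplaceMeasure (1 / ε))).lintegral_comp
        (f := fun z => ENNReal.ofReal (Real.exp (s * z))) (by fun_prop)]
      exact lintegral_exp_laplace_le hε hs

end Laws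

open SamplingTwice in
/-- A measurable pointwise bound of the error of the algorithm bounds its expected error. -/
theorem samplingTwiceKL_le {d n : ℕ} {α τ ε : ℝ} (hε : 0 < ε) (p : stdSimplex ℝ (Fin d))
    {G : ((Fin d → ℕ) × (Fin d → ℝ)) × ((Fin d → ℕ) × ℝ × (Fin d → ℝ)) → ℝ≥0∞} (hG : Measurable G)
    (h : ∀ x z x' ζ z', kl p (output α τ ε x x' ⟨z, ζ, z'⟩) ≤ G ((x, z), (x', ζ, z'))) :
    samplingTwiceKL α τ ε n p ≤
      ∫⁻ w, G w ∂(firstLaw ε (α * n) p).prod (secondLaw ε ((1 - α) * n) p) := by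
  have := isProbabilityMeasure_laplaceMeasure (b := 1 / ε) (by positivity)
  have := isProbabilityMeasure_secondLaw (m := (1 - α) * n) (p := p) hε
  set Z := Measure.pi fun _ : Fin d => laplaceMeasure (1 / ε) with hZ
  have hmeas : ∀ x x', Measurable fun w : (Fin d → ℝ) × ℝ × (Fin d → ℝ) => G ((x, w.1), (x', w.2)) :=
    fun x x' => by fun_prop
  have h1 : ∀ s : (Fin d → ℕ) × (Fin d → ℕ), ∫⁻ a, kl p a ∂(samplingTwice α τ ε s) ≤
      ∫⁻ z, ∫⁻ w, G ((s.1, z), (s.2, w)) ∂((laplaceMeasure (1 / ε)).prod Z) ∂Z := fun s => by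
    -- The inequality for pushforwards needs no measurability of the relative entropy; only the
    -- majorant `G` has to be measurable.
    refine (lintegral_map_le _ _).trans ?_
    rw [← lintegral_prod (fun w : (Fin d → ℝ) × ℝ × (Fin d → ℝ) => G ((s.1, w.1), (s.2, w.2)))
      (hmeas s.1 s.2).aemeasurable]
    exact lintegral_mono fun w => h _ _ _ _ _
  unfold samplingTwiceKL
  refine (lintegral_mono h1).trans ?_
  rw [lintegral_prod _ Measurable.of_discrete.aemeasurable, lintegral_prod _ hG.aemeasurable,
    firstLaw, lintegral_prod _ hG.lintegral_prod_right'.aemeasurable]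
  refine le_of_eq (lintegral_congr fun x => ?_)
  -- Regroups the variables as (x, z) and (x', ζ, z'), so that L is a function of the first group,
  -- independent of the second.
  rw [lintegral_lintegral_swap]
  · refine lintegral_congr fun z => ?_
    have h3 : Measurable fun w : (Fin d → ℕ) × ℝ × (Fin d → ℝ) => G ((x, z), w) := by fun_prop
    rw [secondLaw, lintegral_prod _ h3.aemeasurable]
  · have h2 : Measurable fun q : ((Fin d → ℕ) × (Fin d → ℝ)) × (ℝ × (Fin d → ℝ)) =>
        G ((x, q.1.2), (q.1.1, q.2)) := by fun_prop
    exact (h2.lintegral_prod_right' (ν := (laplaceMeasure (1 / ε)).prod Z)).aemeasurable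

end

end PrivateKL

/-! ### Upper bounds on the expected error of the algorithm. -/

namespace PrivateKL

noncomputable section

/-- The expectation of a quantity that depends on the first sample only through a random finite
set. -/
theorem lintegral_prod_finset_le {ι Ω₁ Ω₂ : Type*} [Fintype ι] [DecidableEq ι]
    [MeasurableSpace Ω₁] [MeasurableSpace Ω₂]
    {μ₁ : Measure Ω₁} {μ₂ : Measure Ω₂} [SFinite μ₂] {L : Ω₁ → Finset ι}
    (hL : ∀ i, MeasurableSet {a | i ∈ L a}) {g : Finset ι → Ω₂ → ℝ≥0∞}
    (hg : ∀ s, Measurable (g s)) :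
    Measurable (fun w : Ω₁ × Ω₂ => g (L w.1) w.2) ∧
      ∫⁻ w, g (L w.1) w.2 ∂(μ₁.prod μ₂) = ∫⁻ a, ∫⁻ b, g (L a) b ∂μ₂ ∂μ₁ := by
  have hs : ∀ s, MeasurableSet {a | L a = s} := fun s => by
    have : {a | L a = s} = ⋂ i, {a | i ∈ L a ↔ i ∈ s} := by
      ext a; simp [Finset.ext_iff]
    rw [this]
    refine MeasurableSet.iInter fun i => ?_
    by_cases h : i ∈ s
    · simpa [h] using hL i
    · have : {a | i ∈ L a ↔ i ∈ s} = {a | i ∈ L a}ᶜ := by ext a; simp [h]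
      rw [this]; exact (hL i).compl
  have hm : Measurable fun w : Ω₁ × Ω₂ => g (L w.1) w.2 := by
    have : (fun w : Ω₁ × Ω₂ => g (L w.1) w.2) =
        fun w => ∑ s : Finset ι, if L w.1 = s then g s w.2 else 0 := by
      funext w; rw [Finset.sum_ite_eq, if_pos (Finset.mem_univ _)]
    rw [this]
    exact Finset.measurable_sum _ fun s _ => Measurable.ite (measurable_fst (hs s))
      ((hg s).comp measurable_snd) measurable_const
  exact ⟨hm, lintegral_prod _ hm.aemeasurable⟩

theorem measurable_symbolLoss (M τ e l : ℝ) :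
    Measurable fun q : ℝ × ℝ => symbolLoss M τ e l q.1 q.2 := by
  unfold symbolLoss klTerm
  exact Measurable.ite (measurableSet_le (by fun_prop) (by fun_prop)) (by fun_prop) (by fun_prop)

theorem measurable_massLoss {d : ℕ} (e : ℝ) (l : Fin d → ℝ) (L : Finset (Fin d)) :
    Measurable (massLoss e l L) := by
  unfold massLoss klTerm
  split_ifs <;> fun_prop

/-- The upper bound on the expected error of the algorithm; `S` is the set of the symbols of small
mass. -/
theorem samplingTwiceKL_le_sum {d n : ℕ} (hn : 1 ≤ n) {ε τ M : ℝ} (hε : 0 < ε)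
    (p : stdSimplex ℝ (Fin d)) (S : Finset (Fin d))
    (hS : ∀ i ∉ S, 3 * τ ≤ min ε 1 * (n / 2 * p i)) (hτ : 1 ≤ τ) (hM1 : 1 ≤ M)
    (hM : Real.log M ≤ 1 + τ / 4) :
    samplingTwiceKL (1 / 2) τ ε n p ≤ ENNReal.ofReal (2 / n *
      (∑ i ∈ Sᶜ, 106200 * (1 + 1 / (min ε 1 ^ 2 * (n / 2 * p i))) +
        ∑ i ∈ S, (n / 2 * p i * Real.log M +
          16800 * (min (n / 2 * p i) (1 / min ε 1) + 1 / (min ε 1 * M))) +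
        if S = ∅ then 0 else 8400 / min ε 1)) := by
  have hn0 : (0 : ℝ) < n := by exact_mod_cast hn
  set e := min ε 1 with he
  have he0 : 0 < e := by positivity
  have he1 : e ≤ 1 := min_le_right _ _
  set l : Fin d → ℝ := fun i => n / 2 * p i with hl
  have hl0 : ∀ i, 0 ≤ l i := fun i => by have := simplex_nonneg p i; positivity
  have hm1 : (1 : ℝ) / 2 * n = n / 2 := by ring
  have hm2 : (1 - (1 : ℝ) / 2) * n = n / 2 := by ring
  set μ₁ := firstLaw ε (n / 2) p with hμ₁
  set μ₂ := secondLaw ε (n / 2) p with hμ₂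
  have : IsProbabilityMeasure μ₁ := isProbabilityMeasure_firstLaw hε
  have : IsProbabilityMeasure μ₂ := isProbabilityMeasure_secondLaw hε
  let X : Fin d → (Fin d → ℕ) × (Fin d → ℝ) → ℝ := fun i w => (w.1 i : ℝ) + w.2 i
  let X' : Fin d → (Fin d → ℕ) × ℝ × (Fin d → ℝ) → ℝ := fun i w => (w.1 i : ℝ) + w.2.2 i
  let L : (Fin d → ℕ) × (Fin d → ℝ) → Finset (Fin d) := fun w =>
    Finset.univ.filter fun i => X i w ≤ τ / e
  let g : Finset (Fin d) → (Fin d → ℕ) × ℝ × (Fin d → ℝ) → ℝ≥0∞ := fun s w =>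
    massLoss e l s ((∑ i ∈ s, (w.1 i : ℝ)) + w.2.1)
  have hX : ∀ i, HasMGFBound μ₁ (X i) (l i) e := fun i => hasMGFBound_first hε (by positivity) i
  have hX' : ∀ i, HasMGFBound μ₂ (X' i) (l i) e := fun i => hasMGFBound_second hε (by positivity) i
  have hXQ : ∀ i, HasMGFBound (μ₁.prod μ₂) (fun w => X i w.1) (l i) e := fun i =>
    (hX i).comp measurePreserving_fst
  have hXQ' : ∀ i, HasMGFBound (μ₁.prod μ₂) (fun w => X' i w.2) (l i) e := fun i =>
    (hX' i).comp measurePreserving_snd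
  have hmass : ∀ s, HasMGFBound μ₂ (fun w => (∑ i ∈ s, (w.1 i : ℝ)) + w.2.1) (∑ i ∈ s, l i) e :=
    fun s => hasMGFBound_mass hε (by positivity) s
  have hLm : ∀ i, MeasurableSet {a | i ∈ L a} := fun i => by
    have : {a | i ∈ L a} = {a | X i a ≤ τ / e} := by ext a; simp [L]
    rw [this]
    exact measurableSet_le (hX i).measurable measurable_const
  have hgm : ∀ s, Measurable (g s) := fun s =>
    (measurable_massLoss e l s).comp (hmass s).measurable
  obtain ⟨hm, hint⟩ := lintegral_prod_finset_le (μ₁ := μ₁) (μ₂ := μ₂) hLm hgm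
  have hsm : ∀ i, Measurable fun w : ((Fin d → ℕ) × (Fin d → ℝ)) × (Fin d → ℕ) × ℝ × (Fin d → ℝ) =>
      ENNReal.ofReal (symbolLoss M τ e (l i) (X i w.1) (X' i w.2)) := fun i =>
    ((measurable_symbolLoss M τ e (l i)).comp
      ((hXQ i).measurable.prodMk (hXQ' i).measurable)).ennreal_ofReal
  have hsum := Finset.measurable_sum Finset.univ fun i _ => hsm i
  have hall : Measurable fun w : ((Fin d → ℕ) × (Fin d → ℝ)) × (Fin d → ℕ) × ℝ × (Fin d → ℝ) =>
      ∑ i, ENNReal.ofReal (symbolLoss M τ e (l i) (X i w.1) (X' i w.2)) + g (L w.1) w.2 :=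
    hsum.add hm
  refine (samplingTwiceKL_le hε p (G := fun w => ENNReal.ofReal (2 / n) *
    (∑ i, ENNReal.ofReal (symbolLoss M τ e (l i) (X i w.1) (X' i w.2)) + g (L w.1) w.2))
    (hall.const_mul _) fun x z x' ζ z' =>
      kl_output_le p hn0 τ hε (by linarith) x x' ⟨z, ζ, z'⟩).trans ?_
  rw [hm1, hm2, lintegral_const_mul _ hall, lintegral_add_left hsum,
    lintegral_finsetSum _ fun i _ => hsm i, ENNReal.ofReal_mul (by positivity)]
  refine mul_le_mul_right ?_ _
  have hlarge : ∀ i ∉ S, 1 ≤ e * l i ∧ 0 < l i := fun i hi => by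
    have h0 : 3 * τ ≤ e * l i := hS i hi
    have h1 : 1 ≤ e * l i := by linarith
    exact ⟨h1, by by_contra h; push Not at h; nlinarith⟩
  have hmassle : ∫⁻ w, g (L w.1) w.2 ∂(μ₁.prod μ₂) ≤
      ENNReal.ofReal ((if S = ∅ then 0 else 8400 / e) +
        ∑ i ∈ Sᶜ, 89600 * (1 + 1 / (e ^ 2 * l i))) := by
    rw [hint]
    -- For a fixed first sample, L is a fixed set and its combined mass has error O(1/e). If there
    -- is no light symbol, this is charged only when some heavy symbol is declared small.
    have h1 : ∀ a, ∫⁻ b, g (L a) b ∂μ₂ ≤ ENNReal.ofReal (if S = ∅ then 0 else 8400 / e) +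
        ∑ i ∈ Sᶜ, ENNReal.ofReal (if X i a ≤ τ / e then 8400 / e else 0) := fun a => by
      rcases (L a).eq_empty_or_nonempty with h | h
      · simp [g, massLoss, h]
      have h2 : ∫⁻ b, g (L a) b ∂μ₂ ≤ ENNReal.ofReal (8400 / e) := by
        simp only [g, massLoss, if_neg h.ne_empty]
        exact (hmass (L a)).lintegral_klTerm_le he0 he1 (Finset.sum_nonneg fun i _ => hl0 i)
      refine h2.trans ?_
      by_cases hSe : S = ∅
      · obtain ⟨i, hi⟩ := h
        have hi' : X i a ≤ τ / e := by simpa [L] using hi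
        refine le_trans ?_ le_add_self
        refine le_trans ?_ (Finset.single_le_sum (f := fun i => ENNReal.ofReal
          (if X i a ≤ τ / e then 8400 / e else 0)) (fun _ _ => zero_le)
          (show i ∈ Sᶜ by rw [hSe]; simp))
        simp only [if_pos hi']; exact le_rfl
      · rw [if_neg hSe]; exact le_self_add
    refine (lintegral_mono h1).trans ?_
    rw [lintegral_add_left measurable_const, lintegral_const, measure_univ, mul_one,
      lintegral_finsetSum', ENNReal.ofReal_add (by split_ifs <;> positivity)
        (Finset.sum_nonneg fun i _ => by have := hl0 i; positivity),
      ENNReal.ofReal_sum_of_nonneg fun i _ => by have := hl0 i; positivity]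
    · gcongr with i hi
      obtain ⟨h1, h2⟩ := hlarge i (Finset.mem_compl.1 hi)
      refine ((hX i).lintegral_indicator_le he0 he1 h2 (hS i (Finset.mem_compl.1 hi))
        (by positivity)).trans (ENNReal.ofReal_le_ofReal ?_)
      have h3 := mul_exp_neg_le (u := e * l i)
      have h4 : 8400 / e * (4 / 3 * Real.exp (-(e * l i / 8))) ≤ 89600 * (1 / (e ^ 2 * l i)) := by
        rw [mul_one_div, le_div_iff₀ (by positivity)]
        calc _ = 11200 * (e * l i * Real.exp (-(e * l i / 8))) := by field_simp; norm_num
          _ ≤ 11200 * 8 := by gcongr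
          _ = 89600 := by norm_num
      linarith
    · intro i _
      exact (Measurable.ite (measurableSet_le (hX i).measurable measurable_const)
        measurable_const measurable_const).ennreal_ofReal.aemeasurable
  refine (add_le_add (Finset.sum_le_sum (g := fun i => ENNReal.ofReal
    (if i ∈ S then l i * Real.log M + 16800 * (min (l i) (1 / e) + 1 / (e * M))
      else 16600 * (1 + 1 / (e ^ 2 * l i)))) fun i _ => ?_) hmassle).trans ?_
  · split_ifs with hi
    · exact (hXQ i).lintegral_symbolLoss_le_of_small (hXQ' i) he0 he1 hM1 hM (hl0 i)
    · exact (hXQ i).lintegral_symbolLoss_le_of_large (hXQ' i) he0 he1 hτ hM1 hM (hS i hi)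
  · have hnn : ∀ i, 0 ≤ if i ∈ S then l i * Real.log M + 16800 * (min (l i) (1 / e) + 1 / (e * M))
        else 16600 * (1 + 1 / (e ^ 2 * l i)) := fun i => by
      have := hl0 i
      have := Real.log_nonneg hM1
      have h3 : 0 ≤ min (l i) (1 / e) := le_min (hl0 i) (by positivity)
      split_ifs <;> positivity
    rw [← ENNReal.ofReal_sum_of_nonneg fun i _ => hnn i, ← ENNReal.ofReal_add
      (Finset.sum_nonneg fun i _ => hnn i) (add_nonneg (by split_ifs <;> positivity)
      (Finset.sum_nonneg fun i _ => by have := hl0 i; positivity))]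
    refine ENNReal.ofReal_le_ofReal (le_of_eq ?_)
    rw [← Finset.sum_add_sum_compl S, Finset.sum_congr (s₁ := S) rfl fun i hi => if_pos hi,
      Finset.sum_congr (s₁ := Sᶜ) rfl fun i hi => if_neg (Finset.mem_compl.1 hi)]
    simp only [← Finset.mul_sum]
    ring

open SamplingTwice in
/-- The pointwise error of the algorithm is at most logarithmic in the noisy counts. -/
theorem kl_output_le_log {d : ℕ} (hd : 1 ≤ d) (p : stdSimplex ℝ (Fin d)) (τ : ℝ) {ε : ℝ} (hε : 0 < ε)
    (x x' : Fin d → ℕ) {w : Noise d} :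
    kl p (output (1 / 2) τ ε x x' w) ≤ ENNReal.ofReal (2 * Real.log d + min ε 1 / d *
      (max ((∑ i, (x' i : ℝ)) + w.ζ) (1 / min ε 1) +
        ∑ i, (2 * max (noisy₁ x w i) (1 / min ε 1) + max (noisy₂ x' w i) (1 / min ε 1)))) := by
  have hd0 : (0 : ℝ) < d := by exact_mod_cast hd
  set e := min ε 1 with he
  have hep : 0 < e := by positivity
  have he0 : 0 < 1 / e := by positivity
  set L := small τ ε x w with hL
  set c₁ : Fin d → ℝ := fun i => max (noisy₁ x w i) (1 / e) with hc₁
  set c₂ : Fin d → ℝ := fun i => max (noisy₂ x' w i) (1 / e) with hc₂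
  have hc1 : ∀ i, 1 / e ≤ c₁ i := fun i => le_max_right _ _
  have hc2 : ∀ i, 1 / e ≤ c₂ i := fun i => le_max_right _ _
  set y := max ((∑ i, (x' i : ℝ)) + w.ζ) (1 / e) with hy
  have hy0 : 1 / e ≤ y := le_max_right _ _
  set b := trunc (1 / 2) τ ε x x' w with hb
  have hbL : ∀ i ∈ L, b i = c₁ i := fun i hi => by rw [hb, trunc, if_pos hi]
  have hbL' : ∀ i ∉ L, b i = (c₁ i + c₂ i) / 2 := fun i hi => by
    rw [hb, trunc, if_neg hi, ← he]; ring
  have hb1 : ∀ i, 1 / e ≤ b i := fun i => by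
    by_cases h : i ∈ L
    · rw [hbL i h]; exact hc1 i
    · rw [hbL' i h]; linarith [hc1 i, hc2 i]
  have hmy : 0 ≤ mass τ ε x x' w ∧ mass τ ε x x' w ≤ y := by
    unfold mass
    rw [← hL, ← he]
    split_ifs with h
    · exact ⟨le_rfl, he0.le.trans hy0⟩
    · refine ⟨he0.le.trans (le_max_right _ _), max_le_max ?_ le_rfl⟩
      have := Finset.sum_le_univ_sum_of_nonneg (s := L) (f := fun i => (x' i : ℝ))
        fun i => by positivity
      linarith
  set N := total (1 / 2) τ ε x x' w with hN
  set N' := y + ∑ i, (c₁ i + c₂ i) with hN'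
  set B' := ∑ i, c₁ i with hB'
  have hNN : N ≤ N' := by
    rw [hN, total, ← hL, hN', ← hb]
    refine add_le_add hmy.2 ?_
    calc ∑ i ∈ Lᶜ, b i ≤ ∑ i ∈ Lᶜ, (c₁ i + c₂ i) := by
          gcongr with i hi
          rw [hbL' i (Finset.mem_compl.1 hi)]; linarith [hc1 i, hc2 i]
      _ ≤ ∑ i, (c₁ i + c₂ i) := Finset.sum_le_univ_sum_of_nonneg fun i => by
          linarith [hc1 i, hc2 i]
  have hsingle : ∀ (s : Finset (Fin d)) i, i ∈ s → 1 / e ≤ ∑ j ∈ s, b j := fun s i hi =>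
    (hb1 i).trans (Finset.single_le_sum (f := b) (fun j _ => he0.le.trans (hb1 j)) hi)
  have i₀ : Fin d := ⟨0, hd⟩
  have hB1 : 1 / e ≤ B' := (hc1 i₀).trans
    (Finset.single_le_sum (f := c₁) (fun j _ => he0.le.trans (hc1 j)) (Finset.mem_univ i₀))
  have hN1 : ∀ i, 1 / e ≤ N := fun i => by
    rw [hN, total, ← hL, ← hb]
    have hs : 0 ≤ ∑ j ∈ Lᶜ, b j := Finset.sum_nonneg fun j _ => he0.le.trans (hb1 j)
    by_cases h : i ∈ L
    · have : 1 / e ≤ mass τ ε x x' w := by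
        unfold mass; rw [← hL, ← he, if_neg (Finset.ne_empty_of_mem h)]; exact le_max_right _ _
      linarith
    · have := hsingle Lᶜ i (Finset.mem_compl.2 h)
      linarith [hmy.1]
  have hN0 : 0 < N := he0.trans_le (hN1 i₀)
  have hN'0 : 0 < N' := hN0.trans_le hNN
  have hB'0 : 0 < B' := he0.trans_le hB1
  -- Every truncated count and the combined mass are at least 1/e, so each output coordinate is at
  -- least the product of 1 / (e N') and 1 / (e B').
  have hA : ∀ i, 1 / (e * N' * (e * B')) ≤ output (1 / 2) τ ε x x' w i := fun i => by
    unfold output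
    rw [← hL, ← hN, ← hb]
    have h1 : 1 / (e * N' * (e * B')) = 1 / N' * (1 / e) * (1 / e / B') := by field_simp
    rw [h1]
    split_ifs with h
    · have hm : 1 / e ≤ mass τ ε x x' w := by
        unfold mass; rw [← hL, ← he, if_neg (Finset.ne_empty_of_mem h)]; exact le_max_right _ _
      have hBB : ∑ j ∈ L, b j ≤ B' := by
        rw [Finset.sum_congr rfl hbL]
        exact Finset.sum_le_univ_sum_of_nonneg fun i => he0.le.trans (hc1 i)
      have hB0 : 0 < ∑ j ∈ L, b j := he0.trans_le (hsingle L i h)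
      have := hb1 i
      have : 0 ≤ b i := he0.le.trans (hb1 i)
      have := hmy.1
      gcongr
    · calc 1 / N' * (1 / e) * (1 / e / B') ≤ 1 / N' * (1 / e) * 1 := by
            gcongr; rwa [div_le_one hB'0]
        _ ≤ 1 / N * b i := by rw [mul_one]; have := hb1 i; gcongr
  have hpos : 0 < 1 / (e * N' * (e * B')) := by positivity
  -- Linearization of the logarithm at `d`, the order of the expected values of e N' and e B' when n
  -- e ≤ 2.
  have hlogd : ∀ v : ℝ, 0 < v → Real.log v ≤ v / d - 1 + Real.log d := fun v hv => by
    have := Real.log_le_sub_one_of_pos (x := v / d) (by positivity)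
    rw [Real.log_div hv.ne' hd0.ne'] at this
    linarith
  rw [kl, if_neg (by push Not; exact fun i _ => (hpos.trans_le (hA i)).ne')]
  refine ENNReal.ofReal_le_ofReal ?_
  have hterm : ∀ i, p i * Real.log (p i / output (1 / 2) τ ε x x' w i) ≤
      p i * Real.log (e * N' * (e * B')) := fun i => by
    rcases (simplex_nonneg p i).eq_or_lt with h | h
    · rw [← h]; simp
    · gcongr
      · exact div_pos h (hpos.trans_le (hA i))
      · rw [div_le_iff₀ (hpos.trans_le (hA i))]
        have h2 := mul_le_mul_of_nonneg_left (hA i) (show 0 ≤ e * N' * (e * B') by positivity)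
        rw [mul_one_div, div_self (by positivity)] at h2
        exact (simplex_le_one p i).trans h2
  calc ∑ i, p i * Real.log (p i / output (1 / 2) τ ε x x' w i)
      ≤ ∑ i, p i * Real.log (e * N' * (e * B')) := Finset.sum_le_sum fun i _ => hterm i
    _ = Real.log (e * N') + Real.log (e * B') := by
        rw [← Finset.sum_mul, simplex_sum, one_mul, Real.log_mul (by positivity) (by positivity)]
    _ ≤ e * N' / d - 1 + Real.log d + (e * B' / d - 1 + Real.log d) :=
        add_le_add (hlogd _ (by positivity)) (hlogd _ (by positivity))
    _ ≤ 2 * Real.log d + e / d * (N' + B') := by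
        have : e * N' / d + e * B' / d = e / d * (N' + B') := by ring
        linarith
    _ = 2 * Real.log d + e / d * (y + ∑ i, (2 * c₁ i + c₂ i)) := by
        rw [hN', hB', add_assoc, ← Finset.sum_add_distrib]
        congr 3
        exact Finset.sum_congr rfl fun i _ => by ring

theorem log_natCast_ge {d : ℕ} (hd : 2 ≤ d) : 0.69 ≤ Real.log d := by
  have h1 : Real.log 2 ≤ Real.log d := Real.log_le_log two_pos (by exact_mod_cast hd)
  linarith [Real.log_two_gt_d9]

/-- The expected error is at most logarithmic in the number of symbols if the sample is smaller than
the scale of the noise. -/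
theorem samplingTwiceKL_le_log {d n : ℕ} (hd : 2 ≤ d) {ε : ℝ} (τ : ℝ) (hε : 0 < ε)
    (hne : n * min ε 1 ≤ 2) (p : stdSimplex ℝ (Fin d)) :
    samplingTwiceKL (1 / 2) τ ε n p ≤ ENNReal.ofReal (60 * Real.log d) := by
  have hd0 : (0 : ℝ) < d := by exact_mod_cast (by omega : 0 < d)
  have hlog2 := log_natCast_ge hd
  set e := min ε 1 with he
  have he0 : 0 < e := by positivity
  have he1 : e ≤ 1 := min_le_right _ _
  have hm1 : (1 : ℝ) / 2 * n = n / 2 := by ring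
  have hm2 : (1 - (1 : ℝ) / 2) * n = n / 2 := by ring
  set μ₁ := firstLaw ε (n / 2) p with hμ₁
  set μ₂ := secondLaw ε (n / 2) p with hμ₂
  have : IsProbabilityMeasure μ₁ := isProbabilityMeasure_firstLaw hε
  have : IsProbabilityMeasure μ₂ := isProbabilityMeasure_secondLaw hε
  have hX : ∀ i, HasMGFBound (μ₁.prod μ₂) (fun w => (w.1.1 i : ℝ) + w.1.2 i) (n / 2 * p i) e :=
    fun i => (hasMGFBound_first hε (by positivity) i).comp measurePreserving_fst
  have hX' : ∀ i, HasMGFBound (μ₁.prod μ₂) (fun w => (w.2.1 i : ℝ) + w.2.2.2 i) (n / 2 * p i) e :=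
    fun i => (hasMGFBound_second hε (by positivity) i).comp measurePreserving_snd
  have hY : HasMGFBound (μ₁.prod μ₂) (fun w => (∑ i, (w.2.1 i : ℝ)) + w.2.2.1)
      (∑ i, n / 2 * p i) e :=
    (hasMGFBound_mass hε (by positivity) Finset.univ).comp measurePreserving_snd
  have hxm := fun i => (hX i).measurable
  have hxm' := fun i => (hX' i).measurable
  have hym := hY.measurable
  have hK : 0 ≤ e / d := by positivity
  have hl : ∀ i, 0 ≤ n / 2 * p i ∧ e * (n / 2 * p i) ≤ 1 := fun i => by
    have h0 := simplex_nonneg p i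
    have h1 := simplex_le_one p i
    refine ⟨by positivity, ?_⟩
    have : 0 ≤ e * (n / 2) := by positivity
    nlinarith
  have hc : ∀ y : ℝ, 0 ≤ e / d * max y (1 / e) := fun y =>
    mul_nonneg hK ((by positivity : 0 ≤ 1 / e).trans (le_max_right _ _))
  have hmX : ∀ i, Measurable fun w : ((Fin d → ℕ) × (Fin d → ℝ)) × (Fin d → ℕ) × ℝ × (Fin d → ℝ) =>
      2 * ENNReal.ofReal (e / d * max ((w.1.1 i : ℝ) + w.1.2 i) (1 / e)) := fun i =>
    (((hxm i).max measurable_const).const_mul _).ennreal_ofReal.const_mul _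
  have hmX' : ∀ i, Measurable fun w : ((Fin d → ℕ) × (Fin d → ℝ)) × (Fin d → ℕ) × ℝ × (Fin d → ℝ) =>
      ENNReal.ofReal (e / d * max ((w.2.1 i : ℝ) + w.2.2.2 i) (1 / e)) := fun i =>
    (((hxm' i).max measurable_const).const_mul _).ennreal_ofReal
  have hmY : Measurable fun w : ((Fin d → ℕ) × (Fin d → ℝ)) × (Fin d → ℕ) × ℝ × (Fin d → ℝ) =>
      ENNReal.ofReal (e / d * max ((∑ i, (w.2.1 i : ℝ)) + w.2.2.1) (1 / e)) :=
    ((hym.max measurable_const).const_mul _).ennreal_ofReal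
  have hmXX : ∀ i, Measurable fun w : ((Fin d → ℕ) × (Fin d → ℝ)) × (Fin d → ℕ) × ℝ × (Fin d → ℝ) =>
      2 * ENNReal.ofReal (e / d * max ((w.1.1 i : ℝ) + w.1.2 i) (1 / e)) +
        ENNReal.ofReal (e / d * max ((w.2.1 i : ℝ) + w.2.2.2 i) (1 / e)) := fun i =>
    (hmX i).add (hmX' i)
  have hmYS := hmY.add (Finset.measurable_sum Finset.univ fun i _ => hmXX i)
  refine (samplingTwiceKL_le hε p (G := fun w => ENNReal.ofReal (2 * Real.log d) +
    (ENNReal.ofReal (e / d * max ((∑ i, (w.2.1 i : ℝ)) + w.2.2.1) (1 / e)) +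
      ∑ i, (2 * ENNReal.ofReal (e / d * max ((w.1.1 i : ℝ) + w.1.2 i) (1 / e)) +
        ENNReal.ofReal (e / d * max ((w.2.1 i : ℝ) + w.2.2.2 i) (1 / e)))))
    (measurable_const.add hmYS)
    fun x z x' ζ z' => (kl_output_le_log (by omega) p τ hε x x').trans (le_of_eq ?_)).trans ?_
  · rw [← he, mul_add, Finset.mul_sum, ENNReal.ofReal_add (by positivity)
      (add_nonneg (hc _) (Finset.sum_nonneg fun i _ => by
        rw [mul_add, mul_left_comm]; exact add_nonneg (mul_nonneg zero_le_two (hc _)) (hc _))),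
      ENNReal.ofReal_add (hc _) (Finset.sum_nonneg fun i _ => by
        rw [mul_add, mul_left_comm]; exact add_nonneg (mul_nonneg zero_le_two (hc _)) (hc _)),
      ENNReal.ofReal_sum_of_nonneg fun i _ => by
        rw [mul_add, mul_left_comm]; exact add_nonneg (mul_nonneg zero_le_two (hc _)) (hc _)]
    congr 2
    refine Finset.sum_congr rfl fun i _ => ?_
    rw [mul_add, mul_left_comm, ENNReal.ofReal_add (mul_nonneg zero_le_two (hc _)) (hc _),
      ENNReal.ofReal_mul zero_le_two, ENNReal.ofReal_ofNat]
    rfl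
  · rw [hm1, hm2, lintegral_add_left measurable_const, lintegral_add_left hmY,
      lintegral_finsetSum _ fun i _ => hmXX i, lintegral_const, measure_univ, mul_one]
    have hb : ∀ i, ∫⁻ w, (2 * ENNReal.ofReal (e / d * max ((w.1.1 i : ℝ) + w.1.2 i) (1 / e)) +
        ENNReal.ofReal (e / d * max ((w.2.1 i : ℝ) + w.2.2.2 i) (1 / e))) ∂(μ₁.prod μ₂) ≤
        ENNReal.ofReal (27 / d) := fun i => by
      rw [lintegral_add_left (hmX i), lintegral_const_mul' _ _ (by norm_num)]
      refine (add_le_add (mul_le_mul_right ((hX i).lintegral_max_le he0 he1 (hl i).1 (hl i).2 hK) _)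
        ((hX' i).lintegral_max_le he0 he1 (hl i).1 (hl i).2 hK)).trans (le_of_eq ?_)
      rw [← ENNReal.ofReal_ofNat, ← ENNReal.ofReal_mul zero_le_two,
        ← ENNReal.ofReal_add (by positivity) (by positivity)]
      congr 1
      field_simp; norm_num
    have hlY : ∑ i, n / 2 * p i = (n : ℝ) / 2 := by rw [← Finset.mul_sum, simplex_sum, mul_one]
    refine (add_le_add le_rfl (add_le_add (hY.lintegral_max_le he0 he1 (by rw [hlY]; positivity)
      (by rw [hlY]; linarith) hK) (Finset.sum_le_sum fun i _ => hb i))).trans ?_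
    rw [Finset.sum_const, Finset.card_univ, Fintype.card_fin, nsmul_eq_mul,
      ← ENNReal.ofReal_natCast, ← ENNReal.ofReal_mul hd0.le,
      ← ENNReal.ofReal_add (by positivity) (by positivity),
      ← ENNReal.ofReal_add (by positivity) (by positivity)]
    refine ENNReal.ofReal_le_ofReal ?_
    have h1 : 9 * (e / d / e) ≤ 9 := by
      have : e / d / e = 1 / (d : ℝ) := by field_simp
      rw [this]
      have : 1 / (d : ℝ) ≤ 1 := by
        rw [div_le_one hd0]; exact_mod_cast (by omega : 1 ≤ d)
      linarith
    have h2 : (d : ℝ) * (27 / d) = 27 := by field_simp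
    linarith

end

end PrivateKL

/-! ### Matching the upper and lower bounds. -/

namespace PrivateKL

noncomputable section

theorem ofReal_le_mul_of_le {a b K : ℝ} {c : ℝ≥0∞} (hK : 0 ≤ K) (hab : a ≤ K * b)
    (h : ENNReal.ofReal b ≤ c) : ENNReal.ofReal a ≤ ENNReal.ofReal K * c := by
  refine (ENNReal.ofReal_le_ofReal hab).trans ?_
  rw [ENNReal.ofReal_mul hK]
  gcongr

/-- The cost of the symbols of small mass is matched by the lower bound, for a suitable choice of
the ratio `M` in the upper bound. -/
theorem exists_sum_small_le {d n : ℕ} (hd : 2 ≤ d) (hn : 1 ≤ n) {e : ℝ} (he : 0 < e)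
    (he1 : e ≤ 1) (hE : 2 < n * e) (p : stdSimplex ℝ (Fin d)) {r : ℝ}
    (hr : r = 24 * Real.log d / (n * e)) {S : Finset (Fin d)}
    (hS : S = Finset.univ.filter fun i => p i ≤ r) (hS0 : S.Nonempty) :
    ∃ M : ℝ, 1 ≤ M ∧ Real.log M ≤ 1 + Real.log d ∧
      ENNReal.ofReal (1 / n * (∑ i ∈ S, (n / 2 * p i * Real.log M +
        16800 * (min (n / 2 * p i) (1 / e) + 1 / (e * M))) + 1 / e)) ≤
        ENNReal.ofReal (2 * 10 ^ 8) * lowerDP e e p n (nbhdAdd r) := by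
  have hn0 : (0 : ℝ) < n := by exact_mod_cast hn
  have hlog := log_natCast_ge hd
  set E : ℝ := n * e with hEdef
  have hE0 : 0 < E := by positivity
  set P : ℝ := ∑ i ∈ S, p i with hP
  have hP0 : 0 ≤ P := Finset.sum_nonneg fun i _ => simplex_nonneg p i
  set k := S.card with hk
  have hk1 : 1 ≤ k := hS0.card_pos
  have hk1' : (1 : ℝ) ≤ k := by exact_mod_cast hk1
  have hkd : Real.log k ≤ Real.log d := by
    refine Real.log_le_log (by linarith) ?_
    have : k ≤ d := by simpa using Finset.card_le_univ S
    exact_mod_cast this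
  have hlogk : 0 ≤ Real.log k := Real.log_nonneg hk1'
  have hE1 : 0 < 1 / E := by positivity
  have hr2 : 2 / E ≤ r := by rw [hr]; gcongr; linarith
  have hr32 : 1 / (32 * E) ≤ r := by
    refine le_trans ?_ hr2
    rw [div_le_div_iff₀ (by positivity) hE0]; linarith
  have hmem : ∀ i ∈ S, p i ≤ r := fun i hi => by rw [hS] at hi; simpa using hi
  -- The choice M = 1: every light symbol costs 1/E.
  have hone : 1 / n * (∑ i ∈ S, (n / 2 * p i * Real.log 1 +
      16800 * (min (n / 2 * p i) (1 / e) + 1 / (e * 1))) + 1 / e) ≤ 33601 * (k / E) := by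
    have h1 : ∀ i ∈ S, n / 2 * p i * Real.log 1 +
        16800 * (min (n / 2 * p i) (1 / e) + 1 / (e * 1)) ≤ 33600 * (1 / e) := fun i _ => by
      rw [Real.log_one, mul_zero, mul_one]
      linarith [min_le_right (n / 2 * p i) (1 / e)]
    have h2 := Finset.sum_le_sum h1
    rw [Finset.sum_const, nsmul_eq_mul, ← hk] at h2
    have h3 : 1 / e ≤ k * (1 / e) := le_mul_of_one_le_left (by positivity) hk1'
    calc _ ≤ 1 / n * (k * (33600 * (1 / e)) + k * (1 / e)) := by gcongr
      _ = _ := by rw [hEdef]; field_simp; norm_num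
  -- The general form P ln M + P + k / (E M) + 1/E, up to constants, in which `M` is then chosen.
  have hgen : ∀ M : ℝ, 1 / n * (∑ i ∈ S, (n / 2 * p i * Real.log M +
      16800 * (min (n / 2 * p i) (1 / e) + 1 / (e * M))) + 1 / e) ≤
      P / 2 * Real.log M + 8400 * P + 16800 * (k / (E * M)) + 1 / E := fun M => by
    have h1 : ∀ i ∈ S, n / 2 * p i * Real.log M +
        16800 * (min (n / 2 * p i) (1 / e) + 1 / (e * M)) ≤
        n / 2 * p i * Real.log M + 16800 * (n / 2 * p i + 1 / (e * M)) := fun i _ => by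
      linarith [min_le_left (n / 2 * p i) (1 / e)]
    have h3 : ∑ i ∈ S, (n / 2 * p i * Real.log M + 16800 * (n / 2 * p i + 1 / (e * M))) =
        n / 2 * P * Real.log M + 16800 * (n / 2 * P + k * (1 / (e * M))) := by
      rw [Finset.sum_add_distrib, ← Finset.mul_sum, Finset.sum_add_distrib, Finset.sum_const,
        nsmul_eq_mul, ← Finset.sum_mul, ← Finset.mul_sum]
    have h2 := (Finset.sum_le_sum h1).trans_eq h3
    calc _ ≤ 1 / n * (n / 2 * P * Real.log M + 16800 * (n / 2 * P + k * (1 / (e * M))) + 1 / e) := by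
          gcongr
      _ = 1 / n * n * (P / 2 * Real.log M + 8400 * P) + 16800 * (k * (1 / n * (1 / (e * M)))) +
          1 / n * (1 / e) := by ring
      _ = _ := by
          rw [one_div_mul_cancel hn0.ne', one_div_mul_one_div, one_div_mul_one_div, hEdef,
            ← mul_assoc (n : ℝ) e M]
          ring
  have he3 : (1 : ℝ) ≤ Real.exp 1 := Real.one_le_exp zero_le_one
  have hloge : ∀ y : ℝ, 0 < y → Real.log (Real.exp 1 * y) = 1 + Real.log y := fun y hy => by
    rw [Real.log_mul (Real.exp_pos 1).ne' hy.ne', Real.log_exp]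
  -- If P is at most of order 1/E, the choice M = exp 1 · k makes k / (E M) ≤ 1/E, and the cost (1 +
  -- ln k) / E is that of one mass hidden among all light symbols.
  by_cases hEP : E * P ≤ 2
  · have hPE : P ≤ 2 * (1 / E) := by rw [mul_one_div, le_div_iff₀ hE0]; linarith
    have hSu : S ≠ Finset.univ := fun h => by
      rw [hP, h, simplex_sum] at hEP; linarith
    refine ⟨Real.exp 1 * k, by nlinarith, by rw [hloge k (by linarith)]; linarith, ?_⟩
    refine ofReal_le_mul_of_le (by norm_num) ((hgen _).trans ?_)
      (le_lowerDP_nbhdAdd_of_sum_le hn he he1 p hr32 hS hS0 hSu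
        (by rw [← hP]; refine hPE.trans ?_; rw [mul_one_div]; exact hr2))
    rw [hloge k (by linarith), ← hEdef, ← hk]
    have h1 : k / (E * (Real.exp 1 * k)) ≤ 1 / E := by
      rw [div_le_div_iff₀ (by positivity) hE0]
      nlinarith [mul_pos hE0 (show (0 : ℝ) < k by linarith)]
    have h2 : P / 2 * (1 + Real.log k) ≤ 1 / E * (1 + Real.log k) :=
      mul_le_mul_of_nonneg_right (by linarith) (by linarith)
    have h3 : 1 / (32 * E) * (1 + Real.log k) / 32 = 1 / E * (1 + Real.log k) / 1024 := by
      field_simp; norm_num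
    rw [h3]
    nlinarith [mul_nonneg hE1.le hlogk]
  push Not at hEP
  -- A single light symbol cannot be paired with another one, but its mass is at most r, so the
  -- single-block bound still applies.
  rcases hk1.eq_or_lt with hk1e | hk2
  · obtain ⟨i, hi⟩ := Finset.card_eq_one.1 hk1e.symm
    have hSu : S ≠ Finset.univ := fun h => by
      have : k = d := by rw [hk, h]; simp
      omega
    refine ⟨1, le_rfl, by rw [Real.log_one]; linarith, ?_⟩
    refine ofReal_le_mul_of_le (by norm_num) (hone.trans ?_)
      (le_lowerDP_nbhdAdd_of_sum_le hn he he1 p hr32 hS hS0 hSu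
        (by rw [hi, Finset.sum_singleton]; exact hmem i (by rw [hi]; simp)))
    rw [← hEdef, ← hk, ← hk1e, Nat.cast_one, Real.log_one]
    have h3 : 1 / (32 * E) * (1 + 0) / 32 = 1 / E / 1024 := by
      field_simp; norm_num
    rw [h3]
    linarith
  -- If the light symbols have average mass at least 1 / (16 E), the cost k/E is matched by pairs.
  -- Otherwise M = exp 1 · k / (E P) balances P ln M against k / (E M), and the sparse blocks match
  -- P (1 + ln M).
  rcases le_total (k : ℝ) (16 * (E * P)) with hkP | hkP
  · refine ⟨1, le_rfl, by rw [Real.log_one]; linarith, ?_⟩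
    refine ofReal_le_mul_of_le (by norm_num) (hone.trans ?_)
      (le_lowerDP_nbhdAdd_of_dense hn he he1 p hr32 hmem hk2 hkP)
    rw [← hEdef, ← hk]
    have h3 : (k : ℝ) / (3072 * E) = k / E / 3072 := by field_simp
    have h4 : 0 ≤ (k : ℝ) / E := by positivity
    rw [h3]
    linarith
  · have hEP0 : 0 < E * P := by linarith
    have hPpos : 0 < P := by by_contra h; push Not at h; nlinarith
    set x : ℝ := k / (E * P) with hx
    have hx16 : 16 ≤ x := by rw [hx, le_div_iff₀ hEP0]; linarith
    have hxk : x ≤ k := div_le_self (by linarith) (by linarith)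
    have hlogx : 0 ≤ Real.log x := Real.log_nonneg (by linarith)
    have hlogxd : Real.log x ≤ Real.log d := (Real.log_le_log (by linarith) hxk).trans hkd
    refine ⟨Real.exp 1 * x, by nlinarith, by rw [hloge x (by linarith)]; linarith, ?_⟩
    refine ofReal_le_mul_of_le (by norm_num) ((hgen _).trans ?_)
      (le_lowerDP_nbhdAdd_of_sparse hn he he1 p hr2 hmem hEP.le hkP)
    rw [hloge x (by linarith), ← hEdef, ← hk, ← hP, ← hx]
    have h1 : k / (E * (Real.exp 1 * x)) ≤ P := by
      rw [div_le_iff₀ (by positivity)]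
      have h4 : (k : ℝ) = E * P * x := by rw [hx]; field_simp
      have h5 : 0 < E * P * x := by rw [← h4]; linarith
      calc (k : ℝ) = E * P * x := h4
        _ ≤ Real.exp 1 * (E * P * x) := le_mul_of_one_le_left h5.le he3
        _ = _ := by ring
    have h2 : 1 / E ≤ P := by rw [div_le_iff₀ hE0]; nlinarith
    nlinarith [mul_nonneg hP0 hlogx]

/-- The cost of the symbols of large mass is matched by the lower bounds. -/
theorem sum_large_le {d n : ℕ} (hn : 1 ≤ n) {e : ℝ} (he : 0 < e) (he1 : e ≤ 1)
    (p : stdSimplex ℝ (Fin d)) {U : Finset (Fin d)} (hU : 2 ≤ U.card)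
    (hp : ∀ i ∈ U, 1 / (n * e) < p i) :
    ENNReal.ofReal (1 / n * ∑ i ∈ U, (1 + 1 / (e ^ 2 * (n / 2 * p i)))) ≤
      ENNReal.ofReal (2 * 10 ^ 6) * (lower p n (nbhdStat n) +
        if e < 1 then lowerDP e e p n (nbhdAdd (1 / (n * e))) else 0) := by
  have hn0 : (0 : ℝ) < n := by exact_mod_cast hn
  have hp0 : ∀ i ∈ U, 0 < p i := fun i hi => lt_trans (by positivity) (hp i hi)
  have hpn : ∀ i ∈ U, 1 / (n : ℝ) ≤ p i := fun i hi => by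
    refine le_trans ?_ (hp i hi).le
    exact one_div_le_one_div_of_le (by positivity) (mul_le_of_le_one_right hn0.le he1)
  have hs := card_div_le_lower_nbhdStat hn p U hU hpn
  have hsplit : 1 / (n : ℝ) * ∑ i ∈ U, (1 + 1 / (e ^ 2 * (n / 2 * p i))) =
      U.card / n + ∑ i ∈ U, 1 / n * (1 / (e ^ 2 * (n / 2 * p i))) := by
    rw [Finset.sum_add_distrib, Finset.sum_const, nsmul_eq_mul, mul_one, mul_add, Finset.mul_sum]
    ring
  have hc : 0 ≤ (U.card : ℝ) / n := by positivity
  have hcard : (U.card : ℝ) / (196608 * n) = U.card / n / 196608 := by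
    rw [mul_comm, div_div]
  rw [hsplit]
  split_ifs with h1
  · rw [ENNReal.ofReal_add hc (Finset.sum_nonneg fun i hi => by have := hp0 i hi; positivity),
      mul_add]
    refine add_le_add (ofReal_le_mul_of_le (by norm_num) (by rw [hcard]; linarith) hs)
      (ofReal_le_mul_of_le (by norm_num) ?_ (sum_div_le_lowerDP_nbhdAdd hn he he1 p U hU hp))
    rw [Finset.mul_sum]
    refine Finset.sum_le_sum fun i hi => ?_
    have hpi := hp0 i hi
    have h2 : 1 / n * (1 / (e ^ 2 * (n / 2 * p i))) = 2 * (1 / ((n * e) ^ 2 * p i)) := by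
      field_simp
    have h3 : 1 / (786432 * (n * e) ^ 2 * p i) = 1 / ((n * e) ^ 2 * p i) / 786432 := by
      field_simp
    have h4 : 0 ≤ 1 / ((n * e) ^ 2 * p i) := by positivity
    rw [h2, h3]; linarith
  -- For e = 1 the privacy cost 1 / (n² p_i) is at most 1/n, so the statistical bound alone
  -- suffices.
  · have hee : e = 1 := le_antisymm he1 (not_lt.1 h1)
    subst hee
    rw [add_zero]
    refine ofReal_le_mul_of_le (by norm_num) ?_ hs
    have h2 : ∑ i ∈ U, 1 / n * (1 / ((1 : ℝ) ^ 2 * (n / 2 * p i))) ≤ ∑ i ∈ U, 2 * (1 / (n : ℝ)) := by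
      refine Finset.sum_le_sum fun i hi => ?_
      have hpi := hp0 i hi
      have h3 := hp i hi
      rw [mul_one, div_lt_iff₀ hn0] at h3
      rw [mul_comm]
      gcongr
      rw [div_le_iff₀ (by positivity)]
      nlinarith
    rw [Finset.sum_const, nsmul_eq_mul] at h2
    have h4 : (U.card : ℝ) * (2 * (1 / n)) = 2 * (U.card / n) := by ring
    rw [hcard]; linarith

/-- The error of the algorithm, with `e = min {ε, 1}`, is at most a constant times the lower
bounds. -/
theorem samplingTwiceKL_le_lower {d n : ℕ} (hd : 2 ≤ d) (hn : 1 ≤ n) {ε : ℝ} (hε : 0 < ε)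
    (p : stdSimplex ℝ (Fin d)) :
    samplingTwiceKL (1 / 2) (4 * Real.log d) ε n p ≤ ENNReal.ofReal (10 ^ 15) *
      (lower p n (nbhdStat n) +
        (if min ε 1 < 1 then lowerDP (min ε 1) (min ε 1) p n (nbhdAdd (1 / (n * min ε 1))) else 0) +
        lowerDP (min ε 1) (min ε 1) p n (nbhdAdd (24 * Real.log d / (n * min ε 1)))) := by
  have hn0 : (0 : ℝ) < n := by exact_mod_cast hn
  have hlog := log_natCast_ge hd
  rcases le_or_gt (n * min ε 1) 2 with hE | hE
  · set e := min ε 1 with he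
    have he0 : 0 < e := by positivity
    have he1 : e ≤ 1 := min_le_right _ _
    have hE0 : 0 < n * e := by positivity
    have hr : 1 ≤ 24 * Real.log d / (n * e) := by rw [le_div_iff₀ hE0]; linarith
    refine (samplingTwiceKL_le_log hd _ hε hE p).trans (le_trans (ofReal_le_mul_of_le (by norm_num)
      ?_ (le_lowerDP_nbhdAdd_of_one_le hd hn he0 he1 p hr)) (mul_le_mul_right le_add_self _))
    have h1 : 1 / 64 ≤ min (1 / (32 * (n * e))) 1 := by
      refine le_min ?_ (by norm_num)
      rw [div_le_div_iff₀ (by norm_num) (by positivity)]; linarith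
    have h2 : Real.log d ≤ 1 + Real.log (d - 1 : ℕ) := by
      have h3 : (0 : ℝ) < (d - 1 : ℕ) := by exact_mod_cast (by omega : 0 < d - 1)
      have h4 : (d : ℝ) ≤ Real.exp 1 * (d - 1 : ℕ) := by
        have h5 : (d : ℝ) ≤ 2 * (d - 1 : ℕ) := by exact_mod_cast (by omega : d ≤ 2 * (d - 1))
        nlinarith [Real.exp_one_gt_d9]
      have := Real.log_le_log (by linarith [show (2 : ℝ) ≤ d by exact_mod_cast hd]) h4
      rwa [Real.log_mul (Real.exp_pos 1).ne' h3.ne', Real.log_exp] at this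
    calc 60 * Real.log d ≤ 10 ^ 15 * (1 / 64 * Real.log d / 32) := by linarith
      _ ≤ _ := by gcongr
  · set r : ℝ := 24 * Real.log d / (n * min ε 1) with hr
    set S : Finset (Fin d) := Finset.univ.filter fun i => p i ≤ r with hS
    have he0 : 0 < min ε 1 := by positivity
    have he1 : min ε 1 ≤ 1 := min_le_right _ _
    have hE0 : 0 < n * min ε 1 := by positivity
    have hSr : ∀ i ∉ S, r < p i := fun i hi => by simpa [hS] using hi
    -- This is where t = 6 τ enters: the half sample gives a heavy symbol a mean of at least 3 τ /
    -- e, three times the threshold.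
    have hSτ : ∀ i ∉ S, 3 * (4 * Real.log d) ≤ min ε 1 * (n / 2 * p i) := fun i hi => by
      have h := hSr i hi
      rw [hr, div_lt_iff₀ hE0] at h
      linarith
    have hcompl : ∀ i ∈ Sᶜ, 1 / (n * min ε 1) < p i := fun i hi => by
      refine lt_of_le_of_lt ?_ (hSr i (Finset.mem_compl.1 hi))
      rw [hr]; gcongr; linarith
    have hup := fun M => samplingTwiceKL_le_sum (M := M) hn hε p S hSτ (by linarith)
    set e := min ε 1 with he
    have hτ4 : 1 + 4 * Real.log d / 4 = 1 + Real.log d := by ring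
    set LS := lower p n (nbhdStat n)
    set LB := if e < 1 then lowerDP e e p n (nbhdAdd (1 / (n * e))) else 0 with hLB
    set LC := lowerDP e e p n (nbhdAdd r) with hLC
    have hlarge0 : ∀ i ∈ Sᶜ, 0 ≤ 1 + 1 / (e ^ 2 * (n / 2 * p i)) := fun i _ => by
      have := simplex_nonneg p i; positivity
    have hUB : ∀ (M : ℝ), 1 ≤ M → Real.log M ≤ 1 + Real.log d →
        samplingTwiceKL (1 / 2) (4 * Real.log d) ε n p ≤ ENNReal.ofReal
          (212400 * (1 / n * ∑ i ∈ Sᶜ, (1 + 1 / (e ^ 2 * (n / 2 * p i))))) + ENNReal.ofReal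
          (16800 * (1 / n * (∑ i ∈ S, (n / 2 * p i * Real.log M +
            16800 * (min (n / 2 * p i) (1 / e) + 1 / (e * M))) + if S = ∅ then 0 else 1 / e))) :=
      fun M h1 h2 => by
        have hs0 : 0 ≤ ∑ i ∈ S, (n / 2 * p i * Real.log M +
            16800 * (min (n / 2 * p i) (1 / e) + 1 / (e * M))) := Finset.sum_nonneg fun i _ => by
          have h3 := simplex_nonneg p i
          have h4 := Real.log_nonneg h1
          have h5 : 0 ≤ min (n / 2 * p i) (1 / e) := le_min (by positivity) (by positivity)
          positivity
        have hl0 := Finset.sum_nonneg hlarge0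
        have hif : (if S = ∅ then 0 else 8400 / e) = 8400 * if S = ∅ then 0 else 1 / e := by
          split_ifs <;> ring
        have hif0 : 0 ≤ if S = ∅ then 0 else 1 / e := by split_ifs <;> positivity
        refine (hup M h1 (by rw [hτ4]; exact h2)).trans ?_
        rw [← ENNReal.ofReal_add (by positivity) (by positivity), hif, ← Finset.mul_sum]
        refine ENNReal.ofReal_le_ofReal ?_
        have h6 : 2 / (n : ℝ) = 2 * (1 / n) := by ring
        have hn1 : 0 < 1 / (n : ℝ) := by positivity
        rw [h6]
        nlinarith [mul_nonneg hn1.le hs0]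
    -- The lower bounds for heavy symbols come from pairs and need at least two of them.
    by_cases hm : 2 ≤ Sᶜ.card
    · have hL := sum_large_le hn he0 he1 p hm hcompl
      have hLfin : ENNReal.ofReal
          (212400 * (1 / n * ∑ i ∈ Sᶜ, (1 + 1 / (e ^ 2 * (n / 2 * p i))))) ≤
          ENNReal.ofReal (10 ^ 15) * (LS + LB) := by
        rw [ENNReal.ofReal_mul (by norm_num)]
        refine (mul_le_mul_right hL _).trans ?_
        rw [← mul_assoc, ← ENNReal.ofReal_mul (by norm_num)]
        gcongr; norm_num
      rcases S.eq_empty_or_nonempty with h | h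
      · refine (hUB 1 le_rfl (by rw [Real.log_one]; linarith)).trans ?_
        rw [mul_add _ (LS + LB)]
        refine add_le_add hLfin (le_trans (le_of_eq ?_) zero_le)
        rw [h]; simp
      · obtain ⟨M, h1, h2, h3⟩ := exists_sum_small_le hd hn he0 he1 hE p hr hS h
        refine (hUB M h1 h2).trans ?_
        rw [mul_add _ (LS + LB)]
        refine add_le_add hLfin ?_
        rw [if_neg h.ne_empty, ENNReal.ofReal_mul (by norm_num)]
        refine (mul_le_mul_right h3 _).trans ?_
        rw [← mul_assoc, ← ENNReal.ofReal_mul (by norm_num)]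
        gcongr; norm_num
    -- At most one symbol is heavy. Its cost is O(1/E) and is charged to the summand 1/e of the
    -- light part, which is present because d ≥ 2 leaves a light symbol.
    · have h : S.Nonempty := by
        by_contra h
        rw [Finset.not_nonempty_iff_eq_empty] at h
        rw [h] at hm; simp at hm; omega
      obtain ⟨M, h1, h2, h3⟩ := exists_sum_small_le hd hn he0 he1 hE p hr hS h
      refine (hUB M h1 h2).trans (le_trans ?_ (mul_le_mul_right le_add_self _))
      rw [if_neg h.ne_empty]
      have hl : ∑ i ∈ Sᶜ, (1 + 1 / (e ^ 2 * (n / 2 * p i))) ≤ 2 * (1 / e) := by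
        have h4 : ∀ i ∈ Sᶜ, 1 + 1 / (e ^ 2 * (n / 2 * p i)) ≤ 2 * (1 / e) := fun i hi => by
          have h5 : 1 ≤ e * (n / 2 * p i) := by linarith [hSτ i (Finset.mem_compl.1 hi)]
          have h6 : 1 ≤ 1 / e := by rw [le_div_iff₀ he0]; linarith
          have h7 : 1 / (e ^ 2 * (n / 2 * p i)) ≤ 1 / e :=
            one_div_le_one_div_of_le he0 (by nlinarith)
          linarith
        refine (Finset.sum_le_card_nsmul _ _ _ h4).trans ?_
        rw [nsmul_eq_mul]
        have : (Sᶜ.card : ℝ) ≤ 1 := by exact_mod_cast (by omega : Sᶜ.card ≤ 1)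
        exact mul_le_of_le_one_left (by positivity) this
      have hl0 := Finset.sum_nonneg hlarge0
      have hn1 : 0 < 1 / (n : ℝ) := by positivity
      have hs0 : 0 ≤ ∑ i ∈ S, (n / 2 * p i * Real.log M +
          16800 * (min (n / 2 * p i) (1 / e) + 1 / (e * M))) := Finset.sum_nonneg fun i _ => by
        have h3 := simplex_nonneg p i
        have h4 := Real.log_nonneg h1
        have h5 : 0 ≤ min (n / 2 * p i) (1 / e) := le_min (by positivity) (by positivity)
        positivity
      rw [← ENNReal.ofReal_add (by positivity) (by positivity)]
      refine (ENNReal.ofReal_le_ofReal (q := 450000 * (1 / n * (∑ i ∈ S, (n / 2 * p i * Real.log M +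
          16800 * (min (n / 2 * p i) (1 / e) + 1 / (e * M))) + 1 / e))) ?_).trans ?_
      · have h4 := mul_le_mul_of_nonneg_left hl hn1.le
        nlinarith [mul_nonneg hn1.le hs0, mul_pos hn1 (show 0 < 1 / e by positivity)]
      · rw [ENNReal.ofReal_mul (by norm_num)]
        refine (mul_le_mul_right h3 _).trans ?_
        rw [← mul_assoc, ← ENNReal.ofReal_mul (by norm_num)]
        gcongr; norm_num

end

end PrivateKL

/-! ### Conclusion. -/

open PrivateKL
theorem mainTheorem1 :
    ∃ C : ℝ≥0, ∀ (d n : ℕ) (ε δ : ℝ) (p : stdSimplex ℝ (Fin d)),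
      2 ≤ d → 1 ≤ n → 0 < ε → 0 ≤ δ → δ ≤ ε →
      IsDP (fun s s' : (Fin d → ℕ) × (Fin d → ℕ) =>
          histDist s.1 s'.1 + histDist s.2 s'.2 ≤ 1) ε 0
        (samplingTwice (1 / 2) (4 * Real.log d) ε) ∧
      samplingTwiceKL (1 / 2) (4 * Real.log d) ε n p ≤
        C * (lower p n (nbhdStat n) + lower p n (nbhdAdd (24 * Real.log d / n)) +
          lowerDP ε δ p n (nbhdAdd (1 / (n * ε))) +
          lowerDP ε δ p n (nbhdAdd (24 * Real.log d / (n * ε)))) := by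
  refine ⟨Real.toNNReal (10 ^ 15), fun d n ε δ p hd hn hε _ hδε =>
    ⟨isDP_samplingTwice (by omega) _ _ hε, (samplingTwiceKL_le_lower hd hn hε p).trans ?_⟩⟩
  refine mul_le_mul_right ?_ (ENNReal.ofReal (10 ^ 15))
  -- For ε < 1 the (ε, ε)-private bounds are weakened to (ε, δ). For ε ≥ 1 the remaining private
  -- bound has parameters (1, 1), hence is at most the unrestricted one for N_{≤t/n}.
  rcases lt_or_ge ε 1 with h | h
  · rw [min_eq_left h.le, if_pos h]
    exact add_le_add (add_le_add le_self_add (lowerDP_le_lowerDP hδε p _))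
      (lowerDP_le_lowerDP hδε p _)
  · rw [min_eq_right h, if_neg (lt_irrefl 1), add_zero, mul_one]
    exact ((add_le_add le_rfl (lowerDP_one_le_lower p _)).trans le_self_add).trans le_self_add
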